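/- Let $F_3$ be the free group on $a_1,a_2,a_3$. In $\mathrm{Out}(F_3)$ let $\epsilon_i$ be the class of the automorphism inverting $a_i$ and fixing the other generators, $\Delta=\epsilon_1\epsilon_2\epsilon_3$, let $\sigma_{ij}$ ($i\ne j\le 3$) interchange $a_i$ and $a_j$, and let $\sigma_{i4}$ send $a_i\mapsto a_i^{-1}$ and $a_j\mapsto a_ja_i^{-1}$ for $j\neq i$. Put $S_3=\langle\sigma_{ij}: i,j\le 3\rangle$, $S_4=\langle\sigma_{ij}: i,j\le 4\rangle$ (symmetric groups, $\sigma_{ij}$ corresponding to the transposition of $i$ and $j$), $W_3=\langle \epsilon_1,\epsilon_2,\epsilon_3, S_3\rangle\cong\mathbb{Z}_2^3\rtimes S_3$ and $G_3=\langle\Delta,S_4\rangle\cong\mathbb{Z}_2\times S_4$; thus $S_3<W_3\cap G_3$. For $S_n$, the permutation representation is $\mathbb{C}^n$ with permuted coordinates, the standard representation is its subspace of vectors with coordinate sum zero, the determinant representation is the sign character, and "signed" means tensored with the sign character. A graph is a 1-dimensional CW complex; groups act on graphs by graph automorphisms, which may invert edges. The rank of a connected graph is the least number of generators of its fundamental group.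 The $n$-rose is the graph with one vertex and $n$ edges. A graph $X$ with an action of a group $G$ is $G$-admissible if it is connected, has no vertex of valence 2, and contains no $G$-invariant forest with at least one edge. Let $G\in\{W_3,G_3\}$ and let $X$ be a $G$-admissible graph of rank 5. Suppose that the induced representation of $G$ on $V=H_1(X,\mathbb{C})$ decomposes as $V=V_0\oplus V_1\oplus V_2\oplus V_3$ with $V_1\oplus V_2\neq 0$, where - if $G=W_3$: $V_i=\bigoplus_{|I|=i}E_I$, where for $I\subseteq\{1,2,3\}$ the space $E_I$ consists of the $v\in V$ with $\epsilon_iv=-v$ for $i\in I$ and $\epsilon_iv=v$ for $i\notin I$; and, as $S_3$-modules, $V_0$ is a (possibly empty) direct sum of trivial, $V_1$ of permutation, $V_2$ of signed permutation and $V_3$ of determinant representations; - if $G=G_3$: $\Delta$ acts as the identity on $V_0\oplus V_2$ and as minus the identity on $V_1\oplus V_3$; and, as $S_4$-modules, $V_0$ is a (possibly empty) direct sum of trivial, $V_1$ of standard, $V_2$ of signed standard and $V_3$ of determinant representations. Then $X$ contains a $G$-invariant subgraph $Y$ isomorphic to the 3-rose such that $H_1(Y,\mathbb{C})$, as an $S_3$-module,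 contains the standard representation of $S_3$. -/

import Mathlib

/-! ### Graphs (1-dimensional CW complexes) in combinatorial form -/

universe u v u' v'

set_option linter.checkUnivs false

/-- A graph, i.e. a 1-dimensional CW complex, given by its vertices and its oriented edges
("darts"). Each edge is a pair `{d, bar d}` of opposite darts; loops and multiple edges are
allowed, and an automorphism may invert an edge (send `d` to `bar d`). -/
structure CWGraph where
  Vert : Type u
  Dart : Type v
  /-- initial vertex of an oriented edge -/
  ι : Dart → Vert
  /-- reversal of orientation -/
  bar : Dart → Dart
  bar_bar : ∀ d, bar (bar d) = d
  bar_ne : ∀ d, bar d ≠ d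

namespace CWGraph

/-- Terminal vertex of an oriented edge. -/
def τ (X : CWGraph.{u, v}) (d : X.Dart) : X.Vert := X.ι (X.bar d)

/-- `X.IsWalk a l b`: the list of darts `l` is an edge path in `X` from `a` to `b`. -/
def IsWalk (X : CWGraph.{u, v}) : X.Vert → List X.Dart → X.Vert → Prop
  | a, [], b => a = b
  | a, d :: l, b => X.ι d = a ∧ X.IsWalk (X.τ d) l b

theorem IsWalk.append {X : CWGraph.{u, v}} {l m : List X.Dart} {a b c : X.Vert}
    (h : X.IsWalk a l b) (h' : X.IsWalk b m c) : X.IsWalk a (l ++ m) c := by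
  induction l generalizing a with
  | nil => simpa [show a = b from h] using h'
  | cons d l ih => exact ⟨h.1, ih h.2⟩

theorem IsWalk.reverse {X : CWGraph.{u, v}} {l : List X.Dart} {a b : X.Vert}
    (h : X.IsWalk a l b) : X.IsWalk b (l.map X.bar).reverse a := by
  induction l generalizing a with
  | nil => exact Eq.symm h
  | cons d l ih =>
    rw [List.map_cons, List.reverse_cons]
    exact (ih h.2).append ⟨rfl, by simp [τ, X.bar_bar, h.1, IsWalk]⟩

/-- A graph is connected if it is non-empty and any two vertices are joined by an edge path. -/
def Connected (X : CWGraph.{u, v}) : Prop :=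
  Nonempty X.Vert ∧ ∀ a b : X.Vert, ∃ l, X.IsWalk a l b

/-- The group generated by the darts of `X` with the relations `d * bar d = 1`
(the free group on the edges, once an orientation is chosen). -/
abbrev PathGroup (X : CWGraph.{u, v}) : Type v :=
  PresentedGroup {r : FreeGroup X.Dart | ∃ d, r = FreeGroup.of d * FreeGroup.of (X.bar d)}

/-- The class of a list of darts in the path group. On edge paths with given end points, two
lists have the same class exactly when they become equal after deleting backtracks, that is,
when the paths are homotopic relative to their end points. -/
def pathClass (X : CWGraph.{u, v}) (l : List X.Dart) : X.PathGroup :=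
  (l.map fun d => (PresentedGroup.of d : X.PathGroup)).prod

theorem of_mul_of_bar (X : CWGraph.{u, v}) (d : X.Dart) :
    (PresentedGroup.of d : X.PathGroup) * PresentedGroup.of (X.bar d) = 1 :=
  PresentedGroup.one_of_mem
    (rels := {r : FreeGroup X.Dart | ∃ d, r = FreeGroup.of d * FreeGroup.of (X.bar d)}) ⟨d, rfl⟩

theorem pathClass_reverse (X : CWGraph.{u, v}) (l : List X.Dart) :
    X.pathClass (l.map X.bar).reverse = (X.pathClass l)⁻¹ := by
  induction l with
  | nil => simp [pathClass]
  | cons d l ih =>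
    have h := eq_inv_of_mul_eq_one_right (X.of_mul_of_bar d)
    simp only [pathClass, List.map_cons, List.reverse_cons, List.map_append, List.prod_append,
      List.prod_cons, List.map_nil, List.prod_nil, mul_one, mul_inv_rev] at ih ⊢
    rw [ih, h]

/-- The (edge path) fundamental group of `X` at `a`: homotopy classes of closed edge paths at `a`,
under concatenation. -/
def π₁ (X : CWGraph.{u, v}) (a : X.Vert) : Subgroup X.PathGroup where
  carrier := {x | ∃ l, X.IsWalk a l a ∧ X.pathClass l = x}
  one_mem' := ⟨[], rfl, rfl⟩
  mul_mem' := by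
    rintro _ _ ⟨l, hl, rfl⟩ ⟨m, hm, rfl⟩
    exact ⟨l ++ m, hl.append hm, by simp [pathClass]⟩
  inv_mem' := by
    rintro _ ⟨l, hl, rfl⟩
    exact ⟨_, hl.reverse, X.pathClass_reverse l⟩

/-- `X` is connected of rank `n`: the least number of generators of its fundamental group
is `n`. -/
def HasRank (X : CWGraph.{u, v}) (n : ℕ) : Prop :=
  X.Connected ∧ ∀ a : X.Vert, ∃ _ : Group.FG (X.π₁ a), Group.rank (X.π₁ a) = n

/-- The valence of a vertex; a loop counts twice. -/
noncomputable def valence (X : CWGraph.{u, v}) (a : X.Vert) : ℕ∞ := {d | X.ι d = a}.encard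

/-- A forest: every closed edge path without backtracking is trivial. -/
def IsForest (X : CWGraph.{u, v}) : Prop :=
  ∀ (a : X.Vert) (l : List X.Dart), X.IsWalk a l a → l.IsChain (fun d e => e ≠ X.bar d) → l = []

/-- Isomorphisms of graphs. -/
structure Iso (X : CWGraph.{u, v}) (Y : CWGraph.{u', v'}) where
  vert : X.Vert ≃ Y.Vert
  dart : X.Dart ≃ Y.Dart
  map_ι : ∀ d, Y.ι (dart d) = vert (X.ι d)
  map_bar : ∀ d, Y.bar (dart d) = dart (X.bar d)

/-- The `n`-rose: one vertex and `n` edges. -/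
def rose (n : ℕ) : CWGraph.{0, 0} where
  Vert := Unit
  Dart := Fin n × Bool
  ι _ := ()
  bar d := (d.1, !d.2)
  bar_bar := by simp
  bar_ne d h := by simpa using congrArg Prod.snd h

/-- Subgraphs: sets of vertices and edges, containing with an edge also its end points. -/
structure Subgraph (X : CWGraph.{u, v}) where
  verts : Set X.Vert
  darts : Set X.Dart
  ι_mem : ∀ d ∈ darts, X.ι d ∈ verts
  bar_mem : ∀ d ∈ darts, X.bar d ∈ darts

/-- A subgraph as a graph in its own right. -/
def Subgraph.toGraph {X : CWGraph.{u, v}} (Y : X.Subgraph) : CWGraph.{u, v} where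
  Vert := Y.verts
  Dart := Y.darts
  ι d := ⟨X.ι d, Y.ι_mem d d.2⟩
  bar d := ⟨X.bar d, Y.bar_mem d d.2⟩
  bar_bar d := Subtype.ext (X.bar_bar d)
  bar_ne d h := X.bar_ne d (congrArg Subtype.val h)

/-- `H₁(X, ℂ)`, the kernel of the cellular boundary map. A 1-chain is a finitely supported choice
of weights on darts with `f (bar d) = - f d`; its boundary vanishes when at every vertex the
weights of the darts leaving it add up to zero. -/
noncomputable def H₁ (X : CWGraph.{u, v}) : Submodule ℂ (X.Dart →₀ ℂ) :=
  LinearMap.ker (Finsupp.lmapDomain ℂ ℂ X.bar + LinearMap.id) ⊓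
    LinearMap.ker (Finsupp.lmapDomain ℂ ℂ X.ι)

end CWGraph

/-- An action of a group on a graph by graph automorphisms (edges may be inverted). -/
structure GraphAction (G : Type*) [Group G] (X : CWGraph.{u, v}) where
  vert : G →* Equiv.Perm X.Vert
  dart : G →* Equiv.Perm X.Dart
  ι_dart : ∀ g d, X.ι (dart g d) = vert g (X.ι d)
  bar_dart : ∀ g d, X.bar (dart g d) = dart g (X.bar d)

namespace GraphAction

variable {G : Type*} [Group G] {X : CWGraph.{u, v}}

/-- Subgraphs preserved by the action. -/
def Invariant (a : GraphAction G X) (Y : X.Subgraph) : Prop :=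
  (∀ g, ∀ x ∈ Y.verts, a.vert g x ∈ Y.verts) ∧ (∀ g, ∀ d ∈ Y.darts, a.dart g d ∈ Y.darts)

/-- The action on an invariant subset. -/
def restrictPerm {α : Type*} (f : G →* Equiv.Perm α) (s : Set α) (h : ∀ g, ∀ x ∈ s, f g x ∈ s) :
    G →* Equiv.Perm s where
  toFun g :=
    { toFun := fun x => ⟨f g x, h g x x.2⟩
      invFun := fun x => ⟨f g⁻¹ x, h g⁻¹ x x.2⟩
      left_inv := fun x => Subtype.ext (by simp)
      right_inv := fun x => Subtype.ext (by simp) }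
  map_one' := Equiv.ext fun x => Subtype.ext (by simp)
  map_mul' g k := Equiv.ext fun x => Subtype.ext (by simp)

/-- The action on an invariant subgraph. -/
def restrict (a : GraphAction G X) (Y : X.Subgraph) (h : a.Invariant Y) :
    GraphAction G Y.toGraph where
  vert := restrictPerm a.vert Y.verts h.1
  dart := restrictPerm a.dart Y.darts h.2
  ι_dart g d := Subtype.ext (a.ι_dart g d.1)
  bar_dart g d := Subtype.ext (a.bar_dart g d.1)

/-- `X` is `G`-admissible: connected, without vertices of valence 2, and without an invariant
forest that has at least one edge. -/
def Admissible (a : GraphAction G X) : Prop :=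
  X.Connected ∧ (∀ x : X.Vert, X.valence x ≠ 2) ∧
    ¬ ∃ Y : X.Subgraph, a.Invariant Y ∧ Y.toGraph.IsForest ∧ Y.darts.Nonempty

/-- The action on weights of darts. -/
noncomputable def chainRep (a : GraphAction G X) : Representation ℂ G (X.Dart →₀ ℂ) where
  toFun g := Finsupp.lmapDomain ℂ ℂ (a.dart g)
  map_one' := by ext; simp
  map_mul' g k := by ext; simp

/-- The representation of `G` on `H₁(X, ℂ)` induced by the action. -/
noncomputable def homologyRep (a : GraphAction G X) : Representation ℂ G X.H₁ :=
  Subrepresentation.toRepresentation (ρ := a.chainRep)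
    { toSubmodule := X.H₁
      apply_mem_toSubmodule := by
        intro g f hf
        simp only [CWGraph.H₁, Submodule.mem_inf, LinearMap.mem_ker, LinearMap.add_apply,
          LinearMap.id_apply, Finsupp.lmapDomain_apply] at hf ⊢
        have hb : X.bar ∘ a.dart g = a.dart g ∘ X.bar := funext (a.bar_dart g)
        have hi : X.ι ∘ a.dart g = a.vert g ∘ X.ι := funext (a.ι_dart g)
        simp only [chainRep, MonoidHom.coe_mk, OneHom.coe_mk, Finsupp.lmapDomain_apply]
        constructor
        · rw [← Finsupp.mapDomain_comp, hb, Finsupp.mapDomain_comp, ← Finsupp.mapDomain_add,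
            hf.1, Finsupp.mapDomain_zero]
        · rw [← Finsupp.mapDomain_comp, hi, Finsupp.mapDomain_comp, hf.2,
            Finsupp.mapDomain_zero] }

end GraphAction

/-! ### The finite subgroups `S_n`, `S_{n+1}`, `W_n` and `G_n` of `Out(F_n)` -/

namespace OutF

/-- Inner automorphisms of the free group `F_n`. -/
def Inn (n : ℕ) : Subgroup (MulAut (FreeGroup (Fin n))) := MulAut.conj.range

instance (n : ℕ) : (Inn n).Normal where
  conj_mem := by
    rintro _ ⟨w, rfl⟩ φ
    exact ⟨φ w, by ext; simp⟩

end OutF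

/-- The outer automorphism group of the free group on `a_0, …, a_{n-1}`. -/
abbrev OutF (n : ℕ) : Type := MulAut (FreeGroup (Fin n)) ⧸ OutF.Inn n

namespace OutF

/-- The endomorphism inverting the generators `a_i` with `i ∈ I` and fixing the others. -/
def flipHom {n : ℕ} (I : Finset (Fin n)) : FreeGroup (Fin n) →* FreeGroup (Fin n) :=
  FreeGroup.lift fun i => if i ∈ I then (FreeGroup.of i)⁻¹ else FreeGroup.of i

theorem flipHom_flipHom {n : ℕ} (I : Finset (Fin n)) (w : FreeGroup (Fin n)) :
    flipHom I (flipHom I w) = w := by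
  have h : (flipHom I).comp (flipHom I) = MonoidHom.id _ := by
    refine FreeGroup.ext_hom _ _ fun i => ?_
    by_cases hi : i ∈ I <;> simp [flipHom, hi]
  exact DFunLike.congr_fun h w

/-- The automorphism inverting the generators `a_i` with `i ∈ I` and fixing the others. -/
def flipAut {n : ℕ} (I : Finset (Fin n)) : MulAut (FreeGroup (Fin n)) where
  toFun := flipHom I
  invFun := flipHom I
  left_inv := flipHom_flipHom I
  right_inv := flipHom_flipHom I
  map_mul' := map_mul _

/-- `ε_i` inverts `a_i` and fixes the other generators. -/
def ε {n : ℕ} (i : Fin n) : OutF n := (flipAut {i} : MulAut (FreeGroup (Fin n)))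

/-- `Δ`, the product of all `ε_i`, inverts every generator. -/
def Δ (n : ℕ) : OutF n := (flipAut Finset.univ : MulAut (FreeGroup (Fin n)))

/-- `a_0, …, a_{n-1}` followed by `1`. -/
def gen {n : ℕ} : Fin (n + 1) → FreeGroup (Fin n) := Fin.lastCases 1 FreeGroup.of

/-- The endomorphism `gen i ↦ gen (p i) * (gen (p n))⁻¹`. For a transposition of `i, j < n` it
interchanges `a_i` and `a_j`; for the transposition of `i < n` and the last index it sends `a_i` to
`a_i⁻¹` and `a_j` to `a_j * a_i⁻¹` for `j ≠ i`. -/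
def symHom {n : ℕ} (p : Equiv.Perm (Fin (n + 1))) : FreeGroup (Fin n) →* FreeGroup (Fin n) :=
  FreeGroup.lift fun i => gen (p i.castSucc) * (gen (p (Fin.last n)))⁻¹

theorem symHom_gen {n : ℕ} (p : Equiv.Perm (Fin (n + 1))) (j : Fin (n + 1)) :
    symHom p (gen j) = gen (p j) * (gen (p (Fin.last n)))⁻¹ := by
  induction j using Fin.lastCases with
  | last => simp [gen]
  | cast i => simp [gen, symHom]

theorem symHom_mul {n : ℕ} (p q : Equiv.Perm (Fin (n + 1))) :
    symHom (p * q) = (symHom p).comp (symHom q) := by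
  refine FreeGroup.ext_hom _ _ fun i => ?_
  have h : FreeGroup.of i = gen i.castSucc := by simp [gen]
  rw [MonoidHom.comp_apply, h, symHom_gen, symHom_gen, map_mul, map_inv, symHom_gen, symHom_gen]
  simp

theorem symHom_one {n : ℕ} : symHom (1 : Equiv.Perm (Fin (n + 1))) = MonoidHom.id _ := by
  refine FreeGroup.ext_hom _ _ fun i => ?_
  simp [symHom, gen]

/-- The action of the symmetric group `S_{n+1}` on `F_n`. -/
def symAut (n : ℕ) : Equiv.Perm (Fin (n + 1)) →* MulAut (FreeGroup (Fin n)) where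
  toFun p :=
    { toFun := symHom p
      invFun := symHom p⁻¹
      left_inv := fun w => by
        rw [← MonoidHom.comp_apply, ← symHom_mul, inv_mul_cancel, symHom_one]; rfl
      right_inv := fun w => by
        rw [← MonoidHom.comp_apply, ← symHom_mul, mul_inv_cancel, symHom_one]; rfl
      map_mul' := map_mul _ }
  map_one' := MulEquiv.ext fun w => DFunLike.congr_fun symHom_one w
  map_mul' p q := MulEquiv.ext fun w => DFunLike.congr_fun (symHom_mul p q) w

/-- The inclusion of `S_{n+1}`, which sends the transposition of `i` and `j` to `σ_{ij}`. -/
def symOut (n : ℕ) : Equiv.Perm (Fin (n + 1)) →* OutF n :=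
  (QuotientGroup.mk' (Inn n)).comp (symAut n)

/-- The inclusion of `S_n < S_{n+1}`, the permutations fixing the last index. -/
noncomputable def permOut (n : ℕ) : Equiv.Perm (Fin n) →* OutF n :=
  (symOut n).comp (Equiv.Perm.viaEmbeddingHom Fin.castSuccEmb)

theorem permOut_apply {n : ℕ} (p : Equiv.Perm (Fin n)) :
    permOut n p = (FreeGroup.freeGroupCongr p : MulAut (FreeGroup (Fin n))) := by
  have hl : p.viaEmbedding Fin.castSuccEmb (Fin.last n) = Fin.last n :=
    Equiv.Perm.viaEmbedding_apply_of_notMem _ _ _ (by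
      rintro ⟨i, hi⟩
      exact (Fin.castSucc_lt_last i).ne hi)
  have hc (i : Fin n) : p.viaEmbedding Fin.castSuccEmb i.castSucc = (p i).castSucc :=
    Equiv.Perm.viaEmbedding_apply p Fin.castSuccEmb i
  refine congrArg (QuotientGroup.mk' (Inn n)) (MulEquiv.ext fun w => ?_)
  refine DFunLike.congr_fun (f := symHom (p.viaEmbedding Fin.castSuccEmb))
    (g := (FreeGroup.freeGroupCongr p).toMonoidHom) (FreeGroup.ext_hom _ _ fun i => ?_) w
  simp [symHom, hl, hc, gen]

/-- `W_n`, generated by the `ε_i` and `S_n`. -/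
noncomputable def W (n : ℕ) : Subgroup (OutF n) := Subgroup.closure (Set.range ε) ⊔ (permOut n).range

/-- `G_n`, generated by `Δ` and `S_{n+1}`. -/
def G (n : ℕ) : Subgroup (OutF n) := Subgroup.closure {Δ n} ⊔ (symOut n).range

/-- `ε_i` as an element of `W_n`. -/
noncomputable def εW {n : ℕ} (i : Fin n) : W n :=
  ⟨ε i, Subgroup.mem_sup_left (Subgroup.subset_closure ⟨i, rfl⟩)⟩

/-- The inclusion of `S_n` in `W_n`. -/
noncomputable def permW (n : ℕ) : Equiv.Perm (Fin n) →* W n :=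
  (permOut n).codRestrict (W n) fun p => Subgroup.mem_sup_right ⟨p, rfl⟩

/-- `Δ` as an element of `G_n`. -/
def ΔG (n : ℕ) : G n := ⟨Δ n, Subgroup.mem_sup_left (Subgroup.subset_closure rfl)⟩

/-- The inclusion of `S_{n+1}` in `G_n`. -/
def symG (n : ℕ) : Equiv.Perm (Fin (n + 1)) →* G n :=
  (symOut n).codRestrict (G n) fun p => Subgroup.mem_sup_right ⟨p, rfl⟩

/-- The inclusion of `S_n` in `G_n`. -/
noncomputable def permG (n : ℕ) : Equiv.Perm (Fin n) →* G n :=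
  (permOut n).codRestrict (G n) fun _ => Subgroup.mem_sup_right ⟨_, rfl⟩

end OutF

/-! ### Representations of symmetric groups -/

namespace SymRep

/-- The permutation representation of `S_n` on `ℂ^n`. -/
def perm (n : ℕ) : Representation ℂ (Equiv.Perm (Fin n)) (Fin n → ℂ) where
  toFun p := LinearMap.funLeft ℂ ℂ ⇑p⁻¹
  map_one' := by ext; simp [LinearMap.funLeft]
  map_mul' p q := by ext; simp [LinearMap.funLeft]

/-- The vectors in `ℂ^n` with coordinate sum zero. -/
def sumZero (n : ℕ) : Submodule ℂ (Fin n → ℂ) where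
  carrier := {x | ∑ i, x i = 0}
  zero_mem' := by simp
  add_mem' := by
    intro x y hx hy
    simp only [Set.mem_ofPred_eq, Pi.add_apply, Finset.sum_add_distrib] at *
    rw [hx, hy, add_zero]
  smul_mem' := by
    intro c x hx
    simp only [Set.mem_ofPred_eq, Pi.smul_apply, smul_eq_mul, ← Finset.mul_sum] at *
    rw [hx, mul_zero]

/-- The standard representation of `S_n`, of type `(n-1, 1)`. -/
def std (n : ℕ) : Representation ℂ (Equiv.Perm (Fin n)) (sumZero n) :=
  Subrepresentation.toRepresentation (ρ := perm n)
    { toSubmodule := sumZero n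
      apply_mem_toSubmodule := by
        intro p x hx
        exact (Equiv.sum_comp p⁻¹ x).trans hx }

/-- The tensor product of a representation of `S_n` with the sign character. -/
def signTwist {n : ℕ} {M : Type*} [AddCommGroup M] [Module ℂ M]
    (ρ : Representation ℂ (Equiv.Perm (Fin n)) M) :
    Representation ℂ (Equiv.Perm (Fin n)) M where
  toFun p := ((Equiv.Perm.sign p : ℤ) : ℂ) • ρ p
  map_one' := by simp
  map_mul' p q := by
    ext x
    simp only [map_mul, Units.val_mul, Int.cast_mul, mul_smul, LinearMap.smul_apply,
      Module.End.mul_apply, map_smul]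
    rw [smul_comm]

/-- The trivial one-dimensional representation of `S_n`. -/
def triv (n : ℕ) : Representation ℂ (Equiv.Perm (Fin n)) ℂ := Representation.trivial ℂ _ ℂ

/-- The determinant (sign) representation of `S_n`. -/
def det (n : ℕ) : Representation ℂ (Equiv.Perm (Fin n)) ℂ := signTwist (triv n)

/-- The signed standard representation of `S_n`. -/
def signedStd (n : ℕ) : Representation ℂ (Equiv.Perm (Fin n)) (sumZero n) := signTwist (std n)

/-- The signed permutation representation of `S_n`. -/
def signedPerm (n : ℕ) : Representation ℂ (Equiv.Perm (Fin n)) (Fin n → ℂ) := signTwist (perm n)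

end SymRep

section Modules

variable {H M N : Type*} [Group H] [AddCommGroup M] [Module ℂ M] [AddCommGroup N] [Module ℂ N]

/-- The direct sum of `k` copies of a representation. -/
def copies (k : ℕ) (σ : Representation ℂ H N) : Representation ℂ H (Fin k → N) where
  toFun g := (σ g).compLeft (Fin k)
  map_one' := by ext; simp
  map_mul' g h := by ext; simp

/-- The subspace `V` of the `H`-module `M` is a submodule isomorphic to a direct sum of (finitely
many, possibly zero) copies of `σ`. -/
def IsSumOf (ρ : Representation ℂ H M) (V : Submodule ℂ M) (σ : Representation ℂ H N) : Prop :=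
  ∃ (k : ℕ) (f : Representation.IntertwiningMap (copies k σ) ρ),
    Function.Injective f ∧ LinearMap.range f.toLinearMap = V

/-- The `H`-module `M` contains a submodule isomorphic to `σ`. -/
def ContainsRep (ρ : Representation ℂ H M) (σ : Representation ℂ H N) : Prop :=
  ∃ f : Representation.IntertwiningMap σ ρ, Function.Injective f

end Modules

section Decompositions

variable {M : Type*} [AddCommGroup M] [Module ℂ M]

/-- The simultaneous eigenspace `E_I` of the `ε_i`, with eigenvalue `-1` for `i ∈ I` and `1` for
`i ∉ I`. -/
noncomputable def eigenE {n : ℕ} (ρ : Representation ℂ (OutF.W n) M) (I : Finset (Fin n)) : Submodule ℂ M :=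
  ⨅ i, Module.End.eigenspace (ρ (OutF.εW i)) (if i ∈ I then -1 else 1)

/-- `V_i`, the sum of the `E_I` with `|I| = i`. -/
noncomputable def levelV {n : ℕ} (ρ : Representation ℂ (OutF.W n) M) (i : ℕ) : Submodule ℂ M :=
  ⨆ I : Finset (Fin n), ⨆ _ : I.card = i, eigenE ρ I

/-- The hypothesis on a representation of `W_3`. -/
structure WDecomposition (ρ : Representation ℂ (OutF.W 3) M) : Prop where
  internal : DirectSum.IsInternal fun i : Fin 4 => levelV ρ i
  nontrivial : levelV ρ 1 ⊔ levelV ρ 2 ≠ ⊥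
  zero : IsSumOf (ρ.comp (OutF.permW 3)) (levelV ρ 0) (SymRep.triv 3)
  one : IsSumOf (ρ.comp (OutF.permW 3)) (levelV ρ 1) (SymRep.perm 3)
  two : IsSumOf (ρ.comp (OutF.permW 3)) (levelV ρ 2) (SymRep.signedPerm 3)
  three : IsSumOf (ρ.comp (OutF.permW 3)) (levelV ρ 3) (SymRep.det 3)

/-- The hypothesis on a representation of `G_3` and a decomposition `V_0 ⊕ V_1 ⊕ V_2 ⊕ V_3`. -/
structure GDecomposition (ρ : Representation ℂ (OutF.G 3) M) (V : Fin 4 → Submodule ℂ M) :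
    Prop where
  internal : DirectSum.IsInternal V
  nontrivial : V 1 ⊔ V 2 ≠ ⊥
  delta_even : ∀ x ∈ V 0 ⊔ V 2, ρ (OutF.ΔG 3) x = x
  delta_odd : ∀ x ∈ V 1 ⊔ V 3, ρ (OutF.ΔG 3) x = -x
  zero : IsSumOf (ρ.comp (OutF.symG 3)) (V 0) (SymRep.triv 4)
  one : IsSumOf (ρ.comp (OutF.symG 3)) (V 1) (SymRep.std 4)
  two : IsSumOf (ρ.comp (OutF.symG 3)) (V 2) (SymRep.signedStd 4)
  three : IsSumOf (ρ.comp (OutF.symG 3)) (V 3) (SymRep.det 4)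

end Decompositions

/-- There is an invariant subgraph `Y` isomorphic to a 3-rose such that `H₁(Y, ℂ)`, as a module
over `S_3` (acting through `s`), contains the standard representation. -/
def HasStandardRose {K : Type*} [Group K] {X : CWGraph.{u, v}} (a : GraphAction K X)
    (s : Equiv.Perm (Fin 3) →* K) : Prop :=
  ∃ (Y : X.Subgraph) (hY : a.Invariant Y), Nonempty (Y.toGraph.Iso (CWGraph.rose 3)) ∧
    ContainsRep (M := Y.toGraph.H₁) ((a.restrict Y hY).homologyRep.comp s) (SymRep.std 3)

/-! Both groups contain elements satisfying the relations of rotations of the cube: half-turns n₀,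
n₁, n₂ about the axes, a rotation c of order three, and a half-turn t, which is a transposition
corrected by Δ. The summands of V₁ ⊕ V₂ ≠ 0 have dimension three and dim V = 5, so V₁ ⊕ V₂ is a
single such summand and V₀ ⊕ V₃ has dimension two. The signs of Δ and of the determinant cancel so
that both groups give the same picture: the rotations act trivially on V₀ ⊕ V₃, the operator 1 + n₀
+ n₁ + n₂ vanishes on V₁ ⊕ V₂, and c and t have traces 2 and 1 on V (`CubeFrame.Decomposes.traces`).

The rest is geometry. The Lefschetz formula (`two_mul_trace_homologyRep`) turns the traces into
relations between the numbers of fixed vertices, fixed edges and inverted edges. Together with the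
Euler characteristic and the bound 3 for all valences, the relation for c leaves two cases
(`count`): either c fixes all vertices and moves exactly three edges, or it moves three vertices,
all of valence three, and three oriented edges leaving fixed vertices. In the second case
(`not_three_moved`) each moved vertex has one spoke to a common fixed vertex and two edges to moved
vertices. If a half-turn takes a moved vertex to a fixed one, X has to be the complete graph on four
vertices, in which c fixes no edge. Otherwise the half-turns fix all vertices, and an edge moved by
one of them is doubled, which leaves no room for the spoke.

In the first case the half-turns fix all vertices. An edge p fixed by c but not by the half-turns
would have four parallel translates, permuted like the diagonals of the cube
(`IsCubical.n_eq_self_of_c_eq_self`). If t fixes p, the action on the axis of n₂ is wrong; if t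
inverts p, either a cycle invariant under the half-turns is not invariant under t, or the four edges
separate X into halves exchanged by t, against the Lefschetz count for t. So every edge moved by a
half-turn is moved by c. The three edges moved by c must be loops, because otherwise the half-turns
would act trivially on them (`exists_loop`). They form the rose Y.

A cycle annihilated by 1 + n₀ + n₁ + n₂ has coefficient zero on every edge fixed by the half-turns,
so V₁ ⊕ V₂ is carried by Y. It contains the standard representation of S₃, which for V₂ uses that
this representation is isomorphic to its sign twist (`SymRep.rot`). -/

/-! ### Chains carried by edge paths -/

namespace CWGraph

variable {X : CWGraph.{u, v}}

/-- The 1-chain of an oriented edge. -/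
noncomputable def dartChain (X : CWGraph.{u, v}) (d : X.Dart) : X.Dart →₀ ℂ :=
  Finsupp.single d 1 - Finsupp.single (X.bar d) 1

/-- The 1-chain of an edge path. -/
noncomputable def walkChain (X : CWGraph.{u, v}) (l : List X.Dart) : X.Dart →₀ ℂ :=
  (l.map X.dartChain).sum

@[simp] theorem walkChain_nil : X.walkChain [] = 0 := rfl

@[simp] theorem walkChain_cons (d : X.Dart) (l : List X.Dart) :
    X.walkChain (d :: l) = X.dartChain d + X.walkChain l := by simp [walkChain]

theorem walkChain_append (l m : List X.Dart) :
    X.walkChain (l ++ m) = X.walkChain l + X.walkChain m := by simp [walkChain]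

theorem dartChain_bar (d : X.Dart) : X.dartChain (X.bar d) = -X.dartChain d := by
  simp [dartChain, X.bar_bar]

theorem walkChain_reverse (l : List X.Dart) :
    X.walkChain (l.map X.bar).reverse = -X.walkChain l := by
  induction l with
  | nil => simp
  | cons d l ih =>
    rw [List.map_cons, List.reverse_cons, walkChain_append, ih, walkChain_cons, walkChain_cons,
      walkChain_nil, dartChain_bar]
    abel

theorem bar_injective (X : CWGraph.{u, v}) : Function.Injective X.bar :=
  Function.LeftInverse.injective X.bar_bar

theorem τ_bar (d : X.Dart) : X.τ (X.bar d) = X.ι d := by simp [τ, X.bar_bar]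

theorem mem_H₁_iff (f : X.Dart →₀ ℂ) : f ∈ X.H₁ ↔
    (∀ d, f (X.bar d) = -f d) ∧ Finsupp.mapDomain X.ι f = 0 := by
  simp only [H₁, Submodule.mem_inf, LinearMap.mem_ker, LinearMap.add_apply, LinearMap.id_apply,
    Finsupp.lmapDomain_apply]
  refine and_congr_left fun _ => ?_
  rw [Finsupp.ext_iff]
  refine ⟨fun h d => ?_, fun h d => ?_⟩
  · have := h (X.bar d)
    rw [Finsupp.add_apply, Finsupp.mapDomain_apply X.bar_injective, Finsupp.zero_apply] at this
    linear_combination this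
  · have := h d
    rw [← X.bar_bar d, Finsupp.add_apply, Finsupp.mapDomain_apply X.bar_injective,
      Finsupp.zero_apply, X.bar_bar, this]
    ring

theorem mapDomain_bar_dartChain (d : X.Dart) :
    Finsupp.mapDomain X.bar (X.dartChain d) = -X.dartChain d := by
  simp [dartChain, Finsupp.mapDomain_sub, Finsupp.mapDomain_single, X.bar_bar]

theorem mapDomain_ι_dartChain (d : X.Dart) :
    Finsupp.mapDomain X.ι (X.dartChain d) =
      Finsupp.single (X.ι d) 1 - Finsupp.single (X.τ d) 1 := by
  simp [dartChain, Finsupp.mapDomain_sub, Finsupp.mapDomain_single, τ]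

theorem mapDomain_bar_walkChain (l : List X.Dart) :
    Finsupp.mapDomain X.bar (X.walkChain l) = -X.walkChain l := by
  induction l with
  | nil => simp
  | cons d l ih =>
    rw [walkChain_cons, Finsupp.mapDomain_add, ih, mapDomain_bar_dartChain]
    abel

theorem IsWalk.mapDomain_ι_walkChain {l : List X.Dart} {a b : X.Vert} (h : X.IsWalk a l b) :
    Finsupp.mapDomain X.ι (X.walkChain l) = Finsupp.single a 1 - Finsupp.single b 1 := by
  induction l generalizing a with
  | nil => simp [show a = b from h]
  | cons d l ih =>
    rw [walkChain_cons, Finsupp.mapDomain_add, ih h.2, mapDomain_ι_dartChain, h.1]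
    abel

theorem IsWalk.walkChain_mem {l : List X.Dart} {a : X.Vert} (h : X.IsWalk a l a) :
    X.walkChain l ∈ X.H₁ := by
  simp [H₁, h.mapDomain_ι_walkChain, mapDomain_bar_walkChain]

/-- The homomorphism from the path group to 1-chains. -/
noncomputable def chainHom (X : CWGraph.{u, v}) : X.PathGroup →* Multiplicative (X.Dart →₀ ℂ) :=
  PresentedGroup.toGroup (f := fun d => Multiplicative.ofAdd (X.dartChain d)) (by
    rintro _ ⟨d, rfl⟩
    rw [map_mul, FreeGroup.lift_apply_of, FreeGroup.lift_apply_of, ← ofAdd_add, dartChain_bar,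
      add_neg_cancel, ofAdd_zero])

theorem chainHom_pathClass (l : List X.Dart) :
    X.chainHom (X.pathClass l) = Multiplicative.ofAdd (X.walkChain l) := by
  induction l with
  | nil => simp [pathClass]
  | cons d l ih =>
    rw [walkChain_cons, ofAdd_add, ← ih]
    simp [pathClass, chainHom]

/-- Every cycle is a combination of chains of closed edge paths at a given vertex. -/
theorem H₁_le_span (hX : X.Connected) (a : X.Vert) :
    X.H₁ ≤ Submodule.span ℂ {z | ∃ l, X.IsWalk a l a ∧ z = X.walkChain l} := by
  classical
  choose p hp using hX.2 a
  intro f hf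
  set S := Submodule.span ℂ {z | ∃ l, X.IsWalk a l a ∧ z = X.walkChain l}
  -- Each edge is closed up by the chosen paths from `a`. In the sum of these loops with weights f
  -- the paths cancel because f has no boundary, and the edges contribute 2f because both
  -- orientations of an edge are counted.
  have hloop (d : X.Dart) :
      X.dartChain d + X.walkChain (p (X.ι d)) - X.walkChain (p (X.τ d)) ∈ S := by
    refine Submodule.subset_span ⟨p (X.ι d) ++ d :: ((p (X.τ d)).map X.bar).reverse, ?_, ?_⟩
    · exact (hp _).append ⟨rfl, (hp _).reverse⟩
    · rw [walkChain_append, walkChain_cons, walkChain_reverse]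
      abel
  obtain ⟨hbar, hι⟩ := (X.mem_H₁_iff f).1 hf
  have hsum := S.sum_mem (t := f.support) fun d _ => S.smul_mem (f d) (hloop d)
  let P : (X.Vert →₀ ℂ) →ₗ[ℂ] (X.Dart →₀ ℂ) :=
    Finsupp.linearCombination ℂ fun v => X.walkChain (p v)
  have h1 : ∑ d ∈ f.support, f d • X.walkChain (p (X.ι d)) = 0 := by
    have : P (Finsupp.mapDomain X.ι f) = 0 := by rw [hι, map_zero]
    rw [Finsupp.linearCombination_mapDomain] at this
    exact this
  have hfbar : Finsupp.mapDomain X.bar f = -f := by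
    ext d
    rw [← X.bar_bar d, Finsupp.mapDomain_apply X.bar_injective, Finsupp.neg_apply, hbar (X.bar d),
      neg_neg]
  have h2 : ∑ d ∈ f.support, f d • X.walkChain (p (X.τ d)) = 0 := by
    have : P (Finsupp.mapDomain X.ι (Finsupp.mapDomain X.bar f)) = 0 := by
      rw [hfbar, ← Finsupp.lmapDomain_apply ℂ ℂ, map_neg, Finsupp.lmapDomain_apply, hι, neg_zero,
        map_zero]
    rw [← Finsupp.mapDomain_comp, Finsupp.linearCombination_mapDomain] at this
    exact this
  have h3 : ∑ d ∈ f.support, f d • X.dartChain d = (2 : ℂ) • f := by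
    have e1 : ∑ d ∈ f.support, f d • Finsupp.single d (1 : ℂ) = f := by
      simpa [Finsupp.sum] using f.sum_single
    have e2 : ∑ d ∈ f.support, f d • Finsupp.single (X.bar d) (1 : ℂ) = -f := by
      rw [← hfbar]
      simp [Finsupp.mapDomain, Finsupp.sum]
    simp only [dartChain, smul_sub, Finset.sum_sub_distrib, e1, e2, two_smul, sub_neg_eq_add]
  simp only [smul_sub, smul_add, Finset.sum_sub_distrib, Finset.sum_add_distrib, h1, h2, h3,
    add_zero, sub_zero] at hsum
  have := S.smul_mem (2⁻¹ : ℂ) hsum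
  rwa [smul_smul, inv_mul_cancel₀ two_ne_zero, one_smul] at this

/-- The chain of a closed path depends only on its class and is additive under concatenation, so the
chains of generators of the fundamental group already span the cycles. Equality is obtained later
from the Euler characteristic. -/
theorem HasRank.finrank_H₁_le {n : ℕ} (hX : X.HasRank n) :
    FiniteDimensional ℂ X.H₁ ∧ Module.finrank ℂ X.H₁ ≤ n := by
  classical
  obtain ⟨hc, hr⟩ := hX
  obtain ⟨a⟩ := hc.1
  obtain ⟨hfg, hrank⟩ := hr a
  obtain ⟨S, hS, hcl⟩ := Group.rank_spec (X.π₁ a)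
  let F : X.π₁ a → (X.Dart →₀ ℂ) := fun x => (X.chainHom x.1).toAdd
  have key : ∀ x, F x ∈ Submodule.span ℂ ((S.image F : Finset _) : Set (X.Dart →₀ ℂ)) := by
    intro x
    have hx : x ∈ Subgroup.closure (S : Set (X.π₁ a)) := hcl ▸ Subgroup.mem_top x
    induction hx using Subgroup.closure_induction with
    | mem x hx =>
      exact Submodule.subset_span (Finset.mem_coe.2 (Finset.mem_image_of_mem F hx))
    | one => simp [F]
    | mul x y _ _ hx hy =>
      have : F (x * y) = F x + F y := by simp [F]
      exact this ▸ Submodule.add_mem _ hx hy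
    | inv x _ hx =>
      have : F x⁻¹ = -F x := by simp [F]
      exact this ▸ Submodule.neg_mem _ hx
  have hle : X.H₁ ≤ Submodule.span ℂ ((S.image F : Finset _) : Set (X.Dart →₀ ℂ)) := by
    refine (H₁_le_span hc a).trans (Submodule.span_le.2 ?_)
    rintro _ ⟨l, hl, rfl⟩
    have := key ⟨X.pathClass l, l, hl, rfl⟩
    simpa [F, chainHom_pathClass] using this
  have hfin : FiniteDimensional ℂ
      (Submodule.span ℂ ((S.image F : Finset _) : Set (X.Dart →₀ ℂ))) :=
    FiniteDimensional.span_finset ℂ _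
  refine ⟨Submodule.finiteDimensional_of_le hle, ?_⟩
  calc Module.finrank ℂ X.H₁ ≤ _ := Submodule.finrank_mono hle
    _ ≤ (S.image F).card := finrank_span_finset_le_card _
    _ ≤ S.card := Finset.card_image_le
    _ = n := by rw [hS, hrank]

/-! ### Forests and bridges -/

theorem IsWalk.of_append {l m : List X.Dart} {a c : X.Vert} (h : X.IsWalk a (l ++ m) c) :
    ∃ b, X.IsWalk a l b ∧ X.IsWalk b m c := by
  induction l generalizing a with
  | nil => exact ⟨a, rfl, h⟩
  | cons d l ih =>
    obtain ⟨b, h1, h2⟩ := ih h.2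
    exact ⟨b, ⟨h.1, h1⟩, h2⟩

theorem dartChain_apply_of_ne {d e : X.Dart} (h : e ≠ d) (h' : e ≠ X.bar d) :
    X.dartChain e d = 0 := by
  have : X.bar e ≠ d := fun h2 => h' (by rw [← h2, X.bar_bar])
  simp [dartChain, h, this]

theorem dartChain_apply_self (d : X.Dart) : X.dartChain d d = 1 := by
  simp [dartChain, X.bar_ne d]

theorem walkChain_apply_of_notMem {d : X.Dart} {l : List X.Dart} (h : d ∉ l)
    (h' : X.bar d ∉ l) : X.walkChain l d = 0 := by
  induction l with
  | nil => rfl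
  | cons e l ih =>
    simp only [List.mem_cons, not_or] at h h'
    rw [walkChain_cons, Finsupp.add_apply, ih h.2 h'.2,
      dartChain_apply_of_ne (Ne.symm h.1) (Ne.symm h'.1), add_zero]

/-- A graph that is not a forest has a cycle with a non-vanishing coefficient. -/
theorem isForest_of_H₁ (h : ∀ z ∈ X.H₁, ∀ d, z d = 0) : X.IsForest := by
  intro a l
  induction hn : l.length using Nat.strong_induction_on generalizing a l with
  | _ n ih =>
  subst hn
  intro hl hred
  match l, hl, hred with
  | [], _, _ => rfl
  | d :: l, hl, hred =>
    exfalso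
    -- By induction on the length, no proper subpath can be closed and non-empty. Hence the path
    -- never returns to its first edge in either direction, and its chain has coefficient 1 there.
    have hmin (b : X.Vert) (p q r : List X.Dart) (hpqr : d :: l = p ++ q ++ r) (hq : q ≠ [])
        (hw : X.IsWalk b q b) : p ++ r = [] := by
      by_contra hne
      refine hq (ih q.length ?_ b q rfl hw ?_)
      · rw [hpqr]
        have : 0 < (p ++ r).length := List.length_pos_of_ne_nil hne
        simp only [List.length_append] at this ⊢
        omega
      · rw [hpqr] at hred
        exact (List.isChain_append.1 (List.isChain_append.1 hred).1).2.1
    have h1 : d ∉ l := by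
      intro hd
      obtain ⟨s, t, rfl⟩ := List.append_of_mem hd
      obtain ⟨b, hb1, hb2⟩ := hl.2.of_append
      have := hmin (X.ι d) [] (d :: s) (d :: t) (by simp) (by simp) ⟨rfl, hb2.1 ▸ hb1⟩
      simp at this
    have h2 : X.bar d ∉ l := by
      intro hd
      obtain ⟨s, t, rfl⟩ := List.append_of_mem hd
      obtain ⟨b, hb1, hb2⟩ := hl.2.of_append
      -- The reversed edge cannot follow immediately, since that would be a backtrack.
      have hs : s ≠ [] := by
        rintro rfl
        simp at hred
      have := hmin (X.τ d) [d] s (X.bar d :: t) (by simp) hs (by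
        have e : X.τ d = b := hb2.1
        exact e ▸ hb1)
      simp at this
    have := h _ hl.walkChain_mem d
    rw [walkChain_cons, Finsupp.add_apply, dartChain_apply_self,
      walkChain_apply_of_notMem h1 h2] at this
    simp at this

end CWGraph

/-! ### Homology of subgraphs -/

namespace CWGraph.Subgraph

variable {X : CWGraph.{u, v}} (Y : X.Subgraph)

/-- The inclusion on oriented edges. -/
def dartVal (d : Y.toGraph.Dart) : X.Dart := d.1

/-- The inclusion on vertices. -/
def vertVal (x : Y.toGraph.Vert) : X.Vert := x.1

theorem dartVal_injective : Function.Injective Y.dartVal := fun _ _ h => Subtype.ext h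

theorem vertVal_injective : Function.Injective Y.vertVal := fun _ _ h => Subtype.ext h

/-- Chains of a subgraph as chains of the ambient graph. -/
noncomputable def incl : (Y.toGraph.Dart →₀ ℂ) →ₗ[ℂ] (X.Dart →₀ ℂ) :=
  Finsupp.lmapDomain ℂ ℂ Y.dartVal

theorem incl_injective : Function.Injective Y.incl :=
  Finsupp.mapDomain_injective Y.dartVal_injective

theorem incl_apply (z : Y.toGraph.Dart →₀ ℂ) (d : Y.toGraph.Dart) :
    Y.incl z (Y.dartVal d) = z d :=
  Finsupp.mapDomain_apply Y.dartVal_injective z d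

theorem incl_mem_H₁ {z : Y.toGraph.Dart →₀ ℂ} : Y.incl z ∈ X.H₁ ↔ z ∈ Y.toGraph.H₁ := by
  simp only [H₁, Submodule.mem_inf, LinearMap.mem_ker, LinearMap.add_apply, LinearMap.id_apply,
    Finsupp.lmapDomain_apply, incl]
  have hb : X.bar ∘ Y.dartVal = Y.dartVal ∘ Y.toGraph.bar := rfl
  have hi : X.ι ∘ Y.dartVal = Y.vertVal ∘ Y.toGraph.ι := rfl
  refine and_congr ?_ ?_
  · rw [← Finsupp.mapDomain_comp, hb, Finsupp.mapDomain_comp, ← Finsupp.mapDomain_add]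
    exact map_eq_zero_iff Y.incl Y.incl_injective
  · rw [← Finsupp.mapDomain_comp, hi, Finsupp.mapDomain_comp]
    exact map_eq_zero_iff (Finsupp.lmapDomain ℂ ℂ Y.vertVal)
      (Finsupp.mapDomain_injective Y.vertVal_injective)

end CWGraph.Subgraph

/-! ### Cycles and finiteness in admissible graphs -/

namespace GraphAction

variable {G : Type*} [Group G] {X : CWGraph.{u, v}} (a : GraphAction G X)

theorem chainRep_apply (g : G) (z : X.Dart →₀ ℂ) (d : X.Dart) :
    a.chainRep g z (a.dart g d) = z d :=
  Finsupp.mapDomain_apply (a.dart g).injective z d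

theorem chainRep_apply' (g : G) (z : X.Dart →₀ ℂ) (d : X.Dart) :
    a.chainRep g z d = z (a.dart g⁻¹ d) := by
  conv_lhs => rw [show d = a.dart g (a.dart g⁻¹ d) by simp]
  exact a.chainRep_apply g z _

theorem coe_homologyRep (g : G) (z : X.H₁) :
    ((a.homologyRep g z : X.H₁) : X.Dart →₀ ℂ) = a.chainRep g z := rfl

theorem chainRep_dartChain (g : G) (d : X.Dart) :
    a.chainRep g (X.dartChain d) = X.dartChain (a.dart g d) := by
  change Finsupp.mapDomain _ _ = _
  simp [CWGraph.dartChain, Finsupp.mapDomain_sub, Finsupp.mapDomain_single, a.bar_dart]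

theorem chainRep_walkChain (g : G) (l : List X.Dart) :
    a.chainRep g (X.walkChain l) = X.walkChain (l.map (a.dart g)) := by
  induction l with
  | nil => simp
  | cons d l ih => simp [ih, chainRep_dartChain]

theorem τ_dart (g : G) (d : X.Dart) : X.τ (a.dart g d) = a.vert g (X.τ d) := by
  rw [CWGraph.τ, a.bar_dart, a.ι_dart, CWGraph.τ]

theorem isWalk_map (g : G) {l : List X.Dart} {x y : X.Vert} (h : X.IsWalk x l y) :
    X.IsWalk (a.vert g x) (l.map (a.dart g)) (a.vert g y) := by
  induction l generalizing x with
  | nil => exact congrArg _ h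
  | cons d l ih => exact ⟨by rw [a.ι_dart, h.1], by rw [a.τ_dart]; exact ih h.2⟩

/-- In an admissible graph every edge lies on a cycle. -/
theorem Admissible.exists_cycle {a : GraphAction G X} (ha : a.Admissible) (d : X.Dart) :
    ∃ z ∈ X.H₁, z d ≠ 0 := by
  by_contra! hd
  -- If no cycle passes through `d`, then none passes through a translate of `d`, so the orbit of
  -- this edge is an invariant forest.
  refine ha.2.2 ⟨
    { verts := Set.univ
      darts := {e | ∃ g, e = a.dart g d ∨ e = X.bar (a.dart g d)}
      ι_mem := fun _ _ => Set.mem_univ _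
      bar_mem := by
        rintro _ ⟨g, rfl | rfl⟩
        · exact ⟨g, Or.inr rfl⟩
        · exact ⟨g, Or.inl (X.bar_bar _)⟩ }, ⟨fun _ _ _ => Set.mem_univ _, ?_⟩, ?_, d, 1, ?_⟩
  · rintro k _ ⟨g, rfl | rfl⟩
    · exact ⟨k * g, Or.inl (by simp)⟩
    · exact ⟨k * g, Or.inr (by simp [a.bar_dart])⟩
  · refine CWGraph.isForest_of_H₁ fun z hz e => ?_
    rw [← CWGraph.Subgraph.incl_mem_H₁] at hz
    rw [← CWGraph.Subgraph.incl_apply]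
    have h0 (g : G) {w : X.Dart →₀ ℂ} (hw : w ∈ X.H₁) : w (a.dart g d) = 0 := by
      have := hd _ (a.homologyRep g⁻¹ ⟨w, hw⟩).2
      rwa [coe_homologyRep, chainRep_apply', inv_inv] at this
    obtain ⟨e, g, rfl | rfl⟩ := e
    · exact h0 g hz
    · exact (((X.mem_H₁_iff _).1 hz).1 _).trans (by rw [h0 g hz, neg_zero])
  · simp

/-- Since every edge lies on a cycle, the supports of finitely many cycles spanning the homology
cover all edges. -/
theorem Admissible.finite_dart {a : GraphAction G X} (ha : a.Admissible)
    (hf : FiniteDimensional ℂ X.H₁) : Finite X.Dart := by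
  classical
  obtain ⟨S, hS⟩ := (Submodule.fg_iff_finiteDimensional X.H₁).2 hf
  refine Set.finite_univ_iff.1 ((S.biUnion Finsupp.support).finite_toSet.subset fun d _ => ?_)
  obtain ⟨z, hz, hzd⟩ := ha.exists_cycle d
  by_contra hd
  apply hzd
  rw [← hS] at hz
  have hle : Submodule.span ℂ (S : Set (X.Dart →₀ ℂ)) ≤ LinearMap.ker (Finsupp.lapply d) := by
    refine Submodule.span_le.2 fun w hw => ?_
    by_contra hne
    exact hd (Finset.mem_coe.2 (Finset.mem_biUnion.2 ⟨w, hw, Finsupp.mem_support_iff.2 hne⟩))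
  exact hle hz

end GraphAction

namespace CWGraph

variable {X : CWGraph.{u, v}}

/-- In a connected graph, a set of vertices that is closed under adjacency is empty or
everything. -/
theorem Connected.mem_of_closed (hX : X.Connected) {S : Set X.Vert}
    (hS : ∀ d, X.ι d ∈ S → X.τ d ∈ S) {x : X.Vert} (hx : x ∈ S) (y : X.Vert) : y ∈ S := by
  obtain ⟨l, hl⟩ := hX.2 x y
  induction l generalizing x with
  | nil => exact (show x = y from hl) ▸ hx
  | cons d l ih => exact ih (hS d (hl.1.symm ▸ hx)) hl.2

theorem Connected.finite_vert (hX : X.Connected) [Finite X.Dart] : Finite X.Vert := by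
  obtain ⟨x⟩ := hX.1
  refine Set.finite_univ_iff.1 (((Set.finite_range X.ι).union (Set.finite_singleton x)).subset ?_)
  intro y _
  refine hX.mem_of_closed (S := Set.range X.ι ∪ {x}) (fun d _ => ?_) (Or.inr rfl) y
  exact Or.inl ⟨X.bar d, rfl⟩

end CWGraph

/-! ### Traces -/

/-- Additivity of the trace in a short exact sequence. -/
theorem LinearMap.trace_eq_add_of_exact {𝕜 K M Q : Type*} [Field 𝕜] [AddCommGroup K] [Module 𝕜 K]
    [AddCommGroup M] [Module 𝕜 M] [AddCommGroup Q] [Module 𝕜 Q] [FiniteDimensional 𝕜 M]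
    (i : K →ₗ[𝕜] M) (φ : M →ₗ[𝕜] Q) (hi : Function.Injective i) (hφ : Function.Surjective φ)
    (hex : LinearMap.range i = LinearMap.ker φ) {gK : K →ₗ[𝕜] K} {g : M →ₗ[𝕜] M} {gQ : Q →ₗ[𝕜] Q}
    (h1 : g ∘ₗ i = i ∘ₗ gK) (h2 : φ ∘ₗ g = gQ ∘ₗ φ) :
    LinearMap.trace 𝕜 M g = LinearMap.trace 𝕜 K gK + LinearMap.trace 𝕜 Q gQ := by
  have : FiniteDimensional 𝕜 K := FiniteDimensional.of_injective i hi
  have : FiniteDimensional 𝕜 Q := Module.Finite.of_surjective φ hφ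
  obtain ⟨s, hs⟩ := φ.exists_rightInverse_of_surjective (LinearMap.range_eq_top.2 hφ)
  obtain ⟨p, hp⟩ := i.exists_leftInverse_of_injective (LinearMap.ker_eq_bot.2 hi)
  -- The splitting writes the identity of M as the sum of two projections, through K and through Q.
  -- The trace of g then separates, and cyclic invariance moves each part to K or Q.
  have hsum : i ∘ₗ (p ∘ₗ (LinearMap.id - s ∘ₗ φ)) + s ∘ₗ φ = LinearMap.id := by
    ext m
    obtain ⟨k, hk⟩ : m - s (φ m) ∈ LinearMap.range i := by
      rw [hex, LinearMap.mem_ker, map_sub]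
      have := LinearMap.congr_fun hs (φ m)
      simp only [LinearMap.comp_apply, LinearMap.id_apply] at this
      rw [this, sub_self]
    have hpk : p (i k) = k := LinearMap.congr_fun hp k
    simp only [LinearMap.add_apply, LinearMap.comp_apply, LinearMap.sub_apply, LinearMap.id_apply]
    rw [← hk, hpk, hk, sub_add_cancel]
  set q := p ∘ₗ (LinearMap.id - s ∘ₗ φ)
  have hqi : q ∘ₗ i = LinearMap.id := by
    ext k
    have : φ (i k) = 0 := by
      rw [← LinearMap.mem_ker, ← hex]
      exact ⟨k, rfl⟩
    simpa [q, this] using LinearMap.congr_fun hp k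
  calc LinearMap.trace 𝕜 M g = LinearMap.trace 𝕜 M (g ∘ₗ (i ∘ₗ q + s ∘ₗ φ)) := by
        rw [hsum, LinearMap.comp_id]
    _ = LinearMap.trace 𝕜 M ((i ∘ₗ gK) ∘ₗ q) + LinearMap.trace 𝕜 M ((g ∘ₗ s) ∘ₗ φ) := by
        rw [LinearMap.comp_add, map_add, ← h1]
        rfl
    _ = LinearMap.trace 𝕜 K gK + LinearMap.trace 𝕜 Q gQ := by
        rw [LinearMap.trace_comp_comm' q (i ∘ₗ gK), LinearMap.trace_comp_comm' φ (g ∘ₗ s),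
          ← LinearMap.comp_assoc, ← LinearMap.comp_assoc, h2, hqi, LinearMap.id_comp,
          LinearMap.comp_assoc, hs, LinearMap.comp_id]

open Classical in
theorem Finsupp.trace_lmapDomain {𝕜 α : Type*} [Field 𝕜] [Fintype α] (f : α → α) :
    LinearMap.trace 𝕜 (α →₀ 𝕜) (Finsupp.lmapDomain 𝕜 𝕜 f) =
      (Finset.univ.filter fun x => f x = x).card := by
  rw [LinearMap.trace_eq_matrix_trace 𝕜 Finsupp.basisSingleOne, Matrix.trace]
  simp [LinearMap.toMatrix_apply, Finsupp.mapDomain_single, Finsupp.single_apply]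

/-- The trace on cycles, in terms of the traces on chains. Here `b` reverses the edges, `ι` and `ε`
are the boundary map and the augmentation. -/
theorem LinearMap.two_mul_trace_cycles {𝕜 M P H : Type*} [Field 𝕜] [CharZero 𝕜] [AddCommGroup M]
    [Module 𝕜 M] [AddCommGroup P] [Module 𝕜 P] [AddCommGroup H] [Module 𝕜 H]
    [FiniteDimensional 𝕜 M] [FiniteDimensional 𝕜 P]
    {b g : M →ₗ[𝕜] M} {ι : M →ₗ[𝕜] P} {ε : P →ₗ[𝕜] 𝕜} {g₀ : P →ₗ[𝕜] P} {gH : H →ₗ[𝕜] H}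
    (i : H →ₗ[𝕜] M) (hi : Function.Injective i)
    (hH : LinearMap.range i = LinearMap.ker (b + LinearMap.id) ⊓ LinearMap.ker ι)
    (hgi : g ∘ₗ i = i ∘ₗ gH)
    (hbb : b ∘ₗ b = LinearMap.id) (hgb : g ∘ₗ b = b ∘ₗ g) (hgι : ι ∘ₗ g = g₀ ∘ₗ ι)
    (hε : ε ∘ₗ g₀ = ε) (hε' : Function.Surjective ε) (hει : ε ∘ₗ ι ∘ₗ b = ε ∘ₗ ι)
    (hex : ∀ p, ε p = 0 → ∃ z, b z = -z ∧ ι z = p) :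
    2 * LinearMap.trace 𝕜 H gH =
      LinearMap.trace 𝕜 M g - LinearMap.trace 𝕜 M (g ∘ₗ b) - 2 * LinearMap.trace 𝕜 P g₀ + 2 := by
  -- A is the space of cellular 1-chains. The projection (1 - b)/2 onto it gives the trace of g on
  -- A, and the exact sequences 0 → H → A → ker ε → 0 and 0 → ker ε → P → 𝕜 → 0 give the rest.
  let A : Submodule 𝕜 M := LinearMap.ker (b + LinearMap.id)
  have memA (z : M) : z ∈ A ↔ b z = -z := by
    simp [A, eq_neg_iff_add_eq_zero]
  have hA : ∀ z ∈ A, g z ∈ A := fun z hz => by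
    rw [memA] at hz ⊢
    rw [← LinearMap.comp_apply b g, ← hgb, LinearMap.comp_apply, hz, map_neg]
  let gA : A →ₗ[𝕜] A := g.restrict hA
  let p : M →ₗ[𝕜] A := LinearMap.codRestrict A ((2⁻¹ : 𝕜) • (LinearMap.id - b)) fun z => by
    have : b (b z) = z := LinearMap.congr_fun hbb z
    rw [memA]
    simp only [LinearMap.smul_apply, LinearMap.sub_apply, LinearMap.id_apply, map_smul, map_sub,
      this, ← smul_neg, neg_sub]
  have hp : p ∘ₗ A.subtype = LinearMap.id := by
    ext1 z
    refine Subtype.ext ?_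
    have := (memA z).1 z.2
    simp only [p, LinearMap.comp_apply, LinearMap.codRestrict_apply, LinearMap.smul_apply,
      LinearMap.sub_apply, LinearMap.id_apply, Submodule.subtype_apply, this, sub_neg_eq_add]
    rw [← two_smul 𝕜 (z : M), smul_smul, inv_mul_cancel₀ two_ne_zero, one_smul]
  have hp' : A.subtype ∘ₗ p = (2⁻¹ : 𝕜) • (LinearMap.id - b) := rfl
  have e1 : LinearMap.trace 𝕜 A gA =
      2⁻¹ * (LinearMap.trace 𝕜 M g - LinearMap.trace 𝕜 M (g ∘ₗ b)) := by
    calc LinearMap.trace 𝕜 A gA = LinearMap.trace 𝕜 A (p ∘ₗ (A.subtype ∘ₗ gA)) := by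
          rw [← LinearMap.comp_assoc, hp, LinearMap.id_comp]
      _ = LinearMap.trace 𝕜 M (g ∘ₗ (A.subtype ∘ₗ p)) := by
          rw [LinearMap.trace_comp_comm' (A.subtype ∘ₗ gA) p]
          rfl
      _ = _ := by
          rw [hp', LinearMap.comp_smul, LinearMap.comp_sub, LinearMap.comp_id, map_smul, map_sub,
            smul_eq_mul]
  let Z : Submodule 𝕜 P := LinearMap.ker ε
  have hZ : ∀ z ∈ Z, g₀ z ∈ Z := fun z hz => by
    have h1 := LinearMap.congr_fun hε z
    rw [LinearMap.mem_ker] at hz ⊢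
    rw [← hz, ← h1, LinearMap.comp_apply]
  let gZ : Z →ₗ[𝕜] Z := g₀.restrict hZ
  have e2 : LinearMap.trace 𝕜 P g₀ =
      LinearMap.trace 𝕜 Z gZ + LinearMap.trace 𝕜 𝕜 LinearMap.id :=
    LinearMap.trace_eq_add_of_exact Z.subtype ε Z.injective_subtype hε'
      (by rw [Submodule.range_subtype]) rfl hε
  have hι : ∀ z ∈ A, ι z ∈ Z := fun z hz => by
    have h2 := LinearMap.congr_fun hει z
    simp only [LinearMap.comp_apply, (memA z).1 hz, map_neg] at h2
    rw [LinearMap.mem_ker]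
    exact self_eq_neg.1 h2.symm
  let bd : A →ₗ[𝕜] Z := ι.restrict hι
  have hiA (h : H) : i h ∈ A := (hH.le ⟨h, rfl⟩).1
  let j : H →ₗ[𝕜] A := LinearMap.codRestrict A i hiA
  have e3 : LinearMap.trace 𝕜 A gA = LinearMap.trace 𝕜 H gH + LinearMap.trace 𝕜 Z gZ := by
    refine LinearMap.trace_eq_add_of_exact j bd (fun x y h => hi (congrArg Subtype.val h)) ?_ ?_
      ?_ ?_
    · rintro ⟨q, hq⟩
      obtain ⟨z, hz, rfl⟩ := hex q hq
      exact ⟨⟨z, (memA z).2 hz⟩, rfl⟩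
    · ext z
      rw [LinearMap.mem_ker, Subtype.ext_iff, LinearMap.mem_range]
      constructor
      · rintro ⟨h, rfl⟩
        exact (hH.le ⟨h, rfl⟩).2
      · intro hz
        obtain ⟨h, hh⟩ := hH.ge ⟨z.2, hz⟩
        exact ⟨h, Subtype.ext hh⟩
    · ext1 h
      exact Subtype.ext (LinearMap.congr_fun hgi h)
    · ext1 z
      exact Subtype.ext (LinearMap.congr_fun hgι z)
  rw [LinearMap.trace_id, Module.finrank_self, Nat.cast_one] at e2
  linear_combination 2 * e1 + 2 * e2 - 2 * e3

/-! ### The Lefschetz formula -/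

namespace GraphAction

variable {G : Type*} [Group G] {X : CWGraph.{u, v}} (a : GraphAction G X)

open Classical in
/-- The Lefschetz formula for an automorphism of a finite connected graph. -/
theorem two_mul_trace_homologyRep [Fintype X.Vert] [Fintype X.Dart] (hX : X.Connected) (g : G) :
    2 * LinearMap.trace ℂ X.H₁ (a.homologyRep g) =
      (Finset.univ.filter fun d => a.dart g d = d).card
      - (Finset.univ.filter fun d => a.dart g d = X.bar d).card
      - 2 * (Finset.univ.filter fun x => a.vert g x = x).card + 2 := by
  obtain ⟨x₀⟩ := hX.1
  have e5 : Finsupp.lmapDomain ℂ ℂ (a.dart g) ∘ₗ Finsupp.lmapDomain ℂ ℂ X.bar =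
      Finsupp.lmapDomain ℂ ℂ (a.dart g ∘ X.bar) := (Finsupp.lmapDomain_comp ℂ ℂ _ _).symm
  -- The trace of g composed with reversal counts the oriented edges inverted by g.
  have e6 : (Finset.univ.filter fun d => (a.dart g ∘ X.bar) d = d) =
      Finset.univ.filter fun d => a.dart g d = X.bar d := by
    ext d
    simp only [Function.comp_apply, Finset.mem_filter, Finset.mem_univ, true_and, ← a.bar_dart]
    exact ⟨fun h => by rw [← h, X.bar_bar, h], fun h => by rw [h, X.bar_bar]⟩
  refine (LinearMap.two_mul_trace_cycles (𝕜 := ℂ) (M := X.Dart →₀ ℂ) (P := X.Vert →₀ ℂ)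
    (H := X.H₁) (gH := a.homologyRep g) (b := Finsupp.lmapDomain ℂ ℂ X.bar)
    (g := Finsupp.lmapDomain ℂ ℂ (a.dart g)) (ι := Finsupp.lmapDomain ℂ ℂ X.ι)
    (ε := Finsupp.linearCombination ℂ fun _ => (1 : ℂ))
    (g₀ := Finsupp.lmapDomain ℂ ℂ (a.vert g)) X.H₁.subtype X.H₁.injective_subtype
    (Submodule.range_subtype _) rfl ?_ ?_ ?_ ?_ ?_ ?_ ?_).trans ?_
  · rw [← Finsupp.lmapDomain_comp, show X.bar ∘ X.bar = id from funext X.bar_bar,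
      Finsupp.lmapDomain_id]
  · rw [← Finsupp.lmapDomain_comp, ← Finsupp.lmapDomain_comp,
      show X.bar ∘ a.dart g = a.dart g ∘ X.bar from funext (a.bar_dart g)]
  · rw [← Finsupp.lmapDomain_comp, ← Finsupp.lmapDomain_comp,
      show X.ι ∘ a.dart g = a.vert g ∘ X.ι from funext (a.ι_dart g)]
  · ext d
    simp [Finsupp.mapDomain_single]
  · exact fun r => ⟨Finsupp.single x₀ r, by simp⟩
  · ext d
    simp [Finsupp.mapDomain_single]
  · intro f hf
    -- A 0-chain of total weight zero is the boundary of the chain that carries the weight at x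
    -- along a path from x to the base vertex.
    choose p hp using fun x => hX.2 x x₀
    refine ⟨Finsupp.linearCombination ℂ (fun x => X.walkChain (p x)) f, ?_, ?_⟩
    · rw [← LinearMap.comp_apply, ← LinearMap.neg_apply]
      congr 1
      ext1 x
      ext1
      simp [CWGraph.mapDomain_bar_walkChain]
    · have key : Finsupp.lmapDomain ℂ ℂ X.ι ∘ₗ
          Finsupp.linearCombination ℂ (fun x => X.walkChain (p x)) = LinearMap.id -
          (Finsupp.lsingle x₀) ∘ₗ Finsupp.linearCombination ℂ fun _ => (1 : ℂ) := by
        ext1 x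
        ext1
        simp [(hp x).mapDomain_ι_walkChain]
      have := LinearMap.congr_fun key f
      simpa [hf] using this
  · rw [e5, Finsupp.trace_lmapDomain, Finsupp.trace_lmapDomain, Finsupp.trace_lmapDomain, e6]

end GraphAction

/-! ### Spanning trees -/

/-- A set with a fixed point free involution has a set of representatives. -/
theorem Finset.exists_half {α : Type*} [Fintype α] [DecidableEq α] (f : α → α)
    (hf : ∀ x, f (f x) = x) (hne : ∀ x, f x ≠ x) (s : Finset α) (hs : ∀ x ∈ s, f x ∈ s) :
    ∃ r ⊆ s, 2 * r.card = s.card ∧ ∀ x ∈ s, x ∈ r ∨ f x ∈ r := by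
  let e := Fintype.equivFin α
  have hinj : Function.Injective f := Function.LeftInverse.injective hf
  have hlt (x : α) : e x < e (f x) ∨ e (f x) < e x :=
    lt_or_gt_of_ne fun h => hne x (e.injective h).symm
  -- From each pair {x, f x} the element that comes first in an enumeration is chosen.
  refine ⟨s.filter fun x => e x < e (f x), Finset.filter_subset _ _, ?_, fun x hx => ?_⟩
  · have h1 : (s.filter fun x => e x < e (f x)).image f = s.filter fun x => ¬ e x < e (f x) := by
      ext y
      simp only [Finset.mem_image, Finset.mem_filter, not_lt]
      constructor
      · rintro ⟨x, ⟨hx, hlt⟩, rfl⟩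
        exact ⟨hs x hx, by rw [hf]; exact hlt.le⟩
      · rintro ⟨hy, hle⟩
        refine ⟨f y, ⟨hs y hy, ?_⟩, hf y⟩
        rw [hf]
        exact (hlt y).resolve_left hle.not_gt
    have h2 := Finset.card_image_of_injective (s.filter fun x => e x < e (f x)) hinj
    rw [h1] at h2
    rw [← Finset.card_filter_add_card_filter_not (s := s) (fun x => e x < e (f x)), h2]
    ring
  · rcases hlt x with h | h
    · exact Or.inl (Finset.mem_filter.2 ⟨hx, h⟩)
    · exact Or.inr (Finset.mem_filter.2 ⟨hs x hx, by rwa [hf]⟩)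

namespace CWGraph

variable {X : CWGraph.{u, v}}

theorem pathClass_append (l m : List X.Dart) :
    X.pathClass (l ++ m) = X.pathClass l * X.pathClass m := by simp [pathClass]

theorem pathClass_cons (d : X.Dart) (l : List X.Dart) :
    X.pathClass (d :: l) = PresentedGroup.of d * X.pathClass l := by simp [pathClass]

theorem of_bar (d : X.Dart) :
    (PresentedGroup.of (X.bar d) : X.PathGroup) = (PresentedGroup.of d)⁻¹ :=
  eq_inv_of_mul_eq_one_right (X.of_mul_of_bar d)

/-- A finite connected graph has a spanning tree, here given by its set `F` of oriented edges and
its paths `p x` starting at the root. -/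
theorem Connected.exists_spanningTree (hX : X.Connected) [Fintype X.Vert] [DecidableEq X.Dart]
    (a : X.Vert) : ∃ (p : X.Vert → List X.Dart) (F : Finset X.Dart),
      (∀ x, X.IsWalk a (p x) x) ∧ p a = [] ∧ (∀ d ∈ F, X.bar d ∈ F) ∧
      F.card + 2 = 2 * Fintype.card X.Vert ∧
      ∀ d ∈ F, X.pathClass (p (X.ι d)) * PresentedGroup.of d = X.pathClass (p (X.τ d)) := by
  classical
  -- The tree is grown edge by edge: S is its vertex set, and F contains both orientations of its n
  -- edges. Outside S the paths `p x` are arbitrary until their end point is reached.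
  suffices h : ∀ n, n + 1 ≤ Fintype.card X.Vert → ∃ (S : Finset X.Vert)
      (p : X.Vert → List X.Dart) (F : Finset X.Dart), a ∈ S ∧ S.card = n + 1 ∧
      (∀ d ∈ F, X.ι d ∈ S) ∧ (∀ x, X.IsWalk a (p x) x) ∧ p a = [] ∧ (∀ d ∈ F, X.bar d ∈ F) ∧
      F.card = 2 * n ∧
      ∀ d ∈ F, X.pathClass (p (X.ι d)) * PresentedGroup.of d = X.pathClass (p (X.τ d)) by
    have hpos : 0 < Fintype.card X.Vert := Fintype.card_pos_iff.2 ⟨a⟩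
    obtain ⟨S, p, F, _, _, _, h1, h2, h3, h4, h5⟩ := h (Fintype.card X.Vert - 1) (by omega)
    exact ⟨p, F, h1, h2, h3, by omega, h5⟩
  intro n
  induction n with
  | zero =>
    intro _
    choose p hp using hX.2 a
    refine ⟨{a}, Function.update p a [], ∅, by simp, by simp, by simp, fun x => ?_, by simp,
      by simp, by simp, by simp⟩
    by_cases hx : x = a
    · subst hx
      rw [Function.update_self]
      rfl
    · rw [Function.update_of_ne hx]
      exact hp x
  | succ n ih =>
    intro hn
    obtain ⟨S, p, F, haS, hS, hFS, hp, hpa, hbar, hF, hcl⟩ := ih (by omega)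
    obtain ⟨d, hd, hd'⟩ : ∃ d, X.ι d ∈ S ∧ X.τ d ∉ S := by
      by_contra! hcon
      have : S = Finset.univ := Finset.eq_univ_iff_forall.2 fun y =>
        hX.mem_of_closed (S := (S : Set X.Vert)) (fun d hd => hcon d hd) haS y
      rw [this, Finset.card_univ] at hS
      omega
    have hdF : d ∉ F := fun h => hd' (hFS _ (hbar d h))
    have hdF' : X.bar d ∉ F := fun h => hd' (hFS _ h)
    have hτF : ∀ e ∈ F, X.τ e ∈ S := fun e he => hFS _ (hbar e he)
    have hup : ∀ x ∈ S, Function.update p (X.τ d) (p (X.ι d) ++ [d]) x = p x := fun x hx =>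
      Function.update_of_ne (fun h : x = X.τ d => hd' (h ▸ hx)) _ _
    refine ⟨insert (X.τ d) S, Function.update p (X.τ d) (p (X.ι d) ++ [d]),
      insert d (insert (X.bar d) F), Finset.mem_insert_of_mem haS, ?_, ?_, fun x => ?_, ?_, ?_, ?_,
      ?_⟩
    · rw [Finset.card_insert_of_notMem hd', hS]
    · intro e he
      rcases Finset.mem_insert.1 he with rfl | he
      · exact Finset.mem_insert_of_mem hd
      · rcases Finset.mem_insert.1 he with rfl | he
        · exact Finset.mem_insert_self _ _
        · exact Finset.mem_insert_of_mem (hFS e he)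
    · by_cases hx : x = X.τ d
      · subst hx
        rw [Function.update_self]
        exact (hp _).append ⟨rfl, rfl⟩
      · rw [Function.update_of_ne hx]
        exact hp x
    · rw [hup a haS, hpa]
    · intro e he
      rcases Finset.mem_insert.1 he with rfl | he
      · simp
      · rcases Finset.mem_insert.1 he with rfl | he
        · simp [X.bar_bar]
        · exact Finset.mem_insert_of_mem (Finset.mem_insert_of_mem (hbar e he))
    · rw [Finset.card_insert_of_notMem, Finset.card_insert_of_notMem hdF', hF]
      · ring
      · simp [hdF, (X.bar_ne d).symm]
    · intro e he
      rcases Finset.mem_insert.1 he with rfl | he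
      · rw [hup _ hd, Function.update_self, pathClass_append]
        simp [pathClass]
      · rcases Finset.mem_insert.1 he with rfl | he
        · rw [τ_bar, hup _ hd, show X.ι (X.bar d) = X.τ d from rfl, Function.update_self,
            pathClass_append, of_bar]
          simp [pathClass]
        · rw [hup _ (hFS e he), hup _ (hτF e he), hcl e he]

/-- The fundamental group of a finite connected graph is generated by as many elements as there are
edges outside a spanning tree. -/
theorem Connected.two_mul_rank_le (hX : X.Connected) [Fintype X.Vert] [Fintype X.Dart]
    (a : X.Vert) [Group.FG (X.π₁ a)] :
    2 * Group.rank (X.π₁ a) + 2 * Fintype.card X.Vert ≤ Fintype.card X.Dart + 2 := by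
  classical
  obtain ⟨p, F, hp, hpa, hbar, hF, hcl⟩ := hX.exists_spanningTree a
  -- R contains one orientation of each edge outside the tree; the corresponding loops γ generate,
  -- since the loop of a tree edge is trivial and reversal inverts γ.
  obtain ⟨R, -, hR, hR'⟩ := Finset.exists_half X.bar X.bar_bar X.bar_ne Fᶜ (by
    intro d hd
    rw [Finset.mem_compl] at hd ⊢
    exact fun h => hd (X.bar_bar d ▸ hbar _ h))
  have hloop (d : X.Dart) :
      X.IsWalk a (p (X.ι d) ++ d :: ((p (X.τ d)).map X.bar).reverse) a :=
    (hp _).append ⟨rfl, (hp _).reverse⟩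
  let γ (d : X.Dart) : X.π₁ a := ⟨X.pathClass _, _, hloop d, rfl⟩
  have hγ (d : X.Dart) : (γ d : X.PathGroup) =
      X.pathClass (p (X.ι d)) * PresentedGroup.of d * (X.pathClass (p (X.τ d)))⁻¹ := by
    simp only [γ, pathClass_append, pathClass_cons, pathClass_reverse, mul_assoc]
  set C := (Subgroup.closure ((R.image γ : Finset _) : Set (X.π₁ a))).map (X.π₁ a).subtype with hC
  have hγC (d : X.Dart) : (γ d : X.PathGroup) ∈ C := by
    by_cases hd : d ∈ F
    · rw [hγ, hcl d hd, mul_inv_cancel]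
      exact C.one_mem
    · have hmem : ∀ e ∈ R, (γ e : X.PathGroup) ∈ C := fun e he =>
        ⟨γ e, Subgroup.subset_closure (Finset.mem_coe.2 (Finset.mem_image_of_mem γ he)), rfl⟩
      rcases hR' d (Finset.mem_compl.2 hd) with h | h
      · exact hmem d h
      · have : (γ d : X.PathGroup) = (γ (X.bar d) : X.PathGroup)⁻¹ := by
          rw [hγ, hγ, τ_bar, of_bar, show X.ι (X.bar d) = X.τ d from rfl]
          group
        rw [this]
        exact C.inv_mem (hmem _ h)
  -- Closing up each edge of a path through the root writes the path, closed up at its ends, as a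
  -- telescoping product of the loops γ.
  have hwalk : ∀ (l : List X.Dart) (x y : X.Vert), X.IsWalk x l y →
      X.pathClass (p x) * X.pathClass l * (X.pathClass (p y))⁻¹ ∈ C := by
    intro l
    induction l with
    | nil =>
      rintro x y rfl
      simp [pathClass]
    | cons d l ih =>
      rintro x y ⟨rfl, h⟩
      have := C.mul_mem (hγC d) (ih _ _ h)
      rw [hγ] at this
      rw [pathClass_cons]
      convert this using 1
      group
  have htop : Subgroup.closure ((R.image γ : Finset _) : Set (X.π₁ a)) = ⊤ := by
    rw [eq_top_iff]
    rintro ⟨_, l, hl, rfl⟩ -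
    have := hwalk l a a hl
    rw [hpa] at this
    obtain ⟨w, hw, hw'⟩ := this
    have hx : w = ⟨X.pathClass l, l, hl, rfl⟩ := Subtype.ext (hw'.trans (by simp [pathClass]))
    exact hx ▸ hw
  have h1 := (Group.rank_le htop).trans Finset.card_image_le
  rw [Finset.card_compl] at hR
  have h2 := Finset.card_le_univ F
  omega

end CWGraph

/-- The Euler characteristic of a finite graph with an action, in terms of its rank. -/
theorem GraphAction.euler_of_hasRank {G : Type*} [Group G] {X : CWGraph.{u, v}}
    (a : GraphAction G X) {n : ℕ} (hX : X.HasRank n) [Fintype X.Vert] [Fintype X.Dart] :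
    Fintype.card X.Dart + 2 = 2 * n + 2 * Fintype.card X.Vert ∧ Module.finrank ℂ X.H₁ = n := by
  classical
  obtain ⟨hfin, hle⟩ := hX.finrank_H₁_le
  obtain ⟨x⟩ := hX.1.1
  obtain ⟨hfg, hr⟩ := hX.2 x
  have h1 := hX.1.two_mul_rank_le x
  rw [hr] at h1
  -- At the identity the Lefschetz formula gives dim H₁ = E - V + 1. As dim H₁ ≤ n by spanning and n
  -- ≤ E - V + 1 by the spanning tree, all three numbers agree.
  have h2 := a.two_mul_trace_homologyRep hX.1 1
  have hfree : Module.Free ℂ X.H₁ := Module.Free.of_divisionRing ℂ X.H₁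
  have htr : LinearMap.trace ℂ X.H₁ 1 = (Module.finrank ℂ X.H₁ : ℂ) := LinearMap.trace_one ℂ X.H₁
  rw [map_one, htr] at h2
  simp only [map_one, Equiv.Perm.coe_one, id_eq, Finset.filter_true, Finset.card_univ,
    (X.bar_ne _).symm, Finset.filter_false, Finset.card_empty] at h2
  have h3 : 2 * Module.finrank ℂ X.H₁ + 2 * Fintype.card X.Vert = Fintype.card X.Dart + 2 := by
    have : (2 * Module.finrank ℂ X.H₁ + 2 * Fintype.card X.Vert : ℂ) =
      Fintype.card X.Dart + 2 := by
      rw [h2]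
      push_cast
      ring
    exact_mod_cast this
  omega

/-! ### Rotation groups of the cube acting on graphs -/

/-- Elements of a group that satisfy the relations of rotations of the cube: the half-turns `n i`
about the coordinate axes, a rotation `c` of order three permuting the axes cyclically and a
half-turn `t` interchanging the first two axes. -/
structure CubeFrame (K : Type*) [Group K] where
  n : Fin 3 → K
  c : K
  t : K
  n_mul_self : ∀ i, n i * n i = 1
  n_mul_n : ∀ i, n i * n (i + 1) = n (i + 2)
  c_pow : c ^ 3 = 1
  c_mul_n : ∀ i, c * n i = n (i + 1) * c
  t_mul_c : t * c = c ^ 2 * t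
  t_mul_n_zero : t * n 0 = n 1 * t
  t_mul_n_one : t * n 1 = n 0 * t
  t_mul_n_two : t * n 2 = n 2 * t
  normal : ∀ k i, ∃ j, k * n i = n j * k

namespace CubeFrame

variable {K α : Type*} [Group K] (F : CubeFrame K) (φ : K →* Equiv.Perm α)

theorem n_n (i : Fin 3) (x : α) : φ (F.n i) (φ (F.n i) x) = x := by
  rw [← Equiv.Perm.mul_apply, ← map_mul, F.n_mul_self, map_one, Equiv.Perm.one_apply]

theorem n_n_add_one (i : Fin 3) (x : α) :
    φ (F.n i) (φ (F.n (i + 1)) x) = φ (F.n (i + 2)) x := by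
  rw [← Equiv.Perm.mul_apply, ← map_mul, F.n_mul_n]

theorem n_n_add_two (i : Fin 3) (x : α) :
    φ (F.n i) (φ (F.n (i + 2)) x) = φ (F.n (i + 1)) x := by
  rw [← F.n_n_add_one φ i x, F.n_n]

theorem c_n (i : Fin 3) (x : α) : φ F.c (φ (F.n i) x) = φ (F.n (i + 1)) (φ F.c x) := by
  rw [← Equiv.Perm.mul_apply, ← map_mul, F.c_mul_n, map_mul, Equiv.Perm.mul_apply]

theorem c_c_c (x : α) : φ F.c (φ F.c (φ F.c x)) = x := by
  rw [← Equiv.Perm.mul_apply, ← Equiv.Perm.mul_apply, ← map_mul, ← map_mul, ← pow_two, ← pow_succ,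
    F.c_pow, map_one, Equiv.Perm.one_apply]

theorem t_c (x : α) : φ F.t (φ F.c x) = φ F.c (φ F.c (φ F.t x)) := by
  rw [← Equiv.Perm.mul_apply, ← map_mul, F.t_mul_c, pow_two, map_mul, map_mul,
    Equiv.Perm.mul_apply, Equiv.Perm.mul_apply]

theorem t_n_zero (x : α) : φ F.t (φ (F.n 0) x) = φ (F.n 1) (φ F.t x) := by
  rw [← Equiv.Perm.mul_apply, ← map_mul, F.t_mul_n_zero, map_mul, Equiv.Perm.mul_apply]

theorem t_n_one (x : α) : φ F.t (φ (F.n 1) x) = φ (F.n 0) (φ F.t x) := by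
  rw [← Equiv.Perm.mul_apply, ← map_mul, F.t_mul_n_one, map_mul, Equiv.Perm.mul_apply]

theorem t_n_two (x : α) : φ F.t (φ (F.n 2) x) = φ (F.n 2) (φ F.t x) := by
  rw [← Equiv.Perm.mul_apply, ← map_mul, F.t_mul_n_two, map_mul, Equiv.Perm.mul_apply]

theorem c_c_ne {x : α} (hx : φ F.c x ≠ x) : φ F.c (φ F.c x) ≠ x := fun h =>
  hx (by have := F.c_c_c φ x; rwa [h] at this)

theorem c_eq_iff {x y : α} : φ F.c x = φ F.c y ↔ x = y := (φ F.c).apply_eq_iff_eq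

/-- If `c` fixes an invariant set pointwise, then so do the `n i`. -/
theorem n_eq_self_of_c_eq_self {S : Set α} (hS : ∀ i, ∀ x ∈ S, φ (F.n i) x ∈ S)
    (hc : ∀ x ∈ S, φ F.c x = x) (i : Fin 3) {x : α} (hx : x ∈ S) : φ (F.n i) x = x := by
  -- As c conjugates the half-turns cyclically, all of them agree on S. Since the product of two is
  -- the third, their common value at x must be x.
  have h (j : Fin 3) : φ (F.n (j + 1)) x = φ (F.n j) x := by
    have := F.c_n φ j x
    rw [hc x hx, hc _ (hS j x hx)] at this
    exact this.symm
  have h1 : φ (F.n (i + 1)) x = x := by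
    refine (φ (F.n i)).injective ?_
    rw [F.n_n_add_one, show i + 2 = i + 1 + 1 from (add_assoc i 1 1).symm, h, h]
  rw [← h i, h1]

/-- The `n i` act trivially on an invariant set of three elements permuted by `c`. -/
theorem n_eq_self_of_mem_orbit {x : α} (hx : φ F.c x ≠ x)
    (h : ∀ i, φ (F.n i) x = x ∨ φ (F.n i) x = φ F.c x ∨ φ (F.n i) x = φ F.c (φ F.c x))
    (i : Fin 3) : φ (F.n i) x = x := by
  -- If n_j x = c x, conjugation by c² shows that n_{j+2} interchanges x and c² x. Then n_{j+1} x =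
  -- n_j c² x, which is fixed by c, although c fixes no point of the orbit of x.
  have key (j : Fin 3) : φ (F.n j) x ≠ φ F.c x := by
    intro hj
    have h1 : φ (F.n (j + 2)) (φ F.c (φ F.c x)) = x := by
      rw [show j + 2 = j + 1 + 1 from (add_assoc j 1 1).symm, ← F.c_n, ← F.c_n, hj, F.c_c_c]
    have h2 : φ (F.n (j + 2)) x = φ F.c (φ F.c x) := by
      rw [← F.n_n φ (j + 2) (φ F.c (φ F.c x)), h1]
    have h3 : φ (F.n (j + 1)) x = φ (F.n j) (φ F.c (φ F.c x)) := by rw [← h2, F.n_n_add_two]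
    have h4 : φ F.c (φ (F.n (j + 1)) x) = φ (F.n (j + 1)) x := by
      rw [h3, F.c_n, F.c_c_c, ← h3]
    rcases h (j + 1) with h' | h' | h' <;> rw [h'] at h4
    · exact hx h4
    · exact hx ((φ F.c).injective h4)
    · exact hx ((φ F.c).injective ((φ F.c).injective h4))
  rcases h i with hi | hi | hi
  · exact hi
  · exact absurd hi (key i)
  -- Applying c to n_i x = c² x gives n_{i+1} c x = x, which is the case just excluded.
  · refine absurd ?_ (key (i + 1))
    rw [← F.n_n φ (i + 1) (φ F.c x), ← F.c_n φ i x, hi, F.c_c_c]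

end CubeFrame

/-! ### Counting what the rotation of order three moves -/

/-- The number of points moved by a permutation of order three is a multiple of three. -/
theorem Equiv.Perm.three_dvd_card {α : Type*} [DecidableEq α] (σ : Equiv.Perm α)
    (hσ : σ ^ 3 = 1) (s : Finset α) (hs : ∀ x ∈ s, σ x ∈ s) (hne : ∀ x ∈ s, σ x ≠ x) :
    3 ∣ s.card := by
  have h3 (x : α) : σ (σ (σ x)) = x := by
    have := Equiv.ext_iff.1 hσ x
    simpa [pow_succ] using this
  have hs' : ∀ x, σ x ∈ s ↔ x ∈ s := fun x => ⟨fun h => h3 x ▸ hs _ (hs _ h), hs x⟩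
  have hp : Fact (Nat.Prime 3) := ⟨Nat.prime_three⟩
  let f : Function.End s := fun x => σ.subtypePerm hs' x
  have hf : f ^ 3 ^ 1 = 1 := by
    rw [pow_one, pow_three]
    funext x
    exact Subtype.ext (h3 x.1)
  have h := Equiv.Perm.card_fixedPoints_modEq hf
  have : IsEmpty (Function.fixedPoints f) :=
    ⟨fun x => hne x.1 x.1.2 (congrArg Subtype.val x.2)⟩
  rw [Fintype.card_coe, Fintype.card_eq_zero] at h
  exact Nat.dvd_of_mod_eq_zero h

namespace CWGraph

variable {X : CWGraph.{u, v}}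

open Classical in
theorem sum_eq_zero_of_mem_H₁ [Fintype X.Dart] {z : X.Dart →₀ ℂ} (hz : z ∈ X.H₁) (x : X.Vert) :
    ∑ d ∈ Finset.univ.filter (fun d => X.ι d = x), z d = 0 := by
  have h := DFunLike.congr_fun ((X.mem_H₁_iff z).1 hz).2 x
  rw [Finsupp.mapDomain, Finsupp.sum_fintype _ _ (by simp), Finsupp.finsetSum_apply] at h
  simpa [Finsupp.single_apply, Finset.sum_filter] using h

end CWGraph

/-- What is used of an action of a group with a `CubeFrame` on a finite graph of rank five. -/
structure GraphAction.IsCubical {K : Type*} [Group K] {X : CWGraph.{u, v}} (a : GraphAction K X)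
    (F : CubeFrame K) : Prop where
  conn : X.Connected
  finite_vert : Finite X.Vert
  finite_dart : Finite X.Dart
  exists_cycle : ∀ d, ∃ z ∈ X.H₁, z d ≠ 0
  three_le : ∀ x, 3 ≤ {d | X.ι d = x}.ncard
  euler : Nat.card X.Dart = 2 * Nat.card X.Vert + 8
  fix_c : {d | a.dart F.c d = d}.ncard = 2 * {x | a.vert F.c x = x}.ncard + 2
  fix_t : {d | a.dart F.t d = d}.ncard =
    {d | a.dart F.t d = X.bar d}.ncard + 2 * {x | a.vert F.t x = x}.ncard
  moved : ∃ i d, a.dart (F.n i) d ≠ d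
  invariant_t : ∀ z ∈ X.H₁, (∀ i, a.chainRep (F.n i) z = z) → a.chainRep F.t z = z
  axis_t : ∀ z ∈ X.H₁, a.chainRep (F.n 2) z = z → a.chainRep (F.n 0) z = -z →
    a.chainRep F.t z = -z

theorem Fin.eq_or_eq_add (i j : Fin 3) : j = i ∨ j = i + 1 ∨ j = i + 2 := by
  revert i j
  decide

theorem Set.subset_triple_of_ncard_eq {α : Type*} {s : Set α} (hs : s.ncard = 3) {x y z : α}
    (hx : x ∈ s) (hy : y ∈ s) (hz : z ∈ s) (hxy : x ≠ y) (hxz : x ≠ z) (hyz : y ≠ z) :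
    s = {x, y, z} := by
  symm
  refine Set.eq_of_subset_of_ncard_le ?_ ?_ (Set.finite_of_ncard_ne_zero (by omega))
  · rintro _ (rfl | rfl | rfl) <;> assumption
  · rw [hs, Set.ncard_eq_three.2 ⟨x, y, z, hxy, hxz, hyz, rfl⟩]

namespace GraphAction.IsCubical

variable {K : Type*} [Group K] {X : CWGraph.{u, v}} {a : GraphAction K X} {F : CubeFrame K}

theorem c_fixed_ι (a : GraphAction K X) (g : K) {d : X.Dart} (h : a.dart g d = d) :
    a.vert g (X.ι d) = X.ι d := by rw [← a.ι_dart, h]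

/-- Counting the vertices moved by `c` and the moved oriented edges leaving fixed vertices. -/
theorem count (h : a.IsCubical F) :
    ({x | a.vert F.c x ≠ x} = ∅ ∧ {d | a.dart F.c d ≠ d}.ncard = 6) ∨
    ({x | a.vert F.c x ≠ x}.ncard = 3 ∧
      {d | a.vert F.c (X.ι d) = X.ι d ∧ a.dart F.c d ≠ d}.ncard = 3 ∧
      ∀ x, a.vert F.c x ≠ x → {d | X.ι d = x}.ncard = 3) := by
  classical
  have := h.finite_vert
  have := h.finite_dart
  have := Fintype.ofFinite X.Vert
  have := Fintype.ofFinite X.Dart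
  have hcV : a.vert F.c ^ 3 = 1 := by rw [← map_pow, F.c_pow, map_one]
  have hcD : a.dart F.c ^ 3 = 1 := by rw [← map_pow, F.c_pow, map_one]
  have heuler := h.euler
  have hfix := h.fix_c
  have hval := h.three_le
  simp only [Set.ncard_eq_toFinset_card', Set.toFinset_ofPred, Nat.card_eq_fintype_card] at *
  set f := (Finset.univ.filter fun x => a.vert F.c x = x).card with hf
  set M := (Finset.univ.filter fun x => a.vert F.c x ≠ x) with hM
  set Q := (Finset.univ.filter fun d => a.vert F.c (X.ι d) = X.ι d ∧ a.dart F.c d ≠ d) with hQ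
  set D := (Finset.univ.filter fun d => a.vert F.c (X.ι d) ≠ X.ι d) with hD
  have e1 : f + M.card = Fintype.card X.Vert :=
    Finset.card_filter_add_card_filter_not (s := Finset.univ) (fun x => a.vert F.c x = x)
  have e2 : (Finset.univ.filter fun d => a.vert F.c (X.ι d) = X.ι d).card + D.card =
      Fintype.card X.Dart :=
    Finset.card_filter_add_card_filter_not (s := Finset.univ)
      (fun d => a.vert F.c (X.ι d) = X.ι d)
  have e3 : (Finset.univ.filter fun d => a.dart F.c d = d).card + Q.card =
      (Finset.univ.filter fun d => a.vert F.c (X.ι d) = X.ι d).card := by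
    rw [← Finset.card_filter_add_card_filter_not
      (s := Finset.univ.filter fun d => a.vert F.c (X.ι d) = X.ι d) (fun d => a.dart F.c d = d),
      Finset.filter_filter, Finset.filter_filter]
    congr 2
    ext d
    simp only [Finset.mem_filter, Finset.mem_univ, true_and]
    exact ⟨fun hd => ⟨c_fixed_ι a F.c hd, hd⟩, fun hd => hd.2⟩
  have e4 : D.card = ∑ x ∈ M, (Finset.univ.filter fun d => X.ι d = x).card := by
    rw [Finset.card_eq_sum_card_fiberwise (f := X.ι) (t := M) (fun d hd => by simpa [D, M] using hd)]
    refine Finset.sum_congr rfl fun x hx => ?_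
    congr 1
    ext d
    simp only [D, Finset.filter_filter, Finset.mem_filter, Finset.mem_univ, true_and]
    refine ⟨fun hd => hd.2, fun hd => ⟨?_, hd⟩⟩
    rw [hd]
    simpa [M] using hx
  have e5 : M.card * 3 ≤ D.card := by
    rw [e4]
    exact Finset.card_nsmul_le_sum _ _ _ fun x _ => hval x
  have d1 : 3 ∣ M.card := (a.vert F.c).three_dvd_card hcV M
    (fun x hx => by simpa [M] using hx) (fun x hx => by simpa [M] using hx)
  have d2 : 3 ∣ Q.card := (a.dart F.c).three_dvd_card hcD Q
    (fun d hd => by simpa [Q, a.ι_dart] using hd) (fun d hd => by simp [Q] at hd; exact hd.2)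
  -- If all edges leaving fixed vertices are fixed, the set of fixed vertices is closed under
  -- adjacency. It is not empty, because the Lefschetz count provides a fixed edge.
  have hQ0 : Q.card ≠ 0 ∨ M.card = 0 := by
    by_contra! hcon
    obtain ⟨hq, hm⟩ := hcon
    rw [Finset.card_eq_zero] at hq
    have hpos : 0 < (Finset.univ.filter fun d => a.dart F.c d = d).card := by omega
    obtain ⟨d, hd⟩ := Finset.card_pos.1 hpos
    rw [Finset.mem_filter] at hd
    have hall : ∀ y, a.vert F.c y = y := fun y =>
      h.conn.mem_of_closed (S := {x | a.vert F.c x = x}) (fun e he => by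
        have : a.dart F.c e = e := by
          by_contra hne
          have : e ∈ Q := by simp [Q, hne]; exact he
          simp [hq] at this
        exact (a.τ_dart F.c e).symm.trans (by rw [this]))
        (c_fixed_ι a F.c hd.2) y
    exact hm (by simp [M, hall])
  have hM0 : M.card = 0 → D.card = 0 := fun hm => by
    rw [e4, Finset.card_eq_zero.1 hm, Finset.sum_empty]
  -- The counts combine to |Q| + |D| = 2|M| + 6. With |D| ≥ 3|M| this gives |Q| + |M| ≤ 6, where
  -- both terms are multiples of three and |Q| = 0 only if |M| = 0.
  have hcases : (M.card = 0 ∧ Q.card = 6) ∨ (M.card = 3 ∧ Q.card = 3 ∧ D.card = 9) := by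
    by_cases hm : M.card = 0
    · have := hM0 hm
      omega
    · omega
  rcases hcases with ⟨hm, hq⟩ | ⟨hm, hq, hd⟩
  · have hm' : ∀ x, a.vert F.c x = x := by
      intro x
      by_contra hx
      have : x ∈ M := by simpa [M] using hx
      simp [Finset.card_eq_zero.1 hm] at this
    refine Or.inl ⟨by ext x; simp [hm' x], ?_⟩
    rw [← hq]
    simp [Q, hm']
  · refine Or.inr ⟨hm, hq, fun x hx => ?_⟩
    have hxM : x ∈ M := by simpa [M] using hx
    have hle : ∑ y ∈ M.erase x, (Finset.univ.filter fun d => X.ι d = y).card ≥ 2 * 3 := by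
      have := Finset.card_nsmul_le_sum (M.erase x)
        (fun y => (Finset.univ.filter fun d => X.ι d = y).card) 3 fun y _ => hval y
      rwa [Finset.card_erase_of_mem hxM, hm] at this
    have := Finset.add_sum_erase M (fun y => (Finset.univ.filter fun d => X.ι d = y).card) hxM
    have := hval x
    omega

end GraphAction.IsCubical

/-! ### Three moved vertices are impossible -/

namespace GraphAction.IsCubical

variable {K : Type*} [Group K] {X : CWGraph.{u, v}} {a : GraphAction K X} {F : CubeFrame K}

/-- `c` cannot move exactly three vertices. -/
theorem not_three_moved (h : a.IsCubical F) (hM : {x | a.vert F.c x ≠ x}.ncard = 3)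
    (hQ : {d | a.vert F.c (X.ι d) = X.ι d ∧ a.dart F.c d ≠ d}.ncard = 3)
    (hval : ∀ x, a.vert F.c x ≠ x → {d | X.ι d = x}.ncard = 3) : False := by
  classical
  have := h.finite_vert
  have := h.finite_dart
  have := Fintype.ofFinite X.Dart
  -- an edge from a fixed to a moved vertex
  obtain ⟨d, hdι, hdτ⟩ : ∃ d, a.vert F.c (X.ι d) = X.ι d ∧ a.vert F.c (X.τ d) ≠ X.τ d := by
    by_contra! hcon
    have hpos : 0 < {d | a.dart F.c d = d}.ncard := by rw [h.fix_c]; omega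
    obtain ⟨e, he⟩ := (Set.ncard_pos).1 hpos
    have hall := h.conn.mem_of_closed (S := {x | a.vert F.c x = x}) hcon (c_fixed_ι a F.c he)
    have : {x | a.vert F.c x ≠ x} = ∅ := Set.eq_empty_iff_forall_notMem.2 fun x hx => hx (hall x)
    simp [this] at hM
  have cV := F.c_c_c a.vert
  have cD := F.c_c_c a.dart
  have τc := a.τ_dart F.c
  have ιc := a.ι_dart F.c
  have moved_of_τ : ∀ e, a.vert F.c (X.τ e) ≠ X.τ e → a.dart F.c e ≠ e := fun e he h' =>
    he (by rw [← τc, h'])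
  have hd := moved_of_τ d hdτ
  have hmovedV : ∀ x, a.vert F.c x ≠ x →
      x = X.τ d ∨ x = a.vert F.c (X.τ d) ∨ x = a.vert F.c (a.vert F.c (X.τ d)) := by
    have := Set.subset_triple_of_ncard_eq hM (x := X.τ d) (y := a.vert F.c (X.τ d))
      (z := a.vert F.c (a.vert F.c (X.τ d))) hdτ (by simpa using hdτ) (by simpa using hdτ)
      hdτ.symm (F.c_c_ne a.vert hdτ).symm (by simpa using hdτ.symm)
    intro x hx
    have hx' : x ∈ {x | a.vert F.c x ≠ x} := hx
    rw [this] at hx'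
    exact hx'
  -- By the count, the translates of `d` under c are all the moved oriented edges that leave fixed
  -- vertices. These are the spokes; they share their origin and end at the three moved vertices.
  have hspoke : ∀ e, a.vert F.c (X.ι e) = X.ι e → a.dart F.c e ≠ e →
      e = d ∨ e = a.dart F.c d ∨ e = a.dart F.c (a.dart F.c d) := by
    have := Set.subset_triple_of_ncard_eq hQ (x := d) (y := a.dart F.c d)
      (z := a.dart F.c (a.dart F.c d)) ⟨hdι, hd⟩ ⟨by simpa [ιc] using hdι, by simpa using hd⟩
      ⟨by simpa [ιc] using hdι, by simpa using hd⟩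
      hd.symm (F.c_c_ne a.dart hd).symm (by simpa using hd.symm)
    intro e he he'
    have hx' : e ∈ {d | a.vert F.c (X.ι d) = X.ι d ∧ a.dart F.c d ≠ d} := ⟨he, he'⟩
    rw [this] at hx'
    exact hx'
  have hspoke_ι : ∀ e, a.vert F.c (X.ι e) = X.ι e → a.dart F.c e ≠ e → X.ι e = X.ι d := by
    intro e he he'
    rcases hspoke e he he' with rfl | rfl | rfl <;> simp [ιc, hdι]
  have hspoke_τ : ∀ e, a.vert F.c (X.ι e) = X.ι e → a.dart F.c e ≠ e →
      a.vert F.c (X.τ e) ≠ X.τ e := by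
    intro e he he'
    rcases hspoke e he he' with rfl | rfl | rfl <;> simpa [τc] using hdτ
  have hspoke_inj : ∀ e e', a.vert F.c (X.ι e) = X.ι e → a.vert F.c (X.ι e') = X.ι e' →
      a.dart F.c e ≠ e → a.dart F.c e' ≠ e' → X.τ e = X.τ e' → e = e' := by
    intro e e' h1 h1' h2 h2' h3
    have k1 := F.c_c_ne a.vert hdτ
    rcases hspoke e h1 h2 with rfl | rfl | rfl <;> rcases hspoke e' h1' h2' with h4 | h4 | h4 <;>
      subst h4 <;> simp only [τc, F.c_eq_iff] at h3 <;> first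
        | rfl
        | exact absurd h3 hdτ
        | exact absurd h3.symm hdτ
        | exact absurd h3 k1
        | exact absurd h3.symm k1
  -- every moved vertex has a spoke
  have hex : ∀ x, a.vert F.c x ≠ x → ∃ s, a.vert F.c (X.ι s) = X.ι s ∧ X.τ s = x := by
    intro x hx
    rcases hmovedV x hx with rfl | rfl | rfl
    · exact ⟨d, hdι, rfl⟩
    · exact ⟨a.dart F.c d, by simp [ιc, hdι], τc _⟩
    · exact ⟨a.dart F.c (a.dart F.c d), by simp [ιc, hdι], by simp [τc]⟩
  have hdarts : ∀ {x}, a.vert F.c x ≠ x → ∀ {e₁ e₂ e₃}, X.ι e₁ = x → X.ι e₂ = x → X.ι e₃ = x →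
      e₁ ≠ e₂ → e₁ ≠ e₃ → e₂ ≠ e₃ → {e | X.ι e = x} = {e₁, e₂, e₃} :=
    fun hx _ _ _ h1 h2 h3 => Set.subset_triple_of_ncard_eq (hval _ hx) h1 h2 h3
  -- there are no loops at moved vertices
  have hnoloop : ∀ e, a.vert F.c (X.ι e) ≠ X.ι e → X.τ e ≠ X.ι e := by
    intro e he hloop
    obtain ⟨s, hs, hsτ⟩ := hex _ he
    have n1 : e ≠ X.bar s := fun h' => he (by
      rw [← hloop, h', X.τ_bar, hs])
    have n2 : X.bar e ≠ X.bar s := fun h' => he (by rw [X.bar_injective h', hs])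
    -- The valence is three, so a loop and the spoke exhaust the edges at this vertex. The spoke
    -- would be a bridge, but it lies on a cycle.
    have hset := hdarts he rfl hloop hsτ (X.bar_ne e).symm n1 n2
    obtain ⟨z, hz, hzs⟩ := h.exists_cycle s
    have hsum := CWGraph.sum_eq_zero_of_mem_H₁ hz (X.ι e)
    have hfil : (Finset.univ.filter fun d => X.ι d = X.ι e) = {e, X.bar e, X.bar s} := by
      ext u
      simpa using Set.ext_iff.1 hset u
    rw [hfil, Finset.sum_insert (by simp [n1, (X.bar_ne e).symm]), Finset.sum_pair n2,
      ((X.mem_H₁_iff z).1 hz).1, ((X.mem_H₁_iff z).1 hz).1] at hsum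
    exact hzs (by linear_combination -hsum)
  -- at a moved vertex, every edge but the spoke leads to another moved vertex
  have hτ_moved : ∀ s u, a.vert F.c (X.ι s) = X.ι s → a.vert F.c (X.τ s) ≠ X.τ s →
      X.ι u = X.τ s → u ≠ X.bar s → a.vert F.c (X.τ u) ≠ X.τ u := by
    intro s u hs hsτ hu hne hτu
    have e1 : X.τ (X.bar u) = X.τ s := by rw [X.τ_bar, hu]
    have e2 := hspoke_inj (X.bar u) s hτu hs (moved_of_τ _ (by rwa [e1])) (moved_of_τ _ hsτ) e1
    exact hne (by rw [← e2, X.bar_bar])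
  have hexu : ∀ x s, a.vert F.c x ≠ x → X.τ s = x → ∃ u, X.ι u = x ∧ u ≠ X.bar s := by
    intro x s hx hs
    obtain ⟨u, hu, hne⟩ := Set.exists_ne_of_one_lt_ncard
      (show 1 < {e | X.ι e = x}.ncard by rw [hval x hx]; omega) (X.bar s)
    exact ⟨u, hu, hne⟩
  have hother : ∀ x y, a.vert F.c x ≠ x → a.vert F.c y ≠ y → y ≠ x →
      y = a.vert F.c x ∨ y = a.vert F.c (a.vert F.c x) := by
    intro x y hx hy hyx
    rcases hmovedV x hx with rfl | rfl | rfl <;> rcases hmovedV y hy with rfl | rfl | rfl <;> first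
      | exact absurd rfl hyx
      | exact Or.inl rfl
      | exact Or.inr rfl
      | exact Or.inl (cV _).symm
      | exact Or.inr (cV _).symm
  by_cases hN : ∃ i x, a.vert F.c x ≠ x ∧ a.vert F.c (a.vert (F.n i) x) = a.vert (F.n i) x
  · -- a moved vertex lies in the orbit of a fixed vertex: the complete graph on four vertices
    obtain ⟨i, x, hx, hw⟩ := hN
    set w := a.vert (F.n i) x with hwdef
    have hx0 : a.vert (F.n i) w = x := F.n_n a.vert i x
    have hx1 : a.vert (F.n (i + 1)) w = a.vert F.c x := by
      rw [← hx0, F.c_n, hw]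
    have hx2 : a.vert (F.n (i + 2)) w = a.vert F.c (a.vert F.c x) := by
      rw [← hx1, F.c_n, hw, add_assoc]
      rfl
    obtain ⟨s, hs, hsτ⟩ := hex x hx
    obtain ⟨u, hu, hus⟩ := hexu x s hx hsτ
    have hτu : a.vert F.c (X.τ u) ≠ X.τ u :=
      hτ_moved s u hs (by rwa [hsτ]) (by rw [hu, hsτ]) hus
    have hτux : X.τ u ≠ x := hu ▸ hnoloop u (by rwa [hu])
    -- The edge `u` between moved vertices is taken by n_i to an edge from w to a moved vertex. This
    -- is a spoke, so w is the common origin of the spokes.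
    have hτnu : a.vert F.c (X.τ (a.dart (F.n i) u)) ≠ X.τ (a.dart (F.n i) u) := by
      rw [a.τ_dart]
      rcases hother x _ hx hτu hτux with h' | h' <;> rw [h']
      · rw [← hx1, F.n_n_add_one, hx2]
        simpa using hx
      · rw [← hx2, F.n_n_add_two, hx1]
        simpa using hx
    have hιnu : X.ι (a.dart (F.n i) u) = w := by rw [a.ι_dart, hu]
    have hwd : w = X.ι d := by
      rw [← hspoke_ι (a.dart (F.n i) u) (by rw [hιnu, hw]) (moved_of_τ _ hτnu), hιnu]
    have hmovedw : ∀ y, a.vert F.c y ≠ y →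
        y = w ∨ ∃ j, y = a.vert (F.n j) w := by
      intro y hy
      by_cases hyx : y = x
      · exact Or.inr ⟨i, by rw [hx0, hyx]⟩
      · rcases hother x y hx hy hyx with h' | h'
        · exact Or.inr ⟨i + 1, by rw [hx1, h']⟩
        · exact Or.inr ⟨i + 2, by rw [hx2, h']⟩
    have hvw : {e | X.ι e = w}.ncard = 3 := by
      rw [← hval x hx]
      symm
      refine Set.ncard_congr (fun e _ => a.dart (F.n i) e) (fun e he => ?_) (fun e e' _ _ h' => ?_)
        fun e he => ⟨a.dart (F.n i) e, ?_, F.n_n a.dart i e⟩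
      · exact (a.ι_dart _ _).trans (by rw [show X.ι e = x from he])
      · exact (a.dart (F.n i)).injective h'
      · exact (a.ι_dart _ _).trans (by rw [show X.ι e = w from he, hx0])
    have hdw : ∀ e, X.ι e = w → a.dart F.c e ≠ e := by
      intro e he
      have hset := Set.subset_triple_of_ncard_eq hvw (x := d) (y := a.dart F.c d)
        (z := a.dart F.c (a.dart F.c d)) hwd.symm (by simp [ιc, hdι, hwd])
        (by simp [ιc, hdι, hwd]) hd.symm (F.c_c_ne a.dart hd).symm (by simpa using hd.symm)
      have he' : e ∈ {e | X.ι e = w} := he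
      rw [hset] at he'
      rcases he' with rfl | rfl | rfl <;> simpa using hd
    have hstar : ∀ e, X.ι e = w → ∃ j, X.τ e = a.vert (F.n j) w := by
      intro e he
      have h1 := hspoke_τ e (by rw [he, hw]) (hdw e he)
      rcases hmovedw _ h1 with h2 | h2
      · exact absurd (by rw [h2, hw]) h1
      · exact h2
    have hNw : ∀ j k, ∃ l, a.vert (F.n j) (a.vert (F.n k) w) = w ∨
        a.vert (F.n j) (a.vert (F.n k) w) = a.vert (F.n l) w := by
      intro j k
      rcases Fin.eq_or_eq_add j k with rfl | rfl | rfl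
      · exact ⟨0, Or.inl (F.n_n _ _ _)⟩
      · exact ⟨j + 2, Or.inr (F.n_n_add_one _ _ _)⟩
      · exact ⟨j + 1, Or.inr (F.n_n_add_two _ _ _)⟩
    -- Edges at w lead to translates of w, and the half-turns carry this property to every
    -- translate; connectedness leaves no further vertices.
    have hall := h.conn.mem_of_closed (S := {y | y = w ∨ ∃ j, y = a.vert (F.n j) w}) (fun e he => by
      rcases he with he | ⟨j, he⟩
      · exact Or.inr (hstar e he)
      · obtain ⟨k, hk⟩ := hstar (a.dart (F.n j) e) (by rw [a.ι_dart, he, F.n_n])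
        rw [a.τ_dart] at hk
        obtain ⟨l, hl⟩ := hNw j k
        rw [← hk, F.n_n] at hl
        exact hl.imp_right fun h' => ⟨l, h'⟩) (x := w) (Or.inl rfl)
    -- By the Lefschetz count c fixes some edge. Its origin is fixed by c, so it is w, but all edges
    -- at w are moved.
    have hpos : 0 < {d | a.dart F.c d = d}.ncard := by rw [h.fix_c]; omega
    obtain ⟨e, he⟩ := (Set.ncard_pos).1 hpos
    refine hdw e ?_ he
    have hιe := c_fixed_ι a F.c he
    rcases hall (X.ι e) with h' | ⟨j, h'⟩
    · exact h'
    · exfalso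
      rcases Fin.eq_or_eq_add i j with rfl | rfl | rfl
      · rw [h', hx0] at hιe
        exact hx hιe
      · rw [h', hx1] at hιe
        exact hx (by simpa using hιe)
      · rw [h', hx2] at hιe
        exact hx (by simpa using hιe)
  · -- otherwise the `n i` act trivially
    push Not at hN
    have hNmoved : ∀ i x, a.vert F.c x ≠ x → a.vert (F.n i) x = x := by
      intro i x hx
      refine F.n_eq_self_of_mem_orbit a.vert hx (fun j => ?_) i
      by_cases hj : a.vert (F.n j) x = x
      · exact Or.inl hj
      · exact Or.inr (hother x _ hx (hN j x hx) hj)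
    have hNfixed : ∀ i x, a.vert (F.n i) x = x := by
      intro i x
      by_cases hx : a.vert F.c x = x
      · refine F.n_eq_self_of_c_eq_self a.vert (S := {x | a.vert F.c x = x}) (fun j y hy => ?_)
          (fun y hy => hy) i hx
        by_contra hne
        have h1 := hNmoved j _ hne
        rw [F.n_n] at h1
        exact hne (by rw [← h1]; exact hy)
      · exact hNmoved i x hx
    have hιN : ∀ i e, X.ι (a.dart (F.n i) e) = X.ι e := fun i e => by rw [a.ι_dart, hNfixed]
    have hτN : ∀ i e, X.τ (a.dart (F.n i) e) = X.τ e := fun i e => by rw [a.τ_dart, hNfixed]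
    -- An edge between fixed vertices is not a spoke, so c fixes it and the half-turns do too. A
    -- spoke is determined by its end point, which the half-turns fix.
    have hfix1 : ∀ i e, a.vert F.c (X.ι e) = X.ι e → a.dart (F.n i) e = e := by
      intro i e he
      by_cases hτe : a.vert F.c (X.τ e) = X.τ e
      · refine F.n_eq_self_of_c_eq_self a.dart
          (S := {e | a.vert F.c (X.ι e) = X.ι e ∧ a.vert F.c (X.τ e) = X.τ e}) (fun j y hy => ?_)
          (fun y hy => ?_) i ⟨he, hτe⟩
        · exact ⟨by rw [hιN]; exact hy.1, by rw [hτN]; exact hy.2⟩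
        · by_contra hne
          exact hspoke_τ y hy.1 hne hy.2
      · exact hspoke_inj _ _ (by rw [hιN, he]) he (moved_of_τ _ (by rwa [hτN]))
          (moved_of_τ _ hτe) (hτN i e)
    obtain ⟨i, u, hiu⟩ := h.moved
    have hιu : a.vert F.c (X.ι u) ≠ X.ι u := fun h' => hiu (hfix1 i u h')
    have hτu : a.vert F.c (X.τ u) ≠ X.τ u := fun h' => hiu (by
      have := hfix1 i (X.bar u) h'
      rw [← a.bar_dart] at this
      exact X.bar_injective this)
    have hne := hnoloop u hιu
    obtain ⟨s, hs, hsτ⟩ := hex _ hτu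
    -- an edge from the end of `u` to the third moved vertex
    obtain ⟨v, hvι, hvτ, hvτ'⟩ : ∃ v, X.ι v = X.τ u ∧ X.τ v ≠ X.ι u ∧
        a.vert F.c (X.τ v) ≠ X.τ v := by
      rcases hother _ _ hιu hτu hne with h' | h'
      · refine ⟨a.dart F.c u, by rw [ιc, h'], ?_, ?_⟩
        · rw [τc, h']
          exact F.c_c_ne a.vert hιu
        · simpa [τc] using hτu
      · refine ⟨a.dart F.c (a.dart F.c u), by rw [ιc, ιc, h'], ?_, ?_⟩
        · rw [τc, τc, h', cV]
          exact hιu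
        · simpa [τc] using hτu
    have m1 : X.τ (X.bar u) = X.ι u := X.τ_bar u
    have m2 : X.τ (X.bar (a.dart (F.n i) u)) = X.ι u := by rw [X.τ_bar, hιN]
    have m3 : X.τ (X.bar s) = X.ι s := X.τ_bar s
    -- The parallel edges `u` and n_i u, together with `v`, exhaust the valence at the end of `u`.
    -- All three lead to moved vertices, so none of them is the spoke.
    have hset := hdarts hτu (e₁ := X.bar u) (e₂ := X.bar (a.dart (F.n i) u)) (e₃ := v) rfl
      (hτN i u) hvι (fun h' => hiu (X.bar_injective h').symm) (fun h' => hvτ (by rw [← h', m1]))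
      (fun h' => hvτ (by rw [← h', m2]))
    have hmem : X.bar s ∈ {e | X.ι e = X.τ u} := hsτ
    rw [hset] at hmem
    rcases hmem with h' | h' | h'
    · exact hιu (by rw [← m1, ← h', m3, hs])
    · exact hιu (by rw [← m2, ← h', m3, hs])
    · exact hvτ' (by rw [← h', m3, hs])

end GraphAction.IsCubical

/-! ### No moved vertices: the moved edges are three loops -/

namespace CubeFrame

variable {K α : Type*} [Group K] (F : CubeFrame K) (φ : K →* Equiv.Perm α)

/-- Conjugation by t permutes the half-turns, so t preserves the set of their common fixed points.
-/
theorem n_t_eq_self {x : α} (h : ∀ i, φ (F.n i) x = x) (i : Fin 3) :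
    φ (F.n i) (φ F.t x) = φ F.t x := by
  fin_cases i
  · exact (F.t_n_one φ x).symm.trans (by rw [h])
  · exact (F.t_n_zero φ x).symm.trans (by rw [h])
  · exact (F.t_n_two φ x).symm.trans (by rw [h])

end CubeFrame

namespace GraphAction.IsCubical

variable {K : Type*} [Group K] {X : CWGraph.{u, v}} {a : GraphAction K X} {F : CubeFrame K}

/-- Inverting an edge has even order on it, which is impossible for c and c² because c³ = 1. -/
theorem bar_ne_c (a : GraphAction K X) (F : CubeFrame K) (e : X.Dart) :
    X.bar e ≠ a.dart F.c e ∧ X.bar e ≠ a.dart F.c (a.dart F.c e) := by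
  have h3 := F.c_c_c a.dart e
  have hb := a.bar_dart F.c
  constructor <;> intro h
  · have h1 : a.dart F.c (a.dart F.c e) = e := by rw [← h, ← hb, ← h, X.bar_bar]
    rw [h1] at h3
    exact X.bar_ne e (h.trans h3)
  · have h1 : a.dart F.c e = e := by
      have : X.bar (X.bar e) = a.dart F.c (a.dart F.c (X.bar e)) := by
        conv_lhs => rw [h]
        rw [hb, hb]
      rw [X.bar_bar, h, h3] at this
      exact this.symm
    rw [h1, h1] at h
    exact X.bar_ne e h

/-- If `c` moves three edges, then these are the translates of any one of them. -/
theorem eq_of_c_ne (h6 : {d | a.dart F.c d ≠ d}.ncard = 6) {e : X.Dart} (he : a.dart F.c e ≠ e)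
    {d : X.Dart} (hd : a.dart F.c d ≠ d) :
    (d = e ∨ d = a.dart F.c e ∨ d = a.dart F.c (a.dart F.c e)) ∨
      X.bar d = e ∨ X.bar d = a.dart F.c e ∨ X.bar d = a.dart F.c (a.dart F.c e) := by
  classical
  have hb := a.bar_dart F.c
  obtain ⟨b1, b2⟩ := bar_ne_c a F e
  have b3 := X.bar_ne e
  have c1 : a.dart F.c e ≠ e := he
  have c2 := F.c_c_ne a.dart he
  have h3 := F.c_c_c a.dart e
  let s : Finset X.Dart := {e, a.dart F.c e, a.dart F.c (a.dart F.c e)}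
  have hs : s.card = 3 := by
    rw [Finset.card_eq_three]
    exact ⟨_, _, _, c1.symm, c2.symm, by simpa using c1.symm, rfl⟩
  have hs' : (s.image X.bar).card = 3 := by
    rw [Finset.card_image_of_injective _ X.bar_injective, hs]
  have hbarc : ∀ x ∈ s, X.bar x ∉ s := by
    have hc3 : ∀ x ∈ s, e = x ∨ e = a.dart F.c x ∨ e = a.dart F.c (a.dart F.c x) := by
      intro x hx
      simp only [s, Finset.mem_insert, Finset.mem_singleton] at hx
      rcases hx with rfl | rfl | rfl <;> simp [h3]
    intro x hx hx'
    have e1 := bar_ne_c a F x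
    have e2 := X.bar_ne x
    simp only [s, Finset.mem_insert, Finset.mem_singleton] at hx hx'
    rcases hx with rfl | rfl | rfl <;> rcases hx' with h' | h' | h' <;> simp_all
  have hdisj : Disjoint s (s.image X.bar) := by
    rw [Finset.disjoint_left]
    intro x hx hx'
    obtain ⟨y, hy, rfl⟩ := Finset.mem_image.1 hx'
    exact hbarc y hy hx
  have hcs : ∀ x ∈ s, a.dart F.c x ≠ x := by
    intro x hx
    simp only [s, Finset.mem_insert, Finset.mem_singleton] at hx
    rcases hx with rfl | rfl | rfl <;> simpa using c1
  -- The three translates and their three reversals are disjoint, as no power of c inverts an edge,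
  -- so they are all of the six moved oriented edges.
  have hsub : ((s ∪ s.image X.bar : Finset X.Dart) : Set X.Dart) = {d | a.dart F.c d ≠ d} := by
    refine Set.eq_of_subset_of_ncard_le ?_ ?_ (Set.finite_of_ncard_ne_zero (by omega))
    · intro x hx
      rcases Finset.mem_union.1 (Finset.mem_coe.1 hx) with hx | hx
      · exact hcs x hx
      · obtain ⟨y, hy, rfl⟩ := Finset.mem_image.1 hx
        intro h'
        rw [← hb] at h'
        exact hcs y hy (X.bar_injective h')
    · rw [h6, Set.ncard_coe_finset, Finset.card_union_of_disjoint hdisj, hs, hs']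
  have hmem : d ∈ ((s ∪ s.image X.bar : Finset X.Dart) : Set X.Dart) := hsub ▸ hd
  rcases Finset.mem_union.1 (Finset.mem_coe.1 hmem) with hx | hx
  · exact Or.inl (by simpa [s] using hx)
  · obtain ⟨y, hy, rfl⟩ := Finset.mem_image.1 hx
    rw [X.bar_bar]
    exact Or.inr (by simpa [s] using hy)

/-- Each half-turn is a commutator of c with another half-turn, so it acts trivially wherever c
does. -/
theorem n_vert (hall : ∀ x, a.vert F.c x = x) (i : Fin 3) (x : X.Vert) : a.vert (F.n i) x = x :=
  F.n_eq_self_of_c_eq_self a.vert (S := Set.univ) (fun _ _ _ => trivial) (fun x _ => hall x) i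
    trivial

/-- Four parallel edges permuted like the diagonals of the cube do not occur. -/
theorem n_eq_self_of_c_eq_self (h : a.IsCubical F) (hall : ∀ x, a.vert F.c x = x)
    (h6 : {d | a.dart F.c d ≠ d}.ncard = 6) {p : X.Dart} (hp : a.dart F.c p = p) (i : Fin 3) :
    a.dart (F.n i) p = p := by
  by_contra hi
  have := h.finite_vert
  have := h.finite_dart
  have hb := fun g => a.bar_dart g
  have hnv := fun i x => n_vert (a := a) hall i x
  have cn (j : Fin 3) : a.dart F.c (a.dart (F.n j) p) = a.dart (F.n (j + 1)) p := by
    rw [F.c_n, hp]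
  have n01 : ∀ d, a.dart (F.n 0) (a.dart (F.n 1) d) = a.dart (F.n 2) d := F.n_n_add_one a.dart 0
  have n12 : ∀ d, a.dart (F.n 1) (a.dart (F.n 2) d) = a.dart (F.n 0) d := F.n_n_add_one a.dart 1
  have n20 : ∀ d, a.dart (F.n 2) (a.dart (F.n 0) d) = a.dart (F.n 1) d := F.n_n_add_one a.dart 2
  have n02 : ∀ d, a.dart (F.n 0) (a.dart (F.n 2) d) = a.dart (F.n 1) d := F.n_n_add_two a.dart 0
  have n10 : ∀ d, a.dart (F.n 1) (a.dart (F.n 0) d) = a.dart (F.n 2) d := F.n_n_add_two a.dart 1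
  have n21 : ∀ d, a.dart (F.n 2) (a.dart (F.n 1) d) = a.dart (F.n 0) d := F.n_n_add_two a.dart 2
  have nn := F.n_n a.dart
  have hne : ∀ j, a.dart (F.n j) p ≠ p := by
    have hstep : ∀ j, a.dart (F.n j) p = p → a.dart (F.n (j + 1)) p = p := fun j hj => by
      rw [← cn, hj, hp]
    intro j hj
    have h1 := hstep j hj
    have h2 := hstep _ h1
    rcases Fin.eq_or_eq_add j i with rfl | rfl | rfl
    · exact hi hj
    · exact hi h1
    · exact hi (by rwa [add_assoc] at h2)
  have c0 : a.dart F.c (a.dart (F.n 0) p) = a.dart (F.n 1) p := cn 0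
  have c1 : a.dart F.c (a.dart (F.n 1) p) = a.dart (F.n 2) p := cn 1
  have c2 : a.dart F.c (a.dart (F.n 2) p) = a.dart (F.n 0) p := cn 2
  have hmoved : a.dart F.c (a.dart (F.n 0) p) ≠ a.dart (F.n 0) p := by
    rw [c0]
    intro h'
    have := n01 p
    rw [h', nn] at this
    exact hne 2 this.symm
  -- the eight oriented edges
  have hP : ∀ d, a.dart F.c d ≠ d → (∃ j, d = a.dart (F.n j) p) ∨ ∃ j, X.bar d = a.dart (F.n j) p := by
    intro d hd
    have := eq_of_c_ne h6 hmoved hd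
    rw [c0, c1] at this
    rcases this with (h' | h' | h') | h' | h' | h'
    exacts [Or.inl ⟨_, h'⟩, Or.inl ⟨_, h'⟩, Or.inl ⟨_, h'⟩, Or.inr ⟨_, h'⟩, Or.inr ⟨_, h'⟩,
      Or.inr ⟨_, h'⟩]
  let P : Set X.Dart := {d | (d = p ∨ ∃ j, d = a.dart (F.n j) p) ∨
    (X.bar d = p ∨ ∃ j, X.bar d = a.dart (F.n j) p)}
  have hPn' : ∀ j d, (d = p ∨ ∃ k, d = a.dart (F.n k) p) →
      (a.dart (F.n j) d = p ∨ ∃ k, a.dart (F.n j) d = a.dart (F.n k) p) := by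
    rintro j d (rfl | ⟨k, rfl⟩)
    · exact Or.inr ⟨j, rfl⟩
    · rcases Fin.eq_or_eq_add j k with rfl | rfl | rfl
      · exact Or.inl (nn _ _)
      · exact Or.inr ⟨_, F.n_n_add_one _ _ _⟩
      · exact Or.inr ⟨_, F.n_n_add_two _ _ _⟩
  have hPn : ∀ j d, d ∈ P → a.dart (F.n j) d ∈ P := by
    rintro j d (hd | hd)
    · exact Or.inl (hPn' j d hd)
    · refine Or.inr ?_
      rw [hb]
      exact hPn' j _ hd
  have hfix : ∀ d, d ∉ P → ∀ j, a.dart (F.n j) d = d := by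
    intro d hd j
    refine F.n_eq_self_of_c_eq_self a.dart (S := Pᶜ) (fun k e he he' => he ?_) (fun e he => ?_) j hd
    · have := hPn k _ he'
      rwa [nn] at this
    · by_contra hne'
      refine he ?_
      rcases hP e hne' with h' | h'
      · exact Or.inl (Or.inr h')
      · exact Or.inr (Or.inr h')
  have hcj : ∀ j, a.dart F.c (a.dart (F.n j) p) ≠ a.dart (F.n j) p := by
    intro j
    fin_cases j
    · exact hmoved
    · change a.dart F.c (a.dart (F.n 1) p) ≠ a.dart (F.n 1) p
      intro h'
      rw [← c0] at h'
      exact hmoved ((a.dart F.c).injective h')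
    · change a.dart F.c (a.dart (F.n 2) p) ≠ a.dart (F.n 2) p
      intro h'
      rw [← c1, ← c0] at h'
      exact hmoved ((a.dart F.c).injective ((a.dart F.c).injective h'))
  -- From t c = c² t it follows that c fixes t p. The half-turns do not all fix t p, so it is one of
  -- the eight oriented edges, and among these only p and its reversal are fixed by c.
  have htp : a.dart F.t p = p ∨ a.dart F.t p = X.bar p := by
    have hc : a.dart F.c (a.dart F.t p) = a.dart F.t p := by
      have h1 := F.t_c a.dart p
      rw [hp] at h1
      conv_lhs => rw [h1]
      exact F.c_c_c _ _
    have hmem : a.dart F.t p ∈ P := by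
      by_contra hcon
      have h1 := hfix _ hcon 1
      rw [← F.t_n_zero] at h1
      exact hne 0 ((a.dart F.t).injective h1)
    rcases hmem with (h' | ⟨j, h'⟩) | (h' | ⟨j, h'⟩)
    · exact Or.inl h'
    · rw [h'] at hc
      exact absurd hc (hcj j)
    · exact Or.inr ((X.bar_bar _).symm.trans (congrArg X.bar h'))
    · have hc' := congrArg X.bar hc
      rw [hb, h'] at hc'
      exact absurd hc' (hcj j)
  have hιn : ∀ j d, X.ι (a.dart (F.n j) d) = X.ι d := fun j d => by rw [a.ι_dart, hnv]
  have hτn : ∀ j d, X.τ (a.dart (F.n j) d) = X.τ d := fun j d => by rw [a.τ_dart, hnv]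
  have hbarp : ∀ j, a.dart (F.n j) p ≠ X.bar p := by
    intro j h'
    apply hcj j
    rw [h', ← hb, hp]
  have e0 : ∀ j, X.dartChain (a.dart (F.n j) p) p = 0 := fun j =>
    CWGraph.dartChain_apply_of_ne (hne j) (hbarp j)
  have e1 : X.dartChain p p = 1 := CWGraph.dartChain_apply_self p
  have hbd : ∀ j, Finsupp.mapDomain X.ι (X.dartChain (a.dart (F.n j) p)) =
      Finsupp.mapDomain X.ι (X.dartChain p) := fun j => by
    rw [CWGraph.mapDomain_ι_dartChain, CWGraph.mapDomain_ι_dartChain, hιn, hτn]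
  have hrep := a.chainRep_dartChain
  have htp' : a.dart F.t p = X.bar p := by
    refine htp.resolve_left fun htp => ?_
    -- The four edges are parallel, so z is a cycle. It spans an axis: n₂ fixes it and n₀ negates
    -- it. If t fixes p, then t exchanges n₀ p and n₁ p and fixes z, whereas t must negate such a
    -- vector.
    let z : X.Dart →₀ ℂ := X.dartChain p + X.dartChain (a.dart (F.n 2) p)
      - X.dartChain (a.dart (F.n 0) p) - X.dartChain (a.dart (F.n 1) p)
    have hz : z ∈ X.H₁ := by
      simp only [CWGraph.H₁, Submodule.mem_inf, LinearMap.mem_ker, LinearMap.add_apply,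
        LinearMap.id_apply, z, map_add, map_sub, Finsupp.lmapDomain_apply,
        CWGraph.mapDomain_bar_dartChain, hbd]
      constructor <;> abel
    have h1 := h.axis_t z hz (by simp only [z, map_add, map_sub, hrep, nn, n20, n21]; abel)
      (by simp only [z, map_add, map_sub, hrep, nn, n01, n02]; abel)
    have h2 : a.chainRep F.t z = z := by
      simp only [z, map_add, map_sub, hrep, F.t_n_two, F.t_n_one, F.t_n_zero, htp]
      abel
    have h3 := DFunLike.congr_fun (h2.symm.trans h1) p
    simp only [z, Finsupp.neg_apply, Finsupp.add_apply, Finsupp.sub_apply, e0, e1] at h3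
    norm_num at h3
  have hpmoved : ∀ l : List X.Dart, (∀ d ∈ l, ∀ j, a.dart (F.n j) d = d) → p ∉ l ∧ X.bar p ∉ l := by
    refine fun l hl => ⟨fun h' => hne 0 (hl p h' 0), fun h' => hne 0 ?_⟩
    have := hl _ h' 0
    rw [← hb] at this
    exact X.bar_injective this
  have hnowalk : ∀ l, (∀ d ∈ l, ∀ j, a.dart (F.n j) d = d) → ¬ X.IsWalk (X.ι p) l (X.τ p) := by
    intro l hl hw
    -- The factor 4 balances the boundaries of the four parallel edges. The cycle z is invariant
    -- under the half-turns, hence under t; but t inverts p, where z has coefficient -1.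
    let z : X.Dart →₀ ℂ := (4 : ℂ) • X.walkChain l - (X.dartChain p + X.dartChain (a.dart (F.n 0) p)
      + X.dartChain (a.dart (F.n 1) p) + X.dartChain (a.dart (F.n 2) p))
    have hz : z ∈ X.H₁ := by
      simp only [CWGraph.H₁, Submodule.mem_inf, LinearMap.mem_ker, LinearMap.add_apply,
        LinearMap.id_apply, z, map_add, map_sub, map_smul, Finsupp.lmapDomain_apply,
        CWGraph.mapDomain_bar_dartChain, hbd, CWGraph.mapDomain_bar_walkChain,
        hw.mapDomain_ι_walkChain, CWGraph.mapDomain_ι_dartChain]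
      constructor <;> module
    have hlN (j : Fin 3) : a.chainRep (F.n j) (X.walkChain l) = X.walkChain l := by
      rw [a.chainRep_walkChain, List.map_congr_left (g := id) fun d hd => hl d hd j, List.map_id]
    have h1 := h.invariant_t z hz (fun j => by
      fin_cases j
      · change a.chainRep (F.n 0) z = z
        simp only [z, map_add, map_sub, map_smul, hlN, hrep, nn, n01, n02]
        abel
      · change a.chainRep (F.n 1) z = z
        simp only [z, map_add, map_sub, map_smul, hlN, hrep, nn, n10, n12]
        abel
      · change a.chainRep (F.n 2) z = z
        simp only [z, map_add, map_sub, map_smul, hlN, hrep, nn, n20, n21]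
        abel)
    have h2 := a.chainRep_apply F.t z p
    rw [h1, htp', ((X.mem_H₁_iff z).1 hz).1] at h2
    obtain ⟨h3, h4⟩ := hpmoved l hl
    have h5 : z p = -1 := by
      simp only [z, Finsupp.sub_apply, Finsupp.smul_apply, Finsupp.add_apply, e0, e1,
        CWGraph.walkChain_apply_of_notMem h3 h4]
      norm_num
    rw [h5] at h2
    norm_num at h2
  have htι : a.vert F.t (X.ι p) = X.τ p := by rw [← a.ι_dart, htp']; rfl
  have htτ : a.vert F.t (X.τ p) = X.ι p := by rw [← a.τ_dart, htp', X.τ_bar]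
  have hPι : ∀ d ∈ P, X.τ d = X.ι p ∨ X.τ d = X.τ p := by
    rintro d ((rfl | ⟨j, rfl⟩) | (h' | ⟨j, h'⟩))
    · exact Or.inr rfl
    · exact Or.inr (hτn _ _)
    · exact Or.inl (congrArg X.ι h')
    · exact Or.inl ((congrArg X.ι h').trans (hιn _ _))
  -- Every vertex can be reached from an end of p without using the four edges, because on crossing
  -- one of them the path can be restarted at an end of p.
  have hreach := h.conn.mem_of_closed (S := {y | ∃ l, (∀ d ∈ l, ∀ j, a.dart (F.n j) d = d) ∧
    (X.IsWalk (X.ι p) l y ∨ X.IsWalk (X.τ p) l y)}) (x := X.ι p) (by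
      rintro d ⟨l, hl, hw⟩
      by_cases hd : d ∈ P
      · refine ⟨[], by simp, ?_⟩
        rcases hPι d hd with h' | h'
        · exact Or.inl h'.symm
        · exact Or.inr h'.symm
      · refine ⟨l ++ [d], fun e he j => ?_, ?_⟩
        · rcases List.mem_append.1 he with he | he
          · exact hl e he j
          · rw [List.mem_singleton.1 he]
            exact hfix d hd j
        · exact hw.imp (fun hw => hw.append ⟨rfl, rfl⟩) (fun hw => hw.append ⟨rfl, rfl⟩))
    ⟨[], by simp, Or.inl rfl⟩
  have hjoin : ∀ l m : List X.Dart, (∀ d ∈ l, ∀ j, a.dart (F.n j) d = d) →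
      (∀ d ∈ m, ∀ j, a.dart (F.n j) d = d) → ∀ y, X.IsWalk (X.ι p) l y →
      ¬ X.IsWalk (X.τ p) m y := by
    intro l m hl hm y h1 h2
    refine hnowalk (l ++ (m.map X.bar).reverse) (fun d hd j => ?_) (h1.append h2.reverse)
    rcases List.mem_append.1 hd with hd | hd
    · exact hl d hd j
    · obtain ⟨e, he, rfl⟩ := List.mem_map.1 (List.mem_reverse.1 hd)
      rw [← hb, hm e he j]
  -- By `hjoin` no vertex can be reached from both ends of p while avoiding the four edges. As t
  -- exchanges the ends, it exchanges the two halves.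
  have hnofix : ∀ x, a.vert F.t x ≠ x := by
    intro x hx
    obtain ⟨l, hl, hw⟩ := hreach x
    have htl : ∀ d ∈ l.map (a.dart F.t), ∀ j, a.dart (F.n j) d = d := by
      intro d hd
      obtain ⟨e, he, rfl⟩ := List.mem_map.1 hd
      exact F.n_t_eq_self a.dart (hl e he)
    rcases hw with hw | hw
    · have := a.isWalk_map F.t hw
      rw [htι, hx] at this
      exact hjoin _ _ hl htl x hw this
    · have := a.isWalk_map F.t hw
      rw [htτ, hx] at this
      exact hjoin _ _ htl hl x this hw
  -- Without fixed vertices there are no fixed edges, so the Lefschetz count for t forbids inverted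
  -- edges; but t inverts p.
  have hcount := h.fix_t
  have k1 : {d | a.dart F.t d = d} = ∅ := Set.eq_empty_iff_forall_notMem.2 fun d hd =>
    hnofix _ (c_fixed_ι a F.t hd)
  have k2 : 0 < {d | a.dart F.t d = X.bar d}.ncard := (Set.ncard_pos).2 ⟨p, htp'⟩
  rw [k1, Set.ncard_empty] at hcount
  omega

/-- The edges moved by the half-turns `n i` are three loops at a common vertex. -/
theorem exists_loop (h : a.IsCubical F) : ∃ e : X.Dart, X.τ e = X.ι e ∧ a.dart F.c e ≠ e ∧
    a.vert F.c (X.ι e) = X.ι e ∧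
    ∀ d, (∃ i, a.dart (F.n i) d ≠ d) ↔
      (d = e ∨ d = a.dart F.c e ∨ d = a.dart F.c (a.dart F.c e)) ∨
      X.bar d = e ∨ X.bar d = a.dart F.c e ∨ X.bar d = a.dart F.c (a.dart F.c e) := by
  obtain ⟨hM, h6⟩ | ⟨h1, h2, h3⟩ := h.count
  swap
  · exact (h.not_three_moved h1 h2 h3).elim
  have hall : ∀ x, a.vert F.c x = x := fun x => by
    by_contra hx
    have : x ∈ {x | a.vert F.c x ≠ x} := hx
    rw [hM] at this
    exact this
  have hfix {d : X.Dart} (hd : a.dart F.c d = d) (i : Fin 3) : a.dart (F.n i) d = d :=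
    h.n_eq_self_of_c_eq_self hall h6 hd i
  obtain ⟨i, e, hie⟩ := h.moved
  have he : a.dart F.c e ≠ e := fun he => hie (hfix he i)
  have hcm : ∀ d, (∃ j, a.dart (F.n j) d ≠ d) → ∃ j, a.dart (F.n j) (a.dart F.c d) ≠ a.dart F.c d := by
    rintro d ⟨j, hj⟩
    exact ⟨j + 1, by rw [← F.c_n]; simpa using hj⟩
  refine ⟨e, ?_, he, hall _, fun d => ⟨?_, ?_⟩⟩
  -- The half-turns preserve origins. If e is not a loop, the reversals of its translates start
  -- elsewhere, so the half-turns permute the three translates themselves and must act trivially on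
  -- them.
  · by_contra hloop
    refine hie (F.n_eq_self_of_mem_orbit a.dart he (fun j => ?_) i)
    have hj : a.dart F.c (a.dart (F.n j) e) ≠ a.dart (F.n j) e := by
      intro h'
      have h1 := hfix h' j
      rw [F.n_n] at h1
      rw [← h1] at h'
      exact he h'
    have hι : X.ι (a.dart (F.n j) e) = X.ι e := by rw [a.ι_dart, n_vert hall]
    have hτc : X.τ (a.dart F.c e) = X.τ e := by rw [a.τ_dart, hall]
    have hτcc : X.τ (a.dart F.c (a.dart F.c e)) = X.τ e := by rw [a.τ_dart, hall, hτc]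
    rcases eq_of_c_ne h6 he hj with h' | h' | h' | h'
    · exact h'
    · exact absurd ((congrArg X.τ h').symm.trans (by rw [X.τ_bar, hι])) hloop
    · exact absurd (by rw [← hτc, ← h', X.τ_bar, hι]) hloop
    · exact absurd (by rw [← hτcc, ← h', X.τ_bar, hι]) hloop
  · rintro ⟨j, hj⟩
    exact eq_of_c_ne h6 he fun h' => hj (hfix h' j)
  · have h0 : ∃ j, a.dart (F.n j) e ≠ e := ⟨i, hie⟩
    have key : ∀ d, (d = e ∨ d = a.dart F.c e ∨ d = a.dart F.c (a.dart F.c e)) →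
        ∃ j, a.dart (F.n j) d ≠ d := by
      rintro d (rfl | rfl | rfl)
      exacts [h0, hcm _ h0, hcm _ (hcm _ h0)]
    rintro (hd | hd)
    · exact key d hd
    · obtain ⟨j, hj⟩ := key _ hd
      exact ⟨j, fun h' => hj (by rw [← a.bar_dart, h'])⟩

end GraphAction.IsCubical

/-! ### The invariant rose and its homology -/

namespace CWGraph.Subgraph

variable {X : CWGraph.{u, v}} (Y : X.Subgraph)

/-- The map induced by the inclusion on homology. -/
noncomputable def inclH₁ : Y.toGraph.H₁ →ₗ[ℂ] X.H₁ :=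
  Y.incl.restrict fun _ hz => Y.incl_mem_H₁.2 hz

theorem inclH₁_injective : Function.Injective Y.inclH₁ := fun _ _ h =>
  Subtype.ext (Y.incl_injective (congrArg Subtype.val h))

theorem mem_range_inclH₁ (z : X.H₁) (hz : ∀ d ∉ Y.darts, z.1 d = 0) :
    z ∈ LinearMap.range Y.inclH₁ := by
  have h : Y.incl (Finsupp.comapDomain Y.dartVal z.1 Y.dartVal_injective.injOn) = z.1 := by
    refine Finsupp.mapDomain_comapDomain _ Y.dartVal_injective z.1 fun d hd => ?_
    by_contra hd'
    exact Finsupp.mem_support_iff.1 hd (hz d fun hd'' => hd' ⟨⟨d, hd''⟩, rfl⟩)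
  exact ⟨⟨_, Y.incl_mem_H₁.1 ((congrArg (· ∈ X.H₁) h).mpr z.2)⟩, Subtype.ext h⟩

end CWGraph.Subgraph

namespace GraphAction

variable {K : Type*} [Group K] {X : CWGraph.{u, v}} {a : GraphAction K X}

theorem inclH₁_homologyRep {Y : X.Subgraph} (hY : a.Invariant Y) (g : K) (z : Y.toGraph.H₁) :
    Y.inclH₁ ((a.restrict Y hY).homologyRep g z) = a.homologyRep g (Y.inclH₁ z) := by
  refine Subtype.ext ?_
  change Finsupp.mapDomain Y.dartVal (Finsupp.mapDomain ((a.restrict Y hY).dart g) z.1) =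
    Finsupp.mapDomain (a.dart g) (Finsupp.mapDomain Y.dartVal z.1)
  rw [← Finsupp.mapDomain_comp, ← Finsupp.mapDomain_comp]
  rfl

/-- A submodule of the homology consisting of cycles in an invariant subgraph is contained in the
homology of that subgraph. -/
theorem containsRep_restrict {Y : X.Subgraph} (hY : a.Invariant Y) {H N : Type*} [Group H]
    [AddCommGroup N] [Module ℂ N] {σ : Representation ℂ H N} (s : H →* K)
    (f : Representation.IntertwiningMap σ (a.homologyRep.comp s)) (hf : Function.Injective f)
    (hsupp : ∀ x, ∀ d ∉ Y.darts, (f x).1 d = 0) :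
    ContainsRep (M := Y.toGraph.H₁) ((a.restrict Y hY).homologyRep.comp s) σ := by
  let j := LinearEquiv.ofInjective Y.inclH₁ Y.inclH₁_injective
  let g : N →ₗ[ℂ] Y.toGraph.H₁ := j.symm.toLinearMap ∘ₗ
    LinearMap.codRestrict (LinearMap.range Y.inclH₁) f.toLinearMap
      fun x => Y.mem_range_inclH₁ _ (hsupp x)
  have hg (x : N) : Y.inclH₁ (g x) = f x := congrArg Subtype.val (j.apply_symm_apply _)
  refine ⟨⟨g, fun k => LinearMap.ext fun x => Y.inclH₁_injective ?_⟩, fun x y hxy => hf ?_⟩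
  · change Y.inclH₁ (g (σ k x)) = Y.inclH₁ ((a.restrict Y hY).homologyRep (s k) (g x))
    rw [inclH₁_homologyRep, hg, hg, f.isIntertwining]
    rfl
  · rw [← hg, ← hg]
    exact congrArg Y.inclH₁ hxy

namespace IsCubical

variable {F : CubeFrame K}

/-- The edges moved by some half-turn form the rose. It is invariant under the whole group because
conjugation permutes the half-turns, and `hN` forces the cycles in the image of f to be supported on
it. -/
theorem hasStandardRose (h : a.IsCubical F) (s : Equiv.Perm (Fin 3) →* K)
    (f : Representation.IntertwiningMap (SymRep.std 3) (a.homologyRep.comp s))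
    (hf : Function.Injective f)
    (hN : ∀ x, f x + ∑ i, a.homologyRep (F.n i) (f x) = 0) : HasStandardRose a s := by
  obtain ⟨e, hloop, hce, hcv, hmem⟩ := h.exists_loop
  have h3 := F.c_c_c a.dart e
  have hc2 := F.c_c_ne a.dart hce
  have hbn := X.bar_ne e
  obtain ⟨hb1, hb2⟩ := bar_ne_c a F e
  have hτc : ∀ d, X.τ d = X.ι e → X.τ (a.dart F.c d) = X.ι e := fun d hd => by
    rw [a.τ_dart, hd, hcv]
  have hιc : ∀ d, X.ι d = X.ι e → X.ι (a.dart F.c d) = X.ι e := fun d hd => by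
    rw [a.ι_dart, hd, hcv]
  have hι : ∀ d, (∃ i, a.dart (F.n i) d ≠ d) → X.ι d = X.ι e := by
    intro d hd
    rcases (hmem d).1 hd with (rfl | rfl | rfl) | hd | hd | hd
    · rfl
    · exact hιc _ rfl
    · exact hιc _ (hιc _ rfl)
    all_goals rw [← X.τ_bar, hd]
    · exact hloop
    · exact hτc _ hloop
    · exact hτc _ (hτc _ hloop)
  let Y : X.Subgraph :=
    { verts := {X.ι e}
      darts := {d | ∃ i, a.dart (F.n i) d ≠ d}
      ι_mem := hι
      bar_mem := by
        rintro d ⟨i, hi⟩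
        refine ⟨i, fun h' => hi ?_⟩
        rw [← a.bar_dart] at h'
        exact X.bar_injective h' }
  have hYd : ∀ g, ∀ d ∈ Y.darts, a.dart g d ∈ Y.darts := by
    rintro g d ⟨i, hi⟩
    obtain ⟨j, hj⟩ := F.normal g i
    refine ⟨j, fun h' => hi ((a.dart g).injective ?_)⟩
    rwa [← Equiv.Perm.mul_apply, ← map_mul, ← hj, map_mul, Equiv.Perm.mul_apply] at h'
  have heY : e ∈ Y.darts := (hmem e).2 (Or.inl (Or.inl rfl))
  have hY : a.Invariant Y := by
    refine ⟨?_, hYd⟩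
    rintro g _ rfl
    rw [← a.ι_dart]
    exact hι _ (hYd g e heY)
  refine ⟨Y, hY, ?_, containsRep_restrict hY s f hf fun x d hd => ?_⟩
  · let E : Fin 3 → X.Dart := ![e, a.dart F.c e, a.dart F.c (a.dart F.c e)]
    have hE : Function.Injective E := by
      have hc3 : a.dart F.c (a.dart F.c e) ≠ a.dart F.c e := fun h' => hce ((a.dart F.c).injective h')
      intro k l hkl
      fin_cases k <;> fin_cases l <;> first
        | rfl
        | exact absurd hkl hce
        | exact absurd hkl.symm hce
        | exact absurd hkl hc2
        | exact absurd hkl.symm hc2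
        | exact absurd hkl hc3
        | exact absurd hkl.symm hc3
    have hEb : ∀ k l, X.bar (E k) ≠ E l := by
      intro k l hkl
      have e1 := bar_ne_c a F (a.dart F.c e)
      have e2 := bar_ne_c a F (a.dart F.c (a.dart F.c e))
      have e3 := X.bar_ne (a.dart F.c e)
      have e4 := X.bar_ne (a.dart F.c (a.dart F.c e))
      rw [h3] at e1 e2
      fin_cases k <;> fin_cases l <;> first
        | exact hbn hkl
        | exact hb1 hkl
        | exact hb2 hkl
        | exact e1.1 hkl
        | exact e1.2 hkl
        | exact e2.1 hkl
        | exact e2.2 hkl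
        | exact e3 hkl
        | exact e4 hkl
    have hEmem : ∀ k, E k ∈ Y.darts := fun k => (hmem _).2 (Or.inl (by
      fin_cases k
      exacts [Or.inl rfl, Or.inr (Or.inl rfl), Or.inr (Or.inr rfl)]))
    let f : Fin 3 × Bool → Y.toGraph.Dart := fun x =>
      ⟨if x.2 then E x.1 else X.bar (E x.1), by
        split_ifs
        · exact hEmem _
        · exact Y.bar_mem _ (hEmem _)⟩
    have hinj : Function.Injective f := by
      rintro ⟨k, b⟩ ⟨l, b'⟩ hkl
      have hkl' : (if b then E k else X.bar (E k)) = if b' then E l else X.bar (E l) :=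
        congrArg Subtype.val hkl
      cases b <;> cases b' <;> simp only [Bool.false_eq_true, if_true, if_false] at hkl'
      · rw [hE (X.bar_injective hkl')]
      · exact absurd hkl' (hEb k l)
      · exact absurd hkl'.symm (hEb l k)
      · rw [hE hkl']
    have hsurj : Function.Surjective f := by
      rintro ⟨d, hd⟩
      have hE' : ∀ d, (d = e ∨ d = a.dart F.c e ∨ d = a.dart F.c (a.dart F.c e)) → ∃ k, E k = d := by
        rintro d (rfl | rfl | rfl)
        exacts [⟨0, rfl⟩, ⟨1, rfl⟩, ⟨2, rfl⟩]
      rcases (hmem d).1 hd with hd' | hd' <;> obtain ⟨k, hk⟩ := hE' _ hd'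
      · exact ⟨(k, true), Subtype.ext hk⟩
      · exact ⟨(k, false), Subtype.ext ((congrArg X.bar hk).trans (X.bar_bar d))⟩
    let φ := Equiv.ofBijective f ⟨hinj, hsurj⟩
    have hfbar : ∀ x, Y.toGraph.bar (f x) = f (x.1, !x.2) := by
      rintro ⟨k, b⟩
      refine Subtype.ext ?_
      cases b
      · exact X.bar_bar _
      · rfl
    refine ⟨⟨⟨fun _ => (), fun _ => ⟨X.ι e, rfl⟩, fun x => Subtype.ext x.2.symm, fun _ => rfl⟩,
      φ.symm, fun _ => rfl, fun d => ?_⟩⟩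
    obtain ⟨x, rfl⟩ := φ.surjective d
    change ((φ.symm (φ x)).1, !(φ.symm (φ x)).2) = φ.symm (Y.toGraph.bar (φ x))
    rw [Equiv.symm_apply_apply]
    refine φ.injective ?_
    rw [Equiv.apply_symm_apply]
    exact (hfbar x).symm
  -- At an edge fixed by all half-turns the relation `hN` says that four times the coefficient is
  -- zero.
  · have hfix : ∀ i, a.dart (F.n i) d = d := fun i => by
      by_contra h'
      exact hd ⟨i, h'⟩
    have h1 : ∀ i, (a.homologyRep (F.n i) (f x)).1 d = (f x).1 d := fun i => by
      rw [coe_homologyRep]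
      conv_lhs => rw [← hfix i]
      exact a.chainRep_apply _ _ _
    have h2 := DFunLike.congr_fun (congrArg Subtype.val (hN x)) d
    simp only [Fin.sum_univ_three, Submodule.coe_add, Finsupp.add_apply, h1,
      Submodule.coe_zero, Finsupp.zero_apply] at h2
    linear_combination h2 / 4

end IsCubical

end GraphAction

/-! ### From traces to fixed point counts -/

namespace GraphAction

variable {K : Type*} [Group K] {X : CWGraph.{u, v}} {a : GraphAction K X}

/-- Valence 2 is excluded by admissibility, valence 0 by connectedness and the existence of an edge,
and valence 1 because the only edge at a vertex cannot lie on a cycle. -/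
theorem Admissible.three_le_valence (ha : a.Admissible) [Finite X.Dart] [Nonempty X.Dart]
    (x : X.Vert) : 3 ≤ {d | X.ι d = x}.ncard := by
  classical
  have := Fintype.ofFinite X.Dart
  have h2 : {d | X.ι d = x}.ncard ≠ 2 := fun h => ha.2.1 x (by
    rw [CWGraph.valence, ← (Set.toFinite _).cast_ncard_eq, h]
    rfl)
  have h0 : {d | X.ι d = x}.ncard ≠ 0 := fun h => by
    rw [Set.ncard_eq_zero] at h
    have hall := ha.1.mem_of_closed (S := {x}) (fun d hd => by
      have : d ∈ {d | X.ι d = x} := hd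
      simp [h] at this) rfl
    obtain ⟨d⟩ := ‹Nonempty X.Dart›
    have : d ∈ {d | X.ι d = x} := hall _
    simp [h] at this
  have h1 : {d | X.ι d = x}.ncard ≠ 1 := fun h => by
    obtain ⟨d, hd⟩ := Set.ncard_eq_one.1 h
    obtain ⟨z, hz, hzd⟩ := ha.exists_cycle d
    have hsum := CWGraph.sum_eq_zero_of_mem_H₁ hz x
    have hfil : (Finset.univ.filter fun e => X.ι e = x) = {d} := by
      ext e
      simpa using Set.ext_iff.1 hd e
    rw [hfil, Finset.sum_singleton] at hsum
    exact hzd hsum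
  omega

/-- The counts for c and t are the Lefschetz formula with traces 2 and 1, where c inverts no edge.
If the half-turns fixed all edges, they would act trivially on homology. -/
theorem Admissible.isCubical (ha : a.Admissible) (hX : X.HasRank 5) (F : CubeFrame K)
    (hc : LinearMap.trace ℂ X.H₁ (a.homologyRep F.c) = 2)
    (ht : LinearMap.trace ℂ X.H₁ (a.homologyRep F.t) = 1)
    (hmoved : ∃ i z, a.homologyRep (F.n i) z ≠ z)
    (hinv : ∀ z, (∀ i, a.homologyRep (F.n i) z = z) → a.homologyRep F.t z = z)
    (haxis : ∀ z, a.homologyRep (F.n 2) z = z → a.homologyRep (F.n 0) z = -z →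
      a.homologyRep F.t z = -z) : a.IsCubical F := by
  classical
  have hD := ha.finite_dart hX.finrank_H₁_le.1
  have hV := ha.1.finite_vert
  have := Fintype.ofFinite X.Vert
  have := Fintype.ofFinite X.Dart
  obtain ⟨heuler, -⟩ := a.euler_of_hasRank hX
  have hpos : 0 < Fintype.card X.Vert := Fintype.card_pos_iff.2 ha.1.1
  have hne : Nonempty X.Dart := Fintype.card_pos_iff.1 (by omega)
  have hLc := a.two_mul_trace_homologyRep ha.1 F.c
  have hLt := a.two_mul_trace_homologyRep ha.1 F.t
  have hI : (Finset.univ.filter fun d => a.dart F.c d = X.bar d) = ∅ := by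
    rw [Finset.filter_eq_empty_iff]
    exact fun d _ hd => (IsCubical.bar_ne_c a F d).1 hd.symm
  rw [hc, hI, Finset.card_empty] at hLc
  rw [ht] at hLt
  refine ⟨ha.1, hV, hD, ha.exists_cycle, ha.three_le_valence, ?_, ?_, ?_, ?_, ?_, ?_⟩
  · rw [Nat.card_eq_fintype_card, Nat.card_eq_fintype_card]
    omega
  · simp only [Set.ncard_eq_toFinset_card', Set.toFinset_ofPred]
    have : ((Finset.univ.filter fun d => a.dart F.c d = d).card : ℂ) =
        2 * (Finset.univ.filter fun x => a.vert F.c x = x).card + 2 := by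
      push_cast at hLc
      linear_combination -hLc
    exact_mod_cast this
  · simp only [Set.ncard_eq_toFinset_card', Set.toFinset_ofPred]
    have : ((Finset.univ.filter fun d => a.dart F.t d = d).card : ℂ) =
        (Finset.univ.filter fun d => a.dart F.t d = X.bar d).card +
        2 * (Finset.univ.filter fun x => a.vert F.t x = x).card := by
      linear_combination -hLt
    exact_mod_cast this
  · obtain ⟨i, z, hz⟩ := hmoved
    by_contra! hcon
    refine hz (Subtype.ext (Finsupp.ext fun d => ?_))
    rw [coe_homologyRep]
    conv_lhs => rw [← hcon i d]
    exact a.chainRep_apply _ _ _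
  · intro z hz h
    exact congrArg Subtype.val (hinv ⟨z, hz⟩ fun i => Subtype.ext (h i))
  · intro z hz h h'
    exact congrArg Subtype.val (haxis ⟨z, hz⟩ (Subtype.ext h) (Subtype.ext h'))

end GraphAction

/-! ### Representations of symmetric groups -/

section Sums

variable {H M N : Type*} [Group H] [AddCommGroup M] [Module ℂ M] [AddCommGroup N] [Module ℂ N]

theorem trace_copies [FiniteDimensional ℂ N] (k : ℕ) (σ : Representation ℂ H N) (g : H) :
    LinearMap.trace ℂ (Fin k → N) (copies k σ g) = k * LinearMap.trace ℂ N (σ g) := by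
  have h1 : copies k σ g =
      ∑ i, (LinearMap.single ℂ (fun _ : Fin k => N) i ∘ₗ σ g) ∘ₗ LinearMap.proj i := by
    ext i x j
    simp [copies, Pi.single_apply, apply_ite (σ g)]
  rw [h1, map_sum]
  have h2 (i : Fin k) : LinearMap.trace ℂ (Fin k → N)
      ((LinearMap.single ℂ (fun _ : Fin k => N) i ∘ₗ σ g) ∘ₗ LinearMap.proj i) =
      LinearMap.trace ℂ N (σ g) := by
    rw [LinearMap.trace_comp_comm' (LinearMap.proj i)
      (LinearMap.single ℂ (fun _ : Fin k => N) i ∘ₗ σ g), ← LinearMap.comp_assoc,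
      LinearMap.proj_comp_single_same, LinearMap.id_comp]
  simp [h2]

variable {ρ : Representation ℂ H M} {V : Submodule ℂ M} {σ : Representation ℂ H N}

/-- The multiplicity, the dimension and the character of a multiple of a representation. -/
theorem IsSumOf.exists_trace [FiniteDimensional ℂ N] (h : IsSumOf ρ V σ) : ∃ k : ℕ,
    Module.finrank ℂ V = k * Module.finrank ℂ N ∧ (k = 0 → V = ⊥) ∧
    ∀ g, ∃ hV : ∀ v ∈ V, ρ g v ∈ V,
      LinearMap.trace ℂ V ((ρ g).restrict hV) = k * LinearMap.trace ℂ N (σ g) := by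
  obtain ⟨k, f, hf, rfl⟩ := h
  let e : (Fin k → N) ≃ₗ[ℂ] LinearMap.range f.toLinearMap := LinearEquiv.ofInjective f.toLinearMap hf
  refine ⟨k, ?_, ?_, fun g => ⟨?_, ?_⟩⟩
  · rw [← e.finrank_eq, Module.finrank_pi_fintype]
    simp
  · rintro rfl
    exact LinearMap.range_eq_bot.2 (LinearMap.ext fun x => by
      rw [Subsingleton.elim x 0, map_zero, map_zero])
  · rintro _ ⟨x, rfl⟩
    exact ⟨copies k σ g x, Representation.IntertwiningMap.isIntertwining _ _ f g x⟩
  · rw [← trace_copies, ← LinearMap.trace_conj' (copies k σ g) e]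
    congr 1
    ext1 v
    obtain ⟨x, rfl⟩ := e.surjective v
    refine Subtype.ext ?_
    rw [LinearEquiv.conj_apply_apply, e.symm_apply_apply]
    exact (Representation.IntertwiningMap.isIntertwining _ _ f g x).symm

/-- A statement about elements of a multiple of `σ` can be checked on `σ`. -/
theorem IsSumOf.exists_rep (h : IsSumOf ρ V σ) {v : M} (hv : v ∈ V) :
    ∃ (k : ℕ) (f : (Fin k → N) →ₗ[ℂ] M) (x : Fin k → N), Function.Injective f ∧ f x = v ∧
      ∀ g y, ρ g (f y) = f fun j => σ g (y j) := by
  obtain ⟨k, f, hf, rfl⟩ := h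
  obtain ⟨x, rfl⟩ := hv
  exact ⟨k, f.toLinearMap, x, hf, rfl,
    fun g y => (Representation.IntertwiningMap.isIntertwining _ _ f g y).symm⟩

/-- A non-zero multiple of `σ` contains `σ`. -/
theorem IsSumOf.exists_intertwining (h : IsSumOf ρ V σ) (hV : V ≠ ⊥) :
    ∃ f : Representation.IntertwiningMap σ ρ, Function.Injective f ∧ ∀ x, f x ∈ V := by
  obtain ⟨k, f, hf, rfl⟩ := h
  have hk : k ≠ 0 := by
    rintro rfl
    exact hV (LinearMap.range_eq_bot.2 (LinearMap.ext fun x => by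
      rw [Subsingleton.elim x 0, map_zero, map_zero]))
  obtain ⟨k, rfl⟩ := Nat.exists_eq_succ_of_ne_zero hk
  refine ⟨⟨f.toLinearMap ∘ₗ LinearMap.single ℂ (fun _ : Fin (k + 1) => N) 0, fun g => ?_⟩, ?_, ?_⟩
  · ext1 x
    change f (Pi.single 0 (σ g x)) = ρ g (f (Pi.single 0 x))
    rw [← Representation.IntertwiningMap.isIntertwining]
    congr 1
    ext j
    rcases eq_or_ne j 0 with rfl | hj
    · simp [copies]
    · simp [copies, hj]
  · exact hf.comp (Pi.single_injective (M := fun _ : Fin (k + 1) => N) 0)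
  · exact fun x => ⟨_, rfl⟩

end Sums

namespace SymRep

variable {n : ℕ} {N : Type*} [AddCommGroup N] [Module ℂ N]

theorem trace_signTwist (σ : Representation ℂ (Equiv.Perm (Fin n)) N) (p : Equiv.Perm (Fin n)) :
    LinearMap.trace ℂ N (signTwist σ p) = (Equiv.Perm.sign p : ℤ) * LinearMap.trace ℂ N (σ p) := by
  change LinearMap.trace ℂ N (((Equiv.Perm.sign p : ℤ) : ℂ) • σ p) = _
  rw [map_smul, smul_eq_mul]

theorem signTwist_apply (σ : Representation ℂ (Equiv.Perm (Fin n)) N) (p : Equiv.Perm (Fin n))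
    (x : N) : signTwist σ p x = ((Equiv.Perm.sign p : ℤ) : ℂ) • σ p x := rfl

theorem triv_apply (p : Equiv.Perm (Fin n)) (x : ℂ) : triv n p x = x := rfl

theorem perm_apply (p : Equiv.Perm (Fin n)) (x : Fin n → ℂ) (i : Fin n) :
    perm n p x i = x (p⁻¹ i) := rfl

theorem std_apply (p : Equiv.Perm (Fin n)) (x : sumZero n) (i : Fin n) :
    (std n p x).1 i = x.1 (p⁻¹ i) := rfl

theorem trace_triv (p : Equiv.Perm (Fin n)) : LinearMap.trace ℂ ℂ (triv n p) = 1 := by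
  change LinearMap.trace ℂ ℂ LinearMap.id = 1
  simp

theorem trace_perm (p : Equiv.Perm (Fin n)) : LinearMap.trace ℂ (Fin n → ℂ) (perm n p) =
    (Finset.univ.filter fun i => p⁻¹ i = i).card := by
  rw [LinearMap.trace_eq_matrix_trace ℂ (Pi.basisFun ℂ (Fin n)), Matrix.trace]
  simp [perm_apply, Pi.single_apply]

/-- The sum of the coordinates. -/
def sumForm (n : ℕ) : (Fin n → ℂ) →ₗ[ℂ] ℂ := ∑ i, LinearMap.proj i

theorem sumForm_apply (x : Fin n → ℂ) : sumForm n x = ∑ i, x i := by simp [sumForm]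

theorem mem_sumZero (x : Fin n → ℂ) : x ∈ sumZero n ↔ ∑ i, x i = 0 := Iff.rfl

theorem range_sumZero : LinearMap.range (sumZero n).subtype = LinearMap.ker (sumForm n) := by
  ext x
  rw [Submodule.range_subtype, LinearMap.mem_ker, sumForm_apply, mem_sumZero]

theorem sumForm_surjective [NeZero n] : Function.Surjective (sumForm n) := fun r =>
  ⟨Pi.single 0 r, by simp [sumForm_apply]⟩

theorem trace_std [NeZero n] (p : Equiv.Perm (Fin n)) :
    LinearMap.trace ℂ (sumZero n) (std n p) =
      (Finset.univ.filter fun i => p⁻¹ i = i).card - 1 := by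
  have h := LinearMap.trace_eq_add_of_exact (sumZero n).subtype (sumForm n)
    (sumZero n).injective_subtype sumForm_surjective range_sumZero (gK := std n p) (g := perm n p)
    (gQ := LinearMap.id) rfl (LinearMap.ext fun x => by
      change sumForm n (perm n p x) = sumForm n x
      rw [sumForm_apply, sumForm_apply]
      exact Equiv.sum_comp p⁻¹ x)
  rw [trace_perm, LinearMap.trace_id, Module.finrank_self, Nat.cast_one] at h
  rw [h]
  ring

theorem finrank_sumZero [NeZero n] : Module.finrank ℂ (sumZero n) + 1 = n := by
  have h := LinearMap.finrank_range_add_finrank_ker (sumForm n)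
  rw [LinearMap.range_eq_top.2 sumForm_surjective, finrank_top, Module.finrank_self,
    Module.finrank_fin_fun, ← range_sumZero, Submodule.range_subtype] at h
  omega

/-- Rotation by a right angle in the plane of the standard representation of `S₃`. -/
def rot : sumZero 3 →ₗ[ℂ] sumZero 3 where
  toFun x := ⟨fun i => x.1 (i + 1) - x.1 (i + 2), by
    rw [mem_sumZero, Fin.sum_univ_three]
    change x.1 1 - x.1 2 + (x.1 2 - x.1 0) + (x.1 0 - x.1 1) = 0
    ring⟩
  map_add' x y := by
    ext i
    simp only [Submodule.coe_add, Pi.add_apply]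
    ring
  map_smul' r x := by
    ext i
    simp only [Submodule.coe_smul, Pi.smul_apply, smul_eq_mul, RingHom.id_apply]
    ring

theorem rot_injective : Function.Injective rot := by
  rw [← LinearMap.ker_eq_bot, LinearMap.ker_eq_bot']
  intro x hx
  have h (i : Fin 3) : x.1 (i + 1) - x.1 (i + 2) = 0 := congrFun (congrArg Subtype.val hx) i
  have h0 : x.1 1 - x.1 2 = 0 := h 0
  have h1 : x.1 2 - x.1 0 = 0 := h 1
  have hs := (mem_sumZero x.1).1 x.2
  rw [Fin.sum_univ_three] at hs
  have e0 : x.1 0 = 0 := by linear_combination (hs - 2 * h1 - h0) / 3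
  have e2 : x.1 2 = 0 := by linear_combination h1 + e0
  have e1 : x.1 1 = 0 := by linear_combination h0 + e2
  ext i
  fin_cases i
  exacts [e0, e1, e2]

/-- Every permutation of ℤ/3 is affine, and its linear part ±1 is its sign. -/
theorem perm_three_cases : ∀ (q : Equiv.Perm (Fin 3)) (i : Fin 3),
    (Equiv.Perm.sign q = 1 ∧ q (i + 1) = q i + 1 ∧ q (i + 2) = q i + 2) ∨
    (Equiv.Perm.sign q = -1 ∧ q (i + 1) = q i + 2 ∧ q (i + 2) = q i + 1) := by
  decide

/-- Odd permutations reverse the cyclic order and so change the sign of the differences of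
neighbouring coordinates. Thus `rot` identifies the standard representation of S₃ with its sign
twist. -/
theorem rot_std (p : Equiv.Perm (Fin 3)) (x : sumZero 3) :
    rot (std 3 p x) = ((Equiv.Perm.sign p : ℤ) : ℂ) • std 3 p (rot x) := by
  ext i
  change x.1 (p⁻¹ (i + 1)) - x.1 (p⁻¹ (i + 2)) =
    ((Equiv.Perm.sign p : ℤ) : ℂ) * (x.1 (p⁻¹ i + 1) - x.1 (p⁻¹ i + 2))
  rw [← Equiv.Perm.sign_inv]
  rcases perm_three_cases p⁻¹ i with ⟨h1, h2, h3⟩ | ⟨h1, h2, h3⟩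
  · rw [h1, h2, h3]
    simp
  · rw [h1, h2, h3]
    simp

end SymRep

/-! ### The rotations of the cube acting on V -/

/-- A representation of a group with a cube frame, decomposed into multiples of the trivial
representation, a three-dimensional representation `σ`, its signed version and the determinant
representation of a symmetric group. -/
structure CubeFrame.Decomposes {K M N : Type*} [Group K] [AddCommGroup M] [Module ℂ M]
    [AddCommGroup N] [Module ℂ N] (F : CubeFrame K) (ρ : Representation ℂ K M) {m : ℕ}
    (s : Equiv.Perm (Fin m) →* K) (σ : Representation ℂ (Equiv.Perm (Fin m)) N)
    (V : Fin 4 → Submodule ℂ M) (D : K) (pc pt : Equiv.Perm (Fin m)) : Prop where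
  c_eq : F.c = s pc
  t_eq : F.t = D * s pt
  sign_pc : Equiv.Perm.sign pc = 1
  sign_pt : Equiv.Perm.sign pt = -1
  finrank_eq : Module.finrank ℂ N = 3
  trace_pc : LinearMap.trace ℂ N (σ pc) = 0
  trace_pt : LinearMap.trace ℂ N (σ pt) = 1
  apply_pt : ∀ x, σ pc x = x → σ pt x = x
  internal : DirectSum.IsInternal V
  nontrivial : V 1 ⊔ V 2 ≠ ⊥
  even : ∀ x ∈ V 0 ⊔ V 2, ρ D x = x
  odd : ∀ x ∈ V 1 ⊔ V 3, ρ D x = -x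
  zero : IsSumOf (ρ.comp s) (V 0) (SymRep.triv m)
  one : IsSumOf (ρ.comp s) (V 1) σ
  two : IsSumOf (ρ.comp s) (V 2) (SymRep.signTwist σ)
  three : IsSumOf (ρ.comp s) (V 3) (SymRep.det m)
  sum_n : ∀ x ∈ V 1 ⊔ V 2, x + ∑ i, ρ (F.n i) x = 0
  n_apply : ∀ x ∈ V 0 ⊔ V 3, ∀ i, ρ (F.n i) x = x

theorem IsSumOf.apply_mem {H M N : Type*} [Group H] [AddCommGroup M] [Module ℂ M]
    [AddCommGroup N] [Module ℂ N] {ρ : Representation ℂ H M} {V : Submodule ℂ M}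
    {σ : Representation ℂ H N} (h : IsSumOf ρ V σ) (g : H) {v : M} (hv : v ∈ V) :
    ρ g v ∈ V := by
  obtain ⟨k, f, hf, rfl⟩ := h
  obtain ⟨x, rfl⟩ := hv
  exact ⟨copies k σ g x, Representation.IntertwiningMap.isIntertwining _ _ f g x⟩

namespace CubeFrame.Decomposes

variable {K M N : Type*} [Group K] [AddCommGroup M] [Module ℂ M]
  [AddCommGroup N] [Module ℂ N] {F : CubeFrame K} {ρ : Representation ℂ K M} {m : ℕ}
  {s : Equiv.Perm (Fin m) →* K} {σ : Representation ℂ (Equiv.Perm (Fin m)) N}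
  {V : Fin 4 → Submodule ℂ M} {D : K} {pc pt : Equiv.Perm (Fin m)}

/-- The scalars e allow for the action of Δ, so that the identity, c and t are all covered by the
same multiplicities. -/
theorem exists_multiplicities [FiniteDimensional ℂ M] [FiniteDimensional ℂ N]
    (h : F.Decomposes ρ s σ V D pc pt) :
    ∃ k₀ k₁ k₂ k₃ : ℕ, 0 < k₁ + k₂ ∧ ∀ (T : Module.End ℂ M) (p : Equiv.Perm (Fin m)) (e : Fin 4 → ℂ),
      (∀ i, ∀ v ∈ V i, T v = e i • ρ (s p) v) →
      LinearMap.trace ℂ M T = e 0 * k₀ + e 1 * (k₁ * LinearMap.trace ℂ N (σ p)) +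
        e 2 * (k₂ * ((Equiv.Perm.sign p : ℤ) * LinearMap.trace ℂ N (σ p))) +
        e 3 * (k₃ * (Equiv.Perm.sign p : ℤ)) := by
  obtain ⟨k₀, -, -, h₀⟩ := h.zero.exists_trace
  obtain ⟨k₁, -, b₁, h₁⟩ := h.one.exists_trace
  obtain ⟨k₂, -, b₂, h₂⟩ := h.two.exists_trace
  obtain ⟨k₃, -, -, h₃⟩ := h.three.exists_trace
  refine ⟨k₀, k₁, k₂, k₃, ?_, fun T p e hT => ?_⟩
  · by_contra hk
    exact h.nontrivial (by rw [b₁ (by omega), b₂ (by omega), sup_bot_eq])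
  · have hm (i : Fin 4) (v : M) (hv : v ∈ V i) : ρ (s p) v ∈ V i := by
      fin_cases i
      exacts [h.zero.apply_mem p hv, h.one.apply_mem p hv, h.two.apply_mem p hv,
        h.three.apply_mem p hv]
    have hTm (i : Fin 4) : Set.MapsTo T (V i) (V i) := fun v hv => by
      rw [hT i v hv]
      exact (V i).smul_mem _ (hm i v hv)
    have htr (i : Fin 4) : LinearMap.trace ℂ (V i) (T.restrict (hTm i)) =
        e i * LinearMap.trace ℂ (V i) ((ρ (s p)).restrict (hm i)) := by
      rw [← smul_eq_mul, ← map_smul]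
      congr 1
      ext1 v
      exact Subtype.ext (hT i v v.2)
    obtain ⟨_, e₀⟩ := h₀ p
    obtain ⟨_, e₁⟩ := h₁ p
    obtain ⟨_, e₂⟩ := h₂ p
    obtain ⟨_, e₃⟩ := h₃ p
    rw [SymRep.trace_triv, mul_one] at e₀
    rw [SymRep.trace_signTwist] at e₂
    rw [SymRep.det, SymRep.trace_signTwist, SymRep.trace_triv, mul_one] at e₃
    rw [LinearMap.trace_eq_sum_trace_restrict h.internal hTm, Fin.sum_univ_four,
      htr, htr, htr, htr, ← e₀, ← e₁, ← e₂, ← e₃]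
    rfl

theorem traces [FiniteDimensional ℂ M] [FiniteDimensional ℂ N]
    (h : F.Decomposes ρ s σ V D pc pt) (hM : Module.finrank ℂ M = 5) :
    LinearMap.trace ℂ M (ρ F.c) = 2 ∧ LinearMap.trace ℂ M (ρ F.t) = 1 := by
  obtain ⟨k₀, k₁, k₂, k₃, hk, H⟩ := h.exists_multiplicities
  have h₁ := H 1 1 1 fun i v _ => by simp
  have hid : LinearMap.trace ℂ M 1 = 5 := by
    rw [Module.End.one_eq_id, LinearMap.trace_id, hM]
    norm_num
  have hid' : LinearMap.trace ℂ N 1 = 3 := by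
    rw [Module.End.one_eq_id, LinearMap.trace_id, h.finrank_eq]
    norm_num
  rw [hid, map_one, hid'] at h₁
  simp only [Pi.one_apply, one_mul, Equiv.Perm.sign_one, Units.val_one, Int.cast_one,
    mul_one] at h₁
  -- The trace of the identity is the dimension. Since k₁ + k₂ is positive, it has to be 1.
  have h₁' : 5 = k₀ + k₁ * 3 + k₂ * 3 + k₃ := by exact_mod_cast h₁
  have hk₁₂ : k₁ + k₂ = 1 := by omega
  have hk₀₃ : k₀ + k₃ = 2 := by omega
  have hk₁₂' : (k₁ : ℂ) + k₂ = 1 := by exact_mod_cast hk₁₂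
  have hk₀₃' : (k₀ : ℂ) + k₃ = 2 := by exact_mod_cast hk₀₃
  constructor
  · rw [H (ρ F.c) pc 1 fun i v _ => by rw [h.c_eq, Pi.one_apply, one_smul], h.trace_pc,
      h.sign_pc]
    simpa using hk₀₃'
  · have hs {i : Fin 4} {ε : ℂ} (v : M) (hv : ρ (s pt) v ∈ V i)
        (hD : ∀ x ∈ V i, ρ D x = ε • x) : ρ F.t v = ε • ρ (s pt) v := by
      rw [h.t_eq, map_mul, Module.End.mul_apply, hD _ hv]
    -- These are the signs by which D acts. With the sign -1 of the transposition on V₂ and V₃, the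
    -- trace becomes k₀ - k₁ - k₂ + k₃ = 2 - 1.
    rw [H (ρ F.t) pt ![1, -1, 1, -1] fun i v hv => by
      fin_cases i
      · exact hs (ε := 1) v (h.zero.apply_mem pt hv) fun x hx => by
          rw [one_smul, h.even x (Submodule.mem_sup_left hx)]
      · exact hs (ε := -1) v (h.one.apply_mem pt hv) fun x hx => by
          rw [neg_one_smul, h.odd x (Submodule.mem_sup_left hx)]
      · exact hs (ε := 1) v (h.two.apply_mem pt hv) fun x hx => by
          rw [one_smul, h.even x (Submodule.mem_sup_right hx)]
      · exact hs (ε := -1) v (h.three.apply_mem pt hv) fun x hx => by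
          rw [neg_one_smul, h.odd x (Submodule.mem_sup_right hx)],
      h.trace_pt, h.sign_pt]
    simp only [Matrix.cons_val, Units.val_neg, Units.val_one, Int.cast_neg, Int.cast_one]
    linear_combination hk₀₃' - hk₁₂'

theorem exists_add (h : F.Decomposes ρ s σ V D pc pt) (v : M) :
    ∃ x ∈ V 0 ⊔ V 3, ∃ y ∈ V 1 ⊔ V 2, x + y = v := by
  rw [← Submodule.mem_sup]
  have hv : v ∈ ⨆ i, V i := by
    rw [h.internal.submodule_iSup_eq_top]
    trivial
  suffices hle : ⨆ i, V i ≤ (V 0 ⊔ V 3) ⊔ (V 1 ⊔ V 2) from hle hv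
  refine iSup_le fun i => ?_
  fin_cases i
  · exact le_sup_left.trans le_sup_left
  · exact le_sup_left.trans le_sup_right
  · exact le_sup_right.trans le_sup_right
  · exact le_sup_right.trans le_sup_left

/-- The average over the Klein four-group is the projection to `V 0 ⊔ V 3`. -/
theorem exists_average (h : F.Decomposes ρ s σ V D pc pt) (v : M) :
    ∃ x ∈ V 0 ⊔ V 3, ∃ y ∈ V 1 ⊔ V 2, x + y = v ∧ v + ∑ i, ρ (F.n i) v = (4 : ℂ) • x := by
  obtain ⟨x, hx, y, hy, rfl⟩ := h.exists_add v
  refine ⟨x, hx, y, hy, rfl, ?_⟩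
  have h1 := h.sum_n y hy
  simp only [map_add, Finset.sum_add_distrib, h.n_apply x hx]
  rw [add_add_add_comm, h1, Finset.sum_const, Finset.card_univ, Fintype.card_fin]
  module

theorem exists_n_ne (h : F.Decomposes ρ s σ V D pc pt) : ∃ i z, ρ (F.n i) z ≠ z := by
  by_contra! hn
  obtain ⟨y, hy, hy0⟩ := Submodule.exists_mem_ne_zero_of_ne_bot h.nontrivial
  have h1 := h.sum_n y hy
  simp only [hn, Finset.sum_const, Finset.card_univ, Fintype.card_fin] at h1
  refine hy0 ?_
  have h2 : (4 : ℂ) • y = 0 := by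
    rw [← h1]
    module
  simpa using h2

/-- On V₃ the sign of D and the determinant of the transposition cancel; on V₀ neither is present.
-/
theorem t_apply_of_mem (h : F.Decomposes ρ s σ V D pc pt) {x : M} (hx : x ∈ V 0 ⊔ V 3) :
    ρ F.t x = x := by
  obtain ⟨y, hy, z, hz, rfl⟩ := Submodule.mem_sup.1 hx
  rw [h.t_eq, map_mul, Module.End.mul_apply, map_add, map_add]
  congr 1
  · refine (h.even _ (Submodule.mem_sup_left (h.zero.apply_mem pt hy))).trans ?_
    obtain ⟨k, f, y, -, rfl, hg⟩ := h.zero.exists_rep hy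
    exact hg pt y
  · refine (h.odd _ (Submodule.mem_sup_right (h.three.apply_mem pt hz))).trans ?_
    obtain ⟨k, f, z, -, rfl, hg⟩ := h.three.exists_rep hz
    have h1 : ρ (s pt) (f z) = f (-z) := by
      refine (hg pt z).trans (congrArg f (funext fun j => ?_))
      rw [SymRep.det, SymRep.signTwist_apply, h.sign_pt, SymRep.triv_apply]
      simp
    rw [MonoidHom.comp_apply, h1, map_neg, neg_neg]

/-- A vector fixed by the half-turns equals its average over the Klein four-group, so it lies in V₀
⊕ V₃. -/
theorem t_apply_of_n (h : F.Decomposes ρ s σ V D pc pt) (v : M) (hv : ∀ i, ρ (F.n i) v = v) :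
    ρ F.t v = v := by
  obtain ⟨x, hx, y, -, -, hxv⟩ := h.exists_average v
  have h1 : (4 : ℂ) • v = (4 : ℂ) • x := by
    rw [← hxv]
    simp only [hv, Finset.sum_const, Finset.card_univ, Fintype.card_fin]
    module
  rw [smul_right_injective M (by norm_num : (4 : ℂ) ≠ 0) h1]
  exact h.t_apply_of_mem hx

/-- In σ a vector fixed by the three-cycle is fixed by the transposition. The sign -1 comes from D
on V₁ and from the sign twist on V₂. -/
theorem t_apply_of_c (h : F.Decomposes ρ s σ V D pc pt) {w : M} (hw : w ∈ V 1 ⊔ V 2)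
    (hc : ρ F.c w = w) : ρ F.t w = -w := by
  obtain ⟨y, hy, z, hz, rfl⟩ := Submodule.mem_sup.1 hw
  rw [h.c_eq, map_add] at hc
  have hy' : ρ (s pc) y ∈ V 1 := h.one.apply_mem pc hy
  have hz' : ρ (s pc) z ∈ V 2 := h.two.apply_mem pc hz
  have hd : Disjoint (V 1) (V 2) :=
    h.internal.submodule_iSupIndep.pairwiseDisjoint (by decide : (1 : Fin 4) ≠ 2)
  -- Since c preserves V₁ and V₂, which meet trivially, it fixes both components.
  have h0 := Submodule.disjoint_def.1 hd (ρ (s pc) y - y) ((V 1).sub_mem hy' hy) (by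
    have : ρ (s pc) y - y = z - ρ (s pc) z := by
      rw [sub_eq_sub_iff_add_eq_add, hc, add_comm]
    rw [this]
    exact (V 2).sub_mem hz hz')
  have hcy : ρ (s pc) y = y := sub_eq_zero.1 h0
  have hcz : ρ (s pc) z = z := by
    rw [hcy] at hc
    exact add_left_cancel hc
  rw [h.t_eq, map_mul, Module.End.mul_apply, map_add, map_add, neg_add]
  congr 1
  · refine (h.odd _ (Submodule.mem_sup_left (h.one.apply_mem pt hy))).trans ?_
    obtain ⟨k, f, y, hf, rfl, hg⟩ := h.one.exists_rep hy
    have h1 := hf ((hg pc y).symm.trans hcy)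
    exact congrArg Neg.neg ((hg pt y).trans
      (congrArg f (funext fun j => h.apply_pt _ (congrFun h1 j))))
  · refine (h.even _ (Submodule.mem_sup_right (h.two.apply_mem pt hz))).trans ?_
    obtain ⟨k, f, z, hf, rfl, hg⟩ := h.two.exists_rep hz
    have h1 := hf ((hg pc z).symm.trans hcz)
    rw [← map_neg]
    refine (hg pt z).trans (congrArg f (funext fun j => ?_))
    have h2 := congrFun h1 j
    rw [SymRep.signTwist_apply, h.sign_pc, Units.val_one, Int.cast_one, one_smul] at h2
    rw [SymRep.signTwist_apply, h.sign_pt, h.apply_pt _ h2]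
    simp

/-- The diagonal w = v + c v + c² v is fixed by c, so t negates it. As t commutes with n₂, it also
negates n₂ w = v - c v - c² v, and v is half the sum of the two. -/
theorem t_apply_of_axis (h : F.Decomposes ρ s σ V D pc pt) (v : M) (h₂ : ρ (F.n 2) v = v)
    (h₀ : ρ (F.n 0) v = -v) : ρ F.t v = -v := by
  have hmul (a b : K) (x : M) : ρ a (ρ b x) = ρ (a * b) x := by
    rw [map_mul, Module.End.mul_apply]
  have h₁ : ρ (F.n 1) v = -v := by
    have e : F.n 1 = F.n 0 * F.n 2 := by
      have := F.n_mul_n 0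
      change F.n 0 * F.n 1 = F.n 2 at this
      rw [← this, ← mul_assoc, F.n_mul_self, one_mul]
    rw [e, ← hmul, h₂, h₀]
  have hv : v ∈ V 1 ⊔ V 2 := by
    obtain ⟨x, hx, y, hy, hxy, hxv⟩ := h.exists_average v
    have h4 : (4 : ℂ) • x = 0 := by
      rw [← hxv, Fin.sum_univ_three, h₀, h₁, h₂]
      abel
    have hx0 : x = 0 := by simpa using h4
    rwa [← hxy, hx0, zero_add]
  have hcm (x : M) (hx : x ∈ V 1 ⊔ V 2) : ρ F.c x ∈ V 1 ⊔ V 2 := by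
    obtain ⟨y, hy, z, hz, rfl⟩ := Submodule.mem_sup.1 hx
    rw [h.c_eq, map_add]
    exact Submodule.add_mem_sup (h.one.apply_mem pc hy) (h.two.apply_mem pc hz)
  have hcn (i : Fin 3) (x : M) : ρ (F.n (i + 1)) (ρ F.c x) = ρ F.c (ρ (F.n i) x) := by
    rw [hmul, hmul, F.c_mul_n]
  have hw : v + ρ F.c v + ρ F.c (ρ F.c v) ∈ V 1 ⊔ V 2 :=
    add_mem (add_mem hv (hcm _ hv)) (hcm _ (hcm _ hv))
  have hcw : ρ F.c (v + ρ F.c v + ρ F.c (ρ F.c v)) = v + ρ F.c v + ρ F.c (ρ F.c v) := by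
    have h3 : ρ F.c (ρ F.c (ρ F.c v)) = v := by
      rw [hmul, hmul, ← pow_two, ← pow_succ, F.c_pow, map_one, Module.End.one_apply]
    rw [map_add, map_add, h3]
    abel
  have htw := h.t_apply_of_c hw hcw
  have hn2w : ρ (F.n 2) (v + ρ F.c v + ρ F.c (ρ F.c v)) =
      v - ρ F.c v - ρ F.c (ρ F.c v) := by
    have e1 : ρ (F.n 2) (ρ F.c v) = ρ F.c (ρ (F.n 1) v) := hcn 1 v
    have e2 : ρ (F.n 2) (ρ F.c (ρ F.c v)) = ρ F.c (ρ (F.n 1) (ρ F.c v)) := hcn 1 _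
    have e3 : ρ (F.n 1) (ρ F.c v) = ρ F.c (ρ (F.n 0) v) := hcn 0 v
    rw [map_add, map_add, h₂, e1, e2, e3, h₁, h₀, map_neg, map_neg]
    abel
  have htn (x : M) : ρ F.t (ρ (F.n 2) x) = ρ (F.n 2) (ρ F.t x) := by
    rw [hmul, hmul, F.t_mul_n_two]
  have key := htn (v + ρ F.c v + ρ F.c (ρ F.c v))
  rw [htw, map_neg, hn2w, map_sub, map_sub] at key
  rw [map_add, map_add] at htw
  have h2 : (2 : ℂ) • ρ F.t v = (2 : ℂ) • (-v) := by
    have e : (2 : ℂ) • ρ F.t v = (ρ F.t v + ρ F.t (ρ F.c v) + ρ F.t (ρ F.c (ρ F.c v))) +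
        (ρ F.t v - ρ F.t (ρ F.c v) - ρ F.t (ρ F.c (ρ F.c v))) := by module
    rw [e, htw, key]
    module
  exact smul_right_injective M (two_ne_zero (α := ℂ)) h2

/-- If V₁ ≠ 0, the copy inside σ is used directly; otherwise V₂ ≠ 0 and `rot` absorbs the sign
twist. -/
theorem exists_std (h : F.Decomposes ρ s σ V D pc pt)
    (emb : Equiv.Perm (Fin 3) →* Equiv.Perm (Fin m))
    (hemb : ∀ p, Equiv.Perm.sign (emb p) = Equiv.Perm.sign p)
    (i : Representation.IntertwiningMap (SymRep.std 3) (σ.comp emb)) (hi : Function.Injective i) :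
    ∃ f : Representation.IntertwiningMap (SymRep.std 3) (ρ.comp (s.comp emb)),
      Function.Injective f ∧ ∀ x, f x ∈ V 1 ⊔ V 2 := by
  have hint := Representation.IntertwiningMap.isIntertwining _ _ i
  by_cases hV : V 1 = ⊥
  · obtain ⟨f, hf, hfV⟩ := h.two.exists_intertwining fun h2 => h.nontrivial (by
      rw [hV, h2, sup_bot_eq])
    have hfi := Representation.IntertwiningMap.isIntertwining _ _ f
    refine ⟨⟨f.toLinearMap ∘ₗ i.toLinearMap ∘ₗ SymRep.rot, fun p => LinearMap.ext fun x => ?_⟩,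
      hf.comp (hi.comp SymRep.rot_injective), fun x => Submodule.mem_sup_right (hfV _)⟩
    change f (i (SymRep.rot (SymRep.std 3 p x))) = ρ (s (emb p)) (f (i (SymRep.rot x)))
    refine Eq.trans ?_ (hfi (emb p) (i (SymRep.rot x)))
    rw [SymRep.rot_std, SymRep.signTwist_apply, hemb, map_smul, hint]
    rfl
  · obtain ⟨f, hf, hfV⟩ := h.one.exists_intertwining hV
    have hfi := Representation.IntertwiningMap.isIntertwining _ _ f
    refine ⟨⟨f.toLinearMap ∘ₗ i.toLinearMap, fun p => LinearMap.ext fun x => ?_⟩,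
      hf.comp hi, fun x => Submodule.mem_sup_left (hfV _)⟩
    change f (i (SymRep.std 3 p x)) = ρ (s (emb p)) (f (i x))
    refine Eq.trans ?_ (hfi (emb p) (i x))
    rw [hint]
    rfl

end CubeFrame.Decomposes

/-- The theorem for any group whose action on homology decomposes. -/
theorem CubeFrame.Decomposes.hasStandardRose {K N : Type*} [Group K] {X : CWGraph.{u, v}}
    [AddCommGroup N] [Module ℂ N] [FiniteDimensional ℂ N] {F : CubeFrame K} {a : GraphAction K X}
    {m : ℕ} {s : Equiv.Perm (Fin m) →* K} {σ : Representation ℂ (Equiv.Perm (Fin m)) N}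
    {V : Fin 4 → Submodule ℂ X.H₁} {D : K} {pc pt : Equiv.Perm (Fin m)}
    (h : F.Decomposes (M := X.H₁) a.homologyRep s σ V D pc pt) (ha : a.Admissible)
    (hX : X.HasRank 5)
    (emb : Equiv.Perm (Fin 3) →* Equiv.Perm (Fin m))
    (hemb : ∀ p, Equiv.Perm.sign (emb p) = Equiv.Perm.sign p)
    (i : Representation.IntertwiningMap (SymRep.std 3) (σ.comp emb)) (hi : Function.Injective i) :
    HasStandardRose a (s.comp emb) := by
  have hfin : FiniteDimensional ℂ X.H₁ := hX.finrank_H₁_le.1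
  have : Finite X.Dart := ha.finite_dart hfin
  have : Finite X.Vert := hX.1.finite_vert
  have := Fintype.ofFinite X.Dart
  have := Fintype.ofFinite X.Vert
  have hM : Module.finrank ℂ X.H₁ = 5 := (a.euler_of_hasRank hX).2
  obtain ⟨hc, ht⟩ := h.traces hM
  obtain ⟨f, hf, hfV⟩ := h.exists_std emb hemb i hi
  exact (ha.isCubical hX F hc ht h.exists_n_ne h.t_apply_of_n h.t_apply_of_axis).hasStandardRose
    _ f hf fun x => h.sum_n _ (hfV x)

/-! ### The group `W₃` -/

theorem FreeGroup.mulAut_ext {α : Type*} {φ ψ : MulAut (FreeGroup α)}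
    (h : ∀ i, φ (FreeGroup.of i) = ψ (FreeGroup.of i)) : φ = ψ :=
  MulEquiv.ext fun w => DFunLike.congr_fun
    (FreeGroup.ext_hom φ.toMonoidHom ψ.toMonoidHom h) w

namespace OutF

variable {n : ℕ}

theorem flipAut_of (I : Finset (Fin n)) (i : Fin n) : flipAut I (FreeGroup.of i) =
    if i ∈ I then (FreeGroup.of i)⁻¹ else FreeGroup.of i := by
  change flipHom I (FreeGroup.of i) = _
  simp [flipHom]

theorem ε_mul_self (i : Fin n) : (ε i : OutF n) * ε i = 1 :=
  congrArg (QuotientGroup.mk' (Inn n)) (MulEquiv.ext fun w => flipHom_flipHom {i} w :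
    flipAut {i} * flipAut {i} = 1)

theorem ε_mul_ε (i j : Fin n) : (ε i : OutF n) * ε j = ε j * ε i := by
  refine congrArg (QuotientGroup.mk' (Inn n)) (FreeGroup.mulAut_ext fun k => ?_ :
    flipAut {i} * flipAut {j} = flipAut {j} * flipAut {i})
  rw [MulAut.mul_apply, MulAut.mul_apply, flipAut_of, flipAut_of]
  split_ifs with hj hi hi
  · rw [map_inv, map_inv, flipAut_of, flipAut_of, if_pos hi, if_pos hj]
  · rw [map_inv, flipAut_of, flipAut_of, if_neg hi, if_pos hj]
  · rw [map_inv, flipAut_of, flipAut_of, if_pos hi, if_neg hj]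
  · rw [flipAut_of, flipAut_of, if_neg hi, if_neg hj]

theorem permOut_mul_ε (p : Equiv.Perm (Fin n)) (i : Fin n) :
    permOut n p * ε i = ε (p i) * permOut n p := by
  rw [permOut_apply]
  refine congrArg (QuotientGroup.mk' (Inn n)) (FreeGroup.mulAut_ext fun k => ?_ :
    (FreeGroup.freeGroupCongr p : MulAut (FreeGroup (Fin n))) * flipAut {i} =
      flipAut {p i} * (FreeGroup.freeGroupCongr p : MulAut (FreeGroup (Fin n))))
  rw [MulAut.mul_apply, MulAut.mul_apply, flipAut_of]
  by_cases hi : k = i <;> simp [hi, flipAut_of]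

theorem εW_mul_self (i : Fin n) : εW i * εW i = 1 := Subtype.ext (ε_mul_self i)

theorem εW_mul_εW (i j : Fin n) : εW i * εW j = εW j * εW i := Subtype.ext (ε_mul_ε i j)

theorem permW_mul_εW (p : Equiv.Perm (Fin n)) (i : Fin n) :
    permW n p * εW i = εW (p i) * permW n p := Subtype.ext (permOut_mul_ε p i)

end OutF

/-- A subgroup permutes finitely many elements by conjugation as soon as its generators do. -/
theorem Subgroup.exists_mul_eq_mul {A ι : Type*} [Group A] [Finite ι] (n : ι → A) {S : Set A}
    (hS : ∀ k ∈ S, ∀ i, ∃ j, k * n i = n j * k) {k : A} (hk : k ∈ Subgroup.closure S) (i : ι) :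
    ∃ j, k * n i = n j * k := by
  -- For a finite set it is enough that conjugation maps it into itself.
  have hle : Subgroup.closure S ≤ Subgroup.normalizer (Set.range n) := by
    refine (Subgroup.closure_le _).2 fun x hx => Subgroup.mem_normalizer_fintype ?_
    rintro _ ⟨i, rfl⟩
    obtain ⟨j, hj⟩ := hS x hx i
    exact ⟨j, by rw [hj, mul_inv_cancel_right]⟩
  obtain ⟨j, hj⟩ := (Subgroup.mem_set_normalizer_iff.1 (hle hk) (n i)).1 ⟨i, rfl⟩
  exact ⟨j, by rw [hj, inv_mul_cancel_right]⟩

namespace OutF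

/-- The rotations by a half turn in `W₃`. -/
noncomputable def halfTurnW (i : Fin 3) : W 3 := εW (i + 1) * εW (i + 2)

/-- `Δ` as an element of `W₃`. -/
noncomputable def ΔW : W 3 := εW 0 * εW 1 * εW 2

theorem εW_mul_halfTurnW (j i : Fin 3) : εW j * halfTurnW i = halfTurnW i * εW j := by
  rw [halfTurnW, ← mul_assoc, εW_mul_εW j, mul_assoc, εW_mul_εW j, mul_assoc]

theorem permW_mul_halfTurnW (p : Equiv.Perm (Fin 3)) (i : Fin 3) :
    permW 3 p * halfTurnW i = halfTurnW (p i) * permW 3 p := by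
  rw [halfTurnW, ← mul_assoc, permW_mul_εW, mul_assoc, permW_mul_εW, ← mul_assoc, halfTurnW]
  rcases SymRep.perm_three_cases p i with ⟨-, h1, h2⟩ | ⟨-, h1, h2⟩
  · rw [h1, h2]
  · rw [h1, h2, εW_mul_εW]

theorem ΔW_mul_halfTurnW (i : Fin 3) : ΔW * halfTurnW i = halfTurnW i * ΔW := by
  rw [ΔW, mul_assoc, εW_mul_halfTurnW, ← mul_assoc, mul_assoc _ (εW 1), εW_mul_halfTurnW,
    ← mul_assoc, εW_mul_halfTurnW]
  simp only [mul_assoc]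

theorem permW_finRotate_mul_ΔW :
    permW 3 (finRotate 3) * ΔW = ΔW * permW 3 (finRotate 3) := by
  rw [ΔW, ← mul_assoc, ← mul_assoc, permW_mul_εW, mul_assoc (εW _), permW_mul_εW,
    ← mul_assoc, mul_assoc _ (permW 3 _), permW_mul_εW, ← mul_assoc]
  congr 1
  change εW 1 * εW 2 * εW 0 = εW 0 * εW 1 * εW 2
  rw [mul_assoc, εW_mul_εW 2 0, ← mul_assoc, εW_mul_εW 1 0]

theorem halfTurnW_normal (k : W 3) (i : Fin 3) : ∃ j, k * halfTurnW i = halfTurnW j * k := by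
  have hk : (k : OutF 3) ∈ Subgroup.closure (Set.range (ε (n := 3)) ∪ Set.range (permOut 3)) := by
    rw [Subgroup.closure_union, ← MonoidHom.coe_range, Subgroup.closure_eq]
    exact k.2
  obtain ⟨j, hj⟩ := Subgroup.exists_mul_eq_mul (fun i => (halfTurnW i : OutF 3)) (by
    rintro _ (⟨j, rfl⟩ | ⟨p, rfl⟩) i
    · exact ⟨i, congrArg Subtype.val (εW_mul_halfTurnW j i)⟩
    · exact ⟨p i, congrArg Subtype.val (permW_mul_halfTurnW p i)⟩) hk i
  exact ⟨j, Subtype.ext hj⟩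

theorem swap_mul_finRotate : Equiv.swap 0 1 * finRotate 3 = finRotate 3 ^ 2 * Equiv.swap 0 1 := by
  decide

/-- The cube frame of `W₃`. -/
noncomputable def cubeFrameW : CubeFrame (W 3) where
  n := halfTurnW
  c := permW 3 (finRotate 3)
  -- A transposition of the axes is a reflection; multiplied by Δ, which acts as -1 on the axes, it
  -- becomes a half-turn.
  t := ΔW * permW 3 (Equiv.swap 0 1)
  n_mul_self i := by
    rw [halfTurnW, mul_assoc, εW_mul_εW (i + 1), ← mul_assoc (εW (i + 2)), εW_mul_self, one_mul,
      εW_mul_self]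
  n_mul_n i := by
    have h1 : i + 1 + 1 = i + 2 := by decide +revert
    have h2 : i + 1 + 2 = i := by decide +revert
    have h3 : i + 2 + 1 = i := by decide +revert
    have h4 : i + 2 + 2 = i + 1 := by decide +revert
    rw [halfTurnW, halfTurnW, halfTurnW, h1, h2, h3, h4, mul_assoc, ← mul_assoc (εW (i + 2)),
      εW_mul_self, one_mul, εW_mul_εW]
  c_pow := by
    rw [← map_pow, show finRotate 3 ^ 3 = 1 by decide, map_one]
  c_mul_n i := by rw [permW_mul_halfTurnW, finRotate_apply]
  t_mul_c := by
    rw [mul_assoc, ← map_mul, swap_mul_finRotate, map_mul, ← mul_assoc, map_pow, pow_two,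
      ← mul_assoc, ← permW_finRotate_mul_ΔW, mul_assoc _ ΔW, ← permW_finRotate_mul_ΔW]
    simp only [mul_assoc]
  t_mul_n_zero := by
    rw [mul_assoc, permW_mul_halfTurnW, ← mul_assoc, ΔW_mul_halfTurnW, mul_assoc,
      Equiv.swap_apply_left]
  t_mul_n_one := by
    rw [mul_assoc, permW_mul_halfTurnW, ← mul_assoc, ΔW_mul_halfTurnW, mul_assoc,
      Equiv.swap_apply_right]
  t_mul_n_two := by
    rw [mul_assoc, permW_mul_halfTurnW, ← mul_assoc, ΔW_mul_halfTurnW, mul_assoc]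
    rfl
  normal := halfTurnW_normal

end OutF

section LevelW

variable {M : Type*} [AddCommGroup M] [Module ℂ M] {ρ : Representation ℂ (OutF.W 3) M}

/-- The eigenvalue of `ε_j` on `E_I`. -/
def eigenSign (I : Finset (Fin 3)) (j : Fin 3) : ℤ := if j ∈ I then -1 else 1

/-- Stating the eigenvalues as integers lets the sign identities below be decided by running through
all subsets I. -/
theorem levelV_le {i : ℕ} {S : Submodule ℂ M} (h : ∀ (I : Finset (Fin 3)), I.card = i →
    ∀ v : M, (∀ j, ρ (OutF.εW j) v = eigenSign I j • v) → v ∈ S) : levelV ρ i ≤ S := by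
  refine iSup₂_le fun I hI v hv => h I hI v fun j => ?_
  have h1 := Module.End.mem_eigenspace_iff.1 ((Submodule.mem_iInf _).1 hv j)
  rw [h1, eigenSign]
  split_ifs <;> simp

theorem halfTurnW_apply {I : Finset (Fin 3)} {v : M}
    (hv : ∀ j, ρ (OutF.εW j) v = eigenSign I j • v) (i : Fin 3) :
    ρ (OutF.halfTurnW i) v = (eigenSign I (i + 2) * eigenSign I (i + 1)) • v := by
  rw [OutF.halfTurnW, map_mul, Module.End.mul_apply, hv, map_zsmul, hv, smul_smul]

theorem ΔW_apply {I : Finset (Fin 3)} {v : M}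
    (hv : ∀ j, ρ (OutF.εW j) v = eigenSign I j • v) :
    ρ OutF.ΔW v = (eigenSign I 2 * (eigenSign I 1 * eigenSign I 0)) • v := by
  rw [OutF.ΔW, map_mul, map_mul, Module.End.mul_apply, Module.End.mul_apply, hv, map_zsmul, hv,
    map_zsmul, map_zsmul, hv, smul_smul, smul_smul, mul_assoc]

theorem eigenSign_even : ∀ I : Finset (Fin 3), I.card = 0 ∨ I.card = 2 →
    eigenSign I 2 * (eigenSign I 1 * eigenSign I 0) = 1 := by decide

theorem eigenSign_odd : ∀ I : Finset (Fin 3), I.card = 1 ∨ I.card = 3 →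
    eigenSign I 2 * (eigenSign I 1 * eigenSign I 0) = -1 := by decide

theorem eigenSign_extreme : ∀ I : Finset (Fin 3), I.card = 0 ∨ I.card = 3 →
    ∀ i : Fin 3, eigenSign I (i + 2) * eigenSign I (i + 1) = 1 := by decide

theorem eigenSign_middle : ∀ I : Finset (Fin 3), I.card = 1 ∨ I.card = 2 →
    1 + ∑ i : Fin 3, eigenSign I (i + 2) * eigenSign I (i + 1) = 0 := by decide

theorem ΔW_apply_even {x : M} (hx : x ∈ levelV ρ 0 ⊔ levelV ρ 2) : ρ OutF.ΔW x = x := by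
  suffices h : levelV ρ 0 ⊔ levelV ρ 2 ≤ LinearMap.eqLocus (ρ OutF.ΔW) LinearMap.id from h hx
  refine sup_le (levelV_le fun I hI v hv => ?_) (levelV_le fun I hI v hv => ?_)
  · rw [LinearMap.mem_eqLocus, ΔW_apply hv, eigenSign_even I (.inl hI), one_smul,
      LinearMap.id_apply]
  · rw [LinearMap.mem_eqLocus, ΔW_apply hv, eigenSign_even I (.inr hI), one_smul,
      LinearMap.id_apply]

theorem ΔW_apply_odd {x : M} (hx : x ∈ levelV ρ 1 ⊔ levelV ρ 3) : ρ OutF.ΔW x = -x := by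
  suffices h : levelV ρ 1 ⊔ levelV ρ 3 ≤ LinearMap.eqLocus (ρ OutF.ΔW) (-LinearMap.id) from h hx
  refine sup_le (levelV_le fun I hI v hv => ?_) (levelV_le fun I hI v hv => ?_)
  · rw [LinearMap.mem_eqLocus, ΔW_apply hv, eigenSign_odd I (.inl hI), neg_one_smul,
      LinearMap.neg_apply, LinearMap.id_apply]
  · rw [LinearMap.mem_eqLocus, ΔW_apply hv, eigenSign_odd I (.inr hI), neg_one_smul,
      LinearMap.neg_apply, LinearMap.id_apply]

theorem halfTurnW_apply_extreme {x : M} (hx : x ∈ levelV ρ 0 ⊔ levelV ρ 3) (i : Fin 3) :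
    ρ (OutF.halfTurnW i) x = x := by
  suffices h : levelV ρ 0 ⊔ levelV ρ 3 ≤
    LinearMap.eqLocus (ρ (OutF.halfTurnW i)) LinearMap.id from h hx
  refine sup_le (levelV_le fun I hI v hv => ?_) (levelV_le fun I hI v hv => ?_)
  · rw [LinearMap.mem_eqLocus, halfTurnW_apply hv, eigenSign_extreme I (.inl hI), one_smul,
      LinearMap.id_apply]
  · rw [LinearMap.mem_eqLocus, halfTurnW_apply hv, eigenSign_extreme I (.inr hI), one_smul,
      LinearMap.id_apply]

theorem sum_halfTurnW_apply {x : M} (hx : x ∈ levelV ρ 1 ⊔ levelV ρ 2) :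
    x + ∑ i, ρ (OutF.halfTurnW i) x = 0 := by
  have key {I : Finset (Fin 3)} (hI : I.card = 1 ∨ I.card = 2) {v : M}
      (hv : ∀ j, ρ (OutF.εW j) v = eigenSign I j • v) :
      v ∈ LinearMap.ker (LinearMap.id + ∑ i, ρ (OutF.halfTurnW i)) := by
    rw [LinearMap.mem_ker, LinearMap.add_apply, LinearMap.sum_apply, LinearMap.id_apply]
    simp only [halfTurnW_apply hv]
    rw [← Finset.sum_smul]
    nth_rw 1 [← one_smul ℤ v]
    rw [← add_smul, eigenSign_middle I hI, zero_smul]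
  suffices h : levelV ρ 1 ⊔ levelV ρ 2 ≤
      LinearMap.ker (LinearMap.id + ∑ i, ρ (OutF.halfTurnW i)) by
    have := LinearMap.mem_ker.1 (h hx)
    rwa [LinearMap.add_apply, LinearMap.sum_apply, LinearMap.id_apply] at this
  exact sup_le (levelV_le fun I hI v hv => key (.inl hI) hv)
    (levelV_le fun I hI v hv => key (.inr hI) hv)

theorem WDecomposition.decomposes (h : WDecomposition ρ) :
    OutF.cubeFrameW.Decomposes ρ (OutF.permW 3) (SymRep.perm 3) (fun i : Fin 4 => levelV ρ i)
      OutF.ΔW (finRotate 3) (Equiv.swap 0 1) where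
  c_eq := rfl
  t_eq := rfl
  sign_pc := by decide
  sign_pt := by decide
  finrank_eq := by simp
  trace_pc := by
    rw [SymRep.trace_perm, show (Finset.univ.filter fun i => (finRotate 3)⁻¹ i = i).card = 0 by
      decide, Nat.cast_zero]
  trace_pt := by
    rw [SymRep.trace_perm, show (Finset.univ.filter
      fun i : Fin 3 => (Equiv.swap 0 1)⁻¹ i = i).card = 1 by decide, Nat.cast_one]
  -- A vector fixed by the cyclic rotation of the coordinates is constant.
  apply_pt x hx := by
    have h0 : x 2 = x 0 := congrFun hx 0
    have h1 : x 0 = x 1 := congrFun hx 1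
    funext i
    fin_cases i
    exacts [h1.symm, h1, rfl]
  internal := h.internal
  nontrivial := h.nontrivial
  even _ hx := ΔW_apply_even hx
  odd _ hx := ΔW_apply_odd hx
  zero := h.zero
  one := h.one
  two := h.two
  three := h.three
  sum_n _ hx := sum_halfTurnW_apply hx
  n_apply _ hx i := halfTurnW_apply_extreme hx i

end LevelW

theorem hasStandardRose_of_WDecomposition {X : CWGraph.{u, v}} (hX : X.HasRank 5)
    (a : GraphAction (OutF.W 3) X) (ha : a.Admissible)
    (h : WDecomposition (M := X.H₁) a.homologyRep) : HasStandardRose a (OutF.permW 3) :=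
  h.decomposes.hasStandardRose ha hX (MonoidHom.id _) (fun _ => rfl)
    ⟨(SymRep.sumZero 3).subtype, fun _ => rfl⟩ (SymRep.sumZero 3).injective_subtype

/-! ### The group `G₃` -/

namespace OutF

variable {n : ℕ}

theorem flipAut_gen (j : Fin (n + 1)) : flipAut Finset.univ (gen j) = (gen j : FreeGroup (Fin n))⁻¹ := by
  induction j using Fin.lastCases with
  | last => simp [gen]
  | cast i => simp [gen, flipAut_of]

theorem symAut_gen (p : Equiv.Perm (Fin (n + 1))) (j : Fin (n + 1)) :
    symAut n p (gen j) = gen (p j) * (gen (p (Fin.last n)))⁻¹ := symHom_gen p j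

/-- The two automorphisms commute only up to conjugation by the generator that is the image of the
last index, so the relation holds in the outer automorphism group. -/
theorem Δ_mul_symOut (p : Equiv.Perm (Fin (n + 1))) : Δ n * symOut n p = symOut n p * Δ n := by
  have h : flipAut Finset.univ * symAut n p =
      MulAut.conj (gen (p (Fin.last n)))⁻¹ * (symAut n p * flipAut Finset.univ) := by
    refine FreeGroup.mulAut_ext fun i => ?_
    have hi : FreeGroup.of i = gen i.castSucc := by simp [gen]
    rw [hi, MulAut.mul_apply, MulAut.mul_apply, MulAut.mul_apply, MulAut.conj_apply, symAut_gen,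
      flipAut_gen, map_mul, map_inv, map_inv, symAut_gen, flipAut_gen, flipAut_gen]
    group
  have hc : QuotientGroup.mk' (Inn n) (MulAut.conj (gen (p (Fin.last n)))⁻¹) = 1 :=
    (QuotientGroup.eq_one_iff _).2 ⟨_, rfl⟩
  have h1 := congrArg (QuotientGroup.mk' (Inn n)) h
  rw [map_mul, map_mul, hc, one_mul] at h1
  exact h1

theorem ΔG_mul_symG (p : Equiv.Perm (Fin (n + 1))) : ΔG n * symG n p = symG n p * ΔG n :=
  Subtype.ext (Δ_mul_symOut p)

/-- The double transpositions in `S₄`. -/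
def doubleSwap (i : Fin 3) : Equiv.Perm (Fin 4) :=
  Equiv.swap i.castSucc 3 * Equiv.swap (i + 1).castSucc (i + 2).castSucc

/-- The cyclic permutation of the first three indices. -/
def rotateFour : Equiv.Perm (Fin 4) := Equiv.swap 0 1 * Equiv.swap 1 2

theorem doubleSwap_normal : ∀ (p : Equiv.Perm (Fin 4)) (i : Fin 3),
    ∃ j, p * doubleSwap i = doubleSwap j * p := by decide

theorem symG_doubleSwap_normal (k : G 3) (i : Fin 3) :
    ∃ j, k * symG 3 (doubleSwap i) = symG 3 (doubleSwap j) * k := by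
  have hk : (k : OutF 3) ∈ Subgroup.closure ({Δ 3} ∪ Set.range (symOut 3)) := by
    rw [Subgroup.closure_union, ← MonoidHom.coe_range, Subgroup.closure_eq]
    exact k.2
  obtain ⟨j, hj⟩ := Subgroup.exists_mul_eq_mul (fun i => symOut 3 (doubleSwap i)) (by
    rintro _ (rfl | ⟨p, rfl⟩) i
    · exact ⟨i, Δ_mul_symOut _⟩
    · obtain ⟨j, hj⟩ := doubleSwap_normal p i
      exact ⟨j, by rw [← map_mul, hj, map_mul]⟩) hk i
  exact ⟨j, Subtype.ext hj⟩

theorem ΔG_mul_symG_mul_symG {p q r s : Equiv.Perm (Fin 4)} (h : p * q = r * s) :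
    ΔG 3 * symG 3 p * symG 3 q = symG 3 r * (ΔG 3 * symG 3 s) := by
  rw [mul_assoc, ← map_mul, h, map_mul, ← mul_assoc, ΔG_mul_symG, mul_assoc]

/-- The cube frame of `G₃`. -/
def cubeFrameG : CubeFrame (G 3) where
  n i := symG 3 (doubleSwap i)
  c := symG 3 rotateFour
  -- As Δ commutes with S₄, it does not affect the relations; it is included to make t act trivially
  -- on V₃ and with trace -1 on both three-dimensional types.
  t := ΔG 3 * symG 3 (Equiv.swap 0 1)
  n_mul_self i := by
    rw [← map_mul, show doubleSwap i * doubleSwap i = 1 by decide +revert, map_one]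
  n_mul_n i := by
    rw [← map_mul, show doubleSwap i * doubleSwap (i + 1) = doubleSwap (i + 2) by decide +revert]
  c_pow := by
    rw [← map_pow, show rotateFour ^ 3 = 1 by decide, map_one]
  c_mul_n i := by
    rw [← map_mul, ← map_mul,
      show rotateFour * doubleSwap i = doubleSwap (i + 1) * rotateFour by decide +revert]
  t_mul_c := by
    rw [← map_pow]
    exact ΔG_mul_symG_mul_symG (by decide)
  t_mul_n_zero := ΔG_mul_symG_mul_symG (by decide)
  t_mul_n_one := ΔG_mul_symG_mul_symG (by decide)
  t_mul_n_two := ΔG_mul_symG_mul_symG (by decide)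
  normal := symG_doubleSwap_normal

end OutF

namespace SymRep

/-- The Klein four-group is simply transitive on the four indices, so each coordinate of the sum is
the full coordinate sum of x. -/
theorem std_apply_doubleSwap (x : sumZero 4) :
    x + ∑ i, std 4 (OutF.doubleSwap i) x = 0 := by
  have hs : x.1 0 + x.1 1 + x.1 2 + x.1 3 = 0 := by
    have := (mem_sumZero x.1).1 x.2
    rwa [Fin.sum_univ_four] at this
  rw [Fin.sum_univ_three]
  ext j
  fin_cases j
  · change x.1 0 + (x.1 3 + x.1 2 + x.1 1) = 0
    linear_combination hs
  · change x.1 1 + (x.1 2 + x.1 3 + x.1 0) = 0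
    linear_combination hs
  · change x.1 2 + (x.1 1 + x.1 0 + x.1 3) = 0
    linear_combination hs
  · change x.1 3 + (x.1 0 + x.1 1 + x.1 2) = 0
    linear_combination hs

theorem sign_doubleSwap : ∀ i, Equiv.Perm.sign (OutF.doubleSwap i) = 1 := by decide

theorem signedStd_apply_doubleSwap (x : sumZero 4) :
    x + ∑ i, signedStd 4 (OutF.doubleSwap i) x = 0 := by
  have h (i : Fin 3) : signedStd 4 (OutF.doubleSwap i) x = std 4 (OutF.doubleSwap i) x := by
    rw [signedStd, signTwist_apply, sign_doubleSwap, Units.val_one, Int.cast_one, one_smul]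
  simp only [h, std_apply_doubleSwap]

/-- The extension of vectors by zero. -/
def extend : sumZero 3 →ₗ[ℂ] sumZero 4 where
  toFun x := ⟨![x.1 0, x.1 1, x.1 2, 0], by
    have hs := (mem_sumZero x.1).1 x.2
    rw [Fin.sum_univ_three] at hs
    rw [mem_sumZero, Fin.sum_univ_four]
    change x.1 0 + x.1 1 + x.1 2 + 0 = 0
    rw [hs, add_zero]⟩
  map_add' x y := by
    ext i
    fin_cases i <;> simp
  map_smul' r x := by
    ext i
    fin_cases i <;> simp

theorem extend_castSucc (x : sumZero 3) (i : Fin 3) : (extend x).1 i.castSucc = x.1 i := by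
  fin_cases i <;> rfl

theorem extend_last (x : sumZero 3) : (extend x).1 (Fin.last 3) = 0 := rfl

theorem extend_injective : Function.Injective extend := fun x y h => by
  ext i
  rw [← extend_castSucc x, h, extend_castSucc]

theorem extend_std (p : Equiv.Perm (Fin 3)) (x : sumZero 3) : extend (std 3 p x) =
    std 4 (Equiv.Perm.viaEmbeddingHom Fin.castSuccEmb p) (extend x) := by
  ext i
  rw [std_apply, ← map_inv, Equiv.Perm.viaEmbeddingHom_apply]
  induction i using Fin.lastCases with
  | last =>
    rw [Equiv.Perm.viaEmbedding_apply_of_notMem _ _ _ (by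
      rintro ⟨i, hi⟩
      exact (Fin.castSucc_lt_last i).ne hi), extend_last, extend_last]
  | cast i =>
    have h : p⁻¹.viaEmbedding Fin.castSuccEmb i.castSucc = (p⁻¹ i).castSucc :=
      Equiv.Perm.viaEmbedding_apply p⁻¹ Fin.castSuccEmb i
    rw [h, extend_castSucc, extend_castSucc, std_apply]

end SymRep

section SumApply

variable {M N : Type*} [AddCommGroup M] [Module ℂ M] [AddCommGroup N] [Module ℂ N] {H : Type*}
  [Group H] {ρ : Representation ℂ H M} {V : Submodule ℂ M} {σ : Representation ℂ H N}

theorem IsSumOf.apply_eq_self (h : IsSumOf ρ V σ) {g : H} (hg : ∀ x, σ g x = x) {v : M}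
    (hv : v ∈ V) : ρ g v = v := by
  obtain ⟨k, f, x, -, rfl, hf⟩ := h.exists_rep hv
  rw [hf]
  simp only [hg]

theorem IsSumOf.add_sum_eq_zero (h : IsSumOf ρ V σ) {g : Fin 3 → H}
    (hg : ∀ x, x + ∑ i, σ (g i) x = 0) {v : M} (hv : v ∈ V) : v + ∑ i, ρ (g i) v = 0 := by
  obtain ⟨k, f, x, -, rfl, hf⟩ := h.exists_rep hv
  simp only [hf]
  rw [← map_sum, ← map_add, ← map_zero f]
  congr 1
  funext j
  rw [Pi.add_apply, Finset.sum_apply]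
  exact hg (x j)

end SumApply

theorem GDecomposition.decomposes {M : Type*} [AddCommGroup M] [Module ℂ M]
    {ρ : Representation ℂ (OutF.G 3) M} {V : Fin 4 → Submodule ℂ M} (h : GDecomposition ρ V) :
    OutF.cubeFrameG.Decomposes ρ (OutF.symG 3) (SymRep.std 4) V (OutF.ΔG 3) OutF.rotateFour
      (Equiv.swap 0 1) where
  c_eq := rfl
  t_eq := rfl
  sign_pc := by decide
  sign_pt := by decide
  finrank_eq := Nat.succ_injective SymRep.finrank_sumZero
  trace_pc := by
    rw [SymRep.trace_std, show (Finset.univ.filter fun i => OutF.rotateFour⁻¹ i = i).card = 1 by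
      decide, Nat.cast_one, sub_self]
  trace_pt := by
    rw [SymRep.trace_std, show (Finset.univ.filter
      fun i : Fin 4 => (Equiv.swap 0 1)⁻¹ i = i).card = 2 by decide]
    norm_num
  -- Invariance under the three-cycle makes the first two coordinates equal, and these are the only
  -- ones interchanged by the transposition.
  apply_pt x hx := by
    have h1 : x.1 0 = x.1 1 := congrFun (congrArg Subtype.val hx) 1
    ext i
    fin_cases i
    exacts [h1.symm, h1, rfl, rfl]
  internal := h.internal
  nontrivial := h.nontrivial
  even := h.delta_even
  odd := h.delta_odd
  zero := h.zero
  one := h.one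
  two := h.two
  three := h.three
  sum_n x hx := by
    obtain ⟨y, hy, z, hz, rfl⟩ := Submodule.mem_sup.1 hx
    have h1 := h.one.add_sum_eq_zero SymRep.std_apply_doubleSwap hy
    have h2 := h.two.add_sum_eq_zero SymRep.signedStd_apply_doubleSwap hz
    simp only [map_add, Finset.sum_add_distrib]
    rw [add_add_add_comm]
    exact (congrArg₂ (· + ·) h1 h2).trans (add_zero 0)
  n_apply x hx i := by
    obtain ⟨y, hy, z, hz, rfl⟩ := Submodule.mem_sup.1 hx
    rw [map_add]
    exact congrArg₂ (· + ·) (h.zero.apply_eq_self (fun _ => rfl) hy)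
      (h.three.apply_eq_self (fun x => by
        rw [SymRep.det, SymRep.signTwist_apply, SymRep.sign_doubleSwap, Units.val_one,
          Int.cast_one, one_smul, SymRep.triv_apply]) hz)

theorem hasStandardRose_of_GDecomposition {X : CWGraph.{u, v}} (hX : X.HasRank 5)
    (a : GraphAction (OutF.G 3) X) (ha : a.Admissible) {V : Fin 4 → Submodule ℂ X.H₁}
    (h : GDecomposition (M := X.H₁) a.homologyRep V) : HasStandardRose a (OutF.permG 3) :=
  h.decomposes.hasStandardRose ha hX (Equiv.Perm.viaEmbeddingHom Fin.castSuccEmb)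
    (fun p => @Equiv.Perm.sign_extendDomain _ _ _ _ _ _ p _ (_) _)
    ⟨SymRep.extend, fun p => LinearMap.ext (SymRep.extend_std p)⟩ SymRep.extend_injective

theorem mainTheorem7 (X : CWGraph.{u, v}) (hX : X.HasRank 5) :
    (∀ a : GraphAction (OutF.W 3) X, a.Admissible → WDecomposition (M := X.H₁) a.homologyRep →
      HasStandardRose a (OutF.permW 3)) ∧
    (∀ a : GraphAction (OutF.G 3) X, a.Admissible →
      (∃ V : Fin 4 → Submodule ℂ X.H₁, GDecomposition (M := X.H₁) a.homologyRep V) →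
      HasStandardRose a (OutF.permG 3)) :=
  ⟨fun a ha h => hasStandardRose_of_WDecomposition hX a ha h,
    fun a ha ⟨_, h⟩ => hasStandardRose_of_GDecomposition hX a ha h⟩
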